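/- **Notation.** Let $n\ge 1$, and let $f\mapsto\bar f$ be the field automorphism of $\mathbb Q(q)$ with $q\mapsto q^{-1}$. Put $[2]=q+q^{-1}$. Let $\delta_1,\delta_2,\dots$ be a basis of a free abelian group, $\delta_{-r}=-\delta_r$, $\delta_0=0$, $\alpha_0=-\delta_1$, $\alpha_r=\delta_r-\delta_{r+1}$ $(r\ge1)$, and $(\delta_r,\delta_s)=2\delta_{rs}$ for $r,s\geq 1$. For $\lambda\in\mathbb Z^n$ put $\mathrm{wt}_s(\lambda)=\sum_{i\ge s}\delta_{\lambda_i}$, and write $\lambda\succeq\mu$ if $\mathrm{wt}_1(\lambda)=\mathrm{wt}_1(\mu)$ and $\mathrm{wt}_s(\lambda)-\mathrm{wt}_s(\mu)\in\sum_{r\ge0}\mathbb Z_{\ge0}\alpha_r$ for all $1\leq s\leq n$; this is a partial order (the Bruhat order). Let $\Lambda^+$ be the set of integer dominant weights, i.e. $\lambda\in\mathbb Z^n$ with $\lambda_1\ge\dots\ge\lambda_n$ in which only the part $0$ may be repeated, and $\Lambda^+_\times\subset\Lambda^+$ the set of those without zero parts. Let $z(\lambda)$ be the number of zero parts of $\lambda$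 and $w_0\lambda=(\lambda_n,\dots,\lambda_1)$. Let $\mathscr V$ be the natural $U_q(\mathfrak b_\infty)$-module with basis $v_a$ $(a\in\mathbb Z)$ and $K_iv_a=q^{(\alpha_i,\delta_a)}v_a$; $E_iv_{i+1}=v_i$, $E_iv_{-i}=v_{-i-1}$, $F_iv_i=v_{i+1}$, $F_iv_{-i-1}=v_{-i}$ $(i\ge1)$; $E_0v_1=v_0$, $E_0v_0=[2]v_{-1}$, $F_0v_{-1}=v_0$, $F_0v_0=[2]v_1$ (the other $E_iv_a$, $F_iv_a$ being $0$). Tensor products are formed with $\Delta(E_i)=1\otimes E_i+E_i\otimes K_i^{-1}$, $\Delta(F_i)=K_i\otimes F_i+F_i\otimes1$, $\Delta(K_i)=K_i\otimes K_i$. Let $N_\lambda=v_{\lambda_1}\otimes\dots\otimes v_{\lambda_n}$, $M_\lambda=[2]^{-z(\lambda)}N_\lambda$, and let $\widehat{\mathscr T}^n$ be the completion of $\mathscr V^{\otimes n}$ consisting of the formal sums $\sum c_\mu N_\mu$ whose support is bounded above by finitely many weights. It carries the antilinear bar involution given by $\overline{v_a}=v_a$ and $\overline{x\otimes v_a}=\Theta(\bar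 x\otimes v_a)$, where $\Theta$ is the quasi-$R$-matrix: $\Theta(x\otimes v_a)\in x\otimes v_a+\sum_{b>a}\cdots\otimes v_b$ and $\Delta(u)\Theta=\Theta\overline{\Delta(\bar u)}$ for all $u\in U_q(\mathfrak b_\infty)$. Let $L_\lambda$ be the dual canonical basis element: the unique bar-invariant element of $M_\lambda+\sum_{\mu\prec\lambda}q^{-1}\mathbb Z[q^{-1}]M_\mu$. Let $\mathscr F^n$ be the degree-$n$ part of the quotient of the tensor algebra of $\mathscr V$ by the ideal generated by the $U_q(\mathfrak b_\infty)$-submodule of $\mathscr V^{\otimes 2}$ generated by all $v_a\otimes v_a$, $a\ne0$, and $\widehat{\mathscr F}^n$ the corresponding quotient of $\widehat{\mathscr T}^n$, with the induced bar involution and $F_\lambda=v_{\lambda_n}\wedge\dots\wedge v_{\lambda_1}$ $(\lambda\in\Lambda^+)$. Let $U_\lambda=\sum_{\mu\in\Lambda^+} u_{\mu\lambda}(q)F_\mu$ be its canonical basis: the unique bar-invariant element of $F_\lambda+\sum_{\mu\succ\lambda}q\mathbb Z[q]F_\mu$. For $\lambda\in\Lambda^+$ put $$E_\lambda=\sum_{\mu\in\Lambda^+,\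 \lambda\succeq\mu}u_{-w_0\lambda,-w_0\mu}(q^{-1})\,L_\mu .$$ Let $\mathscr E^n=\sum_{\lambda\in\Lambda^+}\mathbb Q(q)E_\lambda\subset\widehat{\mathscr T}^n$, let $\mathscr E^{n,0}$ be the span of the $E_\lambda$ with $\lambda\in\Lambda^+\setminus\Lambda^+_\times$, and $\mathscr E^{n,\times}=\mathscr E^n/\mathscr E^{n,0}$ with projection $\pi$. Write $\mathbf E_\lambda=\pi(E_\lambda)$ and $\mathbf L_\lambda=\pi(L_\lambda)$ for $\lambda\in\Lambda^+_\times$. **Proposition.** The bar involution of $\widehat{\mathscr T}^n$ preserves $\mathscr E^n$ and $\mathscr E^{n,0}$, and hence induces an antilinear involution of $\mathscr E^{n,\times}$; all $L_\lambda$, $\lambda\in\Lambda^+$, lie in $\mathscr E^n$. The family $\{\mathbf L_\lambda\mid\lambda\in\Lambda^+_\times\}$ is the unique basis of $\mathscr E^{n,\times}$ such that, for all $\lambda\in\Lambda^+_\times$, $$\overline{\mathbf L_\lambda}=\mathbf L_\lambda\qquad\text{and}\qquad \mathbf L_\lambda\in\mathbf E_\lambda+\sum_{\mu\in\Lambda^+_\times,\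 \mu\prec\lambda}q^{-1}\mathbb Z[q^{-1}]\,\mathbf E_\mu .$$ -/

import Mathlib

/-! # The quotient of the dual Fock space of type `b_∞` without zero parts

Vectors of (completed) tensor spaces are written through their coordinates: a function
`c : (Fin n → ℤ) → ℚ(q)` stands for the formal sum `∑_λ c_λ N_λ`,
with `N_λ = v_{λ_1} ⊗ ⋯ ⊗ v_{λ_n}`. -/

namespace QueerFock

noncomputable section

/-! ## The ground field `ℚ(q)` and its bar involution -/

/-- The field `ℚ(q)`. -/
abbrev Qq : Type := RatFunc ℚ

/-- The indeterminate `q`. -/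
def q : Qq := RatFunc.X

/-- The quantum integer `[2] = q + q⁻¹`. -/
def two : Qq := q + q⁻¹

theorem aeval_inv_injective :
    Function.Injective (Polynomial.aeval (q⁻¹) : Polynomial ℚ →ₐ[ℚ] Qq) := by
  refine transcendental_iff_injective.mp fun h => ?_
  have hX := RatFunc.transcendental_X (K := ℚ)
  refine hX ?_
  convert IsAlgebraic.inv_iff.mp h using 1
  · exact Subsingleton.elim _ _
  · rfl

/-- The bar involution of `ℚ(q)`: the field homomorphism with `q ↦ q⁻¹`. -/
def barQ : Qq →+* Qq :=
  RatFunc.liftRingHom (Polynomial.aeval (q⁻¹) : Polynomial ℚ →ₐ[ℚ] Qq).toRingHom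
    (nonZeroDivisors_le_comap_nonZeroDivisors_of_injective _ aeval_inv_injective)

theorem barQ_q : barQ q = q⁻¹ := by
  have h := RatFunc.liftRingHom_algebraMap
    (φ := (Polynomial.aeval (q⁻¹) : Polynomial ℚ →ₐ[ℚ] Qq).toRingHom)
    (hφ := nonZeroDivisors_le_comap_nonZeroDivisors_of_injective _ aeval_inv_injective)
    (x := (Polynomial.X : Polynomial ℚ))
  rw [RatFunc.algebraMap_X] at h
  exact h.trans (Polynomial.aeval_X _)

/-- The set `q ℤ[q]`. -/
def qZ : Set Qq := {x | ∃ p : Polynomial ℤ, x = q * Polynomial.aeval q p}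

/-- The set `q⁻¹ ℤ[q⁻¹]`. -/
def qInvZ : Set Qq := {x | ∃ p : Polynomial ℤ, x = q⁻¹ * Polynomial.aeval q⁻¹ p}

/-! ## Weights and the Bruhat order -/

/-- Integer weights `λ = ∑ λ_i ε_i`. -/
abbrev Wt (n : ℕ) : Type := Fin n → ℤ

/-- `δ_a` for `a ∈ ℤ`, with `δ_{-r} = -δ_r` and `δ_0 = 0`, in the free abelian group on
`δ_1, δ_2, …` (the index `0` is never used). -/
def delta (a : ℤ) : ℕ →₀ ℤ := Finsupp.single a.natAbs a.sign

/-- The simple roots of type `b_∞`: `α_0 = -δ_1` and `α_r = δ_r - δ_{r+1}` for `r ≥ 1`. -/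
def alpha (r : ℕ) : ℕ →₀ ℤ := delta r - delta (r + 1)

/-- The non-negative integral combinations of simple roots. -/
def posCone : AddSubmonoid (ℕ →₀ ℤ) := AddSubmonoid.closure (Set.range alpha)

/-- `wt_s(λ) = ∑_{i ≥ s} δ_{λ_i}`. -/
def wtFrom {n : ℕ} (l : Wt n) (s : Fin n) : ℕ →₀ ℤ := ∑ i ∈ Finset.univ.filter (s ≤ ·), delta (l i)

/-- `wt(λ) = ∑_i δ_{λ_i}`. -/
def wt {n : ℕ} (l : Wt n) : ℕ →₀ ℤ := ∑ i, delta (l i)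

/-- The Bruhat order: `Succeq l m` means `l ⪰ m`. -/
def Succeq {n : ℕ} (l m : Wt n) : Prop :=
  wt l = wt m ∧ ∀ s, wtFrom l s - wtFrom m s ∈ posCone

/-- The number `z(λ)` of zero parts of `λ`. -/
def zeros {n : ℕ} (l : Wt n) : ℕ := (Finset.univ.filter fun i => l i = 0).card

/-- Integer dominant weights: weakly decreasing, and only the part `0` may be repeated. -/
def IsDominant {n : ℕ} (l : Wt n) : Prop :=
  ∀ i j, i < j → l j ≤ l i ∧ (l i = l j → l i = 0)

/-- All parts of `λ` are non-zero. -/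
def NoZero {n : ℕ} (l : Wt n) : Prop := ∀ i, l i ≠ 0

/-- The set of integer dominant weights with no zero parts. -/
abbrev DomX (n : ℕ) : Type := {l : Wt n // IsDominant l ∧ NoZero l}

/-- `w_0 λ = (λ_n, …, λ_1)`. -/
def w0 {n : ℕ} (l : Wt n) : Wt n := fun i => l i.rev

/-! ## The natural representation of `U_q(b_∞)` and its tensor powers

The bilinear form on weights is normalised by `(δ_r, δ_s) = 2 δ_{rs}`, so that `q_0 = q` and
`q_i = q²` for `i ≥ 1`. On the natural representation with basis `v_a`, `a ∈ ℤ`,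
`K_i v_a = q^{(α_i, δ_a)} v_a`, `E_i v_a = eCoef i a • v_{a-1}`, `F_i v_a = fCoef i a • v_{a+1}`. -/

/-- `(α_i, δ_a)`. -/
def pair (i : ℕ) (a : ℤ) : ℤ := 2 * (alpha i a.natAbs * a.sign)

/-- `E_i v_{i+1} = v_i` and `E_i v_{-i} = v_{-i-1}` for `i ≥ 1`;
`E_0 v_1 = v_0` and `E_0 v_0 = [2] v_{-1}`. -/
def eCoef (i : ℕ) (a : ℤ) : Qq :=
  if a = i + 1 then 1 else if a = -i then (if i = 0 then two else 1) else 0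

/-- `F_i v_i = v_{i+1}` and `F_i v_{-i-1} = v_{-i}` for `i ≥ 1`;
`F_0 v_0 = [2] v_1` and `F_0 v_{-1} = v_0`. -/
def fCoef (i : ℕ) (a : ℤ) : Qq :=
  if a = -i - 1 then 1 else if a = i then (if i = 0 then two else 1) else 0

/-- Formal infinite sums `∑_λ c_λ N_λ`. -/
abbrev FT (n : ℕ) : Type := Wt n → Qq

/-- Action of `E_i` on the `n`-th tensor power, for `Δ(E_i) = 1 ⊗ E_i + E_i ⊗ K_i⁻¹`:
`E_i N_λ = ∑_k q^{-∑_{l>k} (α_i, δ_{λ_l})} eCoef i λ_k • N_{λ - ε_k}`. -/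
def opE (n : ℕ) (i : ℕ) : Module.End Qq (FT n) where
  toFun c := fun m => ∑ k : Fin n,
    q ^ (-∑ l ∈ Finset.univ.filter (k < ·), pair i (m l)) * eCoef i (m k + 1)
      * c (Function.update m k (m k + 1))
  map_add' c d := by
    funext m; simp only [Pi.add_apply, mul_add, Finset.sum_add_distrib]
  map_smul' r c := by
    funext m
    simp only [Pi.smul_apply, smul_eq_mul, RingHom.id_apply, Finset.mul_sum]
    exact Finset.sum_congr rfl fun k _ => by ring

/-- Action of `F_i` on the `n`-th tensor power, for `Δ(F_i) = K_i ⊗ F_i + F_i ⊗ 1`: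
`F_i N_λ = ∑_k q^{∑_{l<k} (α_i, δ_{λ_l})} fCoef i λ_k • N_{λ + ε_k}`. -/
def opF (n : ℕ) (i : ℕ) : Module.End Qq (FT n) where
  toFun c := fun m => ∑ k : Fin n,
    q ^ (∑ l ∈ Finset.univ.filter (· < k), pair i (m l)) * fCoef i (m k - 1)
      * c (Function.update m k (m k - 1))
  map_add' c d := by
    funext m; simp only [Pi.add_apply, mul_add, Finset.sum_add_distrib]
  map_smul' r c := by
    funext m
    simp only [Pi.smul_apply, smul_eq_mul, RingHom.id_apply, Finset.mul_sum]
    exact Finset.sum_congr rfl fun k _ => by ring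

/-- Action of `K_i^ε`, `ε ∈ ℤ`, on the `n`-th tensor power: `K_i N_λ = q^{(α_i, wt λ)} N_λ`. -/
def opK (n : ℕ) (i : ℕ) (ε : ℤ) : Module.End Qq (FT n) where
  toFun c := fun m => q ^ (ε * ∑ l, pair i (m l)) * c m
  map_add' c d := by funext m; simp only [Pi.add_apply, mul_add]
  map_smul' r c := by
    funext m; simp only [Pi.smul_apply, smul_eq_mul, RingHom.id_apply]; ring

/-- The completion `T̂ⁿ` of the `n`-th tensor power: formal sums of `N_μ` whose support is bounded
above in the Bruhat order by finitely many weights. -/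
def THat (n : ℕ) : Submodule Qq (FT n) where
  carrier := {c | ∃ S : Finset (Wt n), ∀ m, c m ≠ 0 → ∃ l ∈ S, Succeq l m}
  zero_mem' := ⟨∅, fun m h => absurd rfl h⟩
  add_mem' := by
    classical
    rintro c d ⟨S, hS⟩ ⟨T, hT⟩
    refine ⟨S ∪ T, fun m h => ?_⟩
    by_cases hc : c m = 0
    · have hd : d m ≠ 0 := fun hd => h (by simp [hc, hd])
      obtain ⟨l, hl, h'⟩ := hT m hd
      exact ⟨l, Finset.mem_union_right _ hl, h'⟩
    · obtain ⟨l, hl, h'⟩ := hS m hc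
      exact ⟨l, Finset.mem_union_left _ hl, h'⟩
  smul_mem' := by
    rintro r c ⟨S, hS⟩
    exact ⟨S, fun m h => hS m fun hc => h (by simp [hc])⟩

/-! ## The quasi-R-matrix and the bar involution on `T̂ⁿ`

The quasi-R-matrix acts on `Tⁿ ⊗ V` as `Θ (x ⊗ v_a) = ∑_{b ≥ a} Θ_{b,a}(x) ⊗ v_b`. It is the unique
such operator with leading term `1 ⊗ 1` and `Δ(u) Θ = Θ Δ̄(u)` for all `u`, where
`Δ̄(u)` is the bar conjugate of `Δ` at the bar conjugate of `u`:
`Δ̄(E_i) = 1 ⊗ E_i + E_i ⊗ K_i`, `Δ̄(F_i) = K_i⁻¹ ⊗ F_i + F_i ⊗ 1`, `Δ̄(K_i) = K_i ⊗ K_i`. -/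

/-- `Θ = (Θ_{b,a})` is the quasi-R-matrix on `Tⁿ ⊗ V`. The last three fields compare the
coefficients of `v_b` in `Δ(u) Θ (x ⊗ v_a) = Θ Δ̄(u) (x ⊗ v_a)` for `u = E_i, F_i, K_i`. -/
structure IsQuasiR (n : ℕ) (Θ : ℤ → ℤ → Module.End Qq (FT n)) : Prop where
  diag : ∀ a, Θ a a = 1
  lower : ∀ b a, b < a → Θ b a = 0
  compE : ∀ (i : ℕ) (b a : ℤ),
    eCoef i (b + 1) • Θ (b + 1) a + q ^ (-pair i b) • (opE n i * Θ b a)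
      = eCoef i a • Θ b (a - 1) + q ^ (pair i a) • (Θ b a * opE n i)
  compF : ∀ (i : ℕ) (b a : ℤ),
    fCoef i (b - 1) • (opK n i 1 * Θ (b - 1) a) + opF n i * Θ b a
      = fCoef i a • (Θ b (a + 1) * opK n i (-1)) + Θ b a * opF n i
  compK : ∀ (i : ℕ) (b a : ℤ),
    q ^ (pair i b) • (opK n i 1 * Θ b a) = q ^ (pair i a) • (Θ b a * opK n i 1)

open scoped Classical in
/-- The quasi-R-matrix on `Tⁿ ⊗ V`. -/
def quasiR (n : ℕ) : ℤ → ℤ → Module.End Qq (FT n) :=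
  if h : ∃ Θ, IsQuasiR n Θ then h.choose else 0

/-- The (antilinear, continuous) bar involution on `T̂ⁿ`: it fixes `v_a`, and
on `Tⁿ ⊗ V` it maps `x ⊗ v_a` to `Θ (x̄ ⊗ v_a)`. -/
def bar : (n : ℕ) → FT n → FT n
  | 0, c => fun m => barQ (c m)
  | n + 1, c => fun m =>
      ∑ᶠ a : ℤ, quasiR n (m (Fin.last n)) a
        (bar n fun l => c (Fin.snoc (α := fun _ => ℤ) l a)) (fun i => m i.castSucc)

/-! ## The dual canonical basis of `T̂ⁿ` -/

/-- `x` is the dual canonical basis element `L_λ`: it is bar-invariant and lies in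
`M_λ + ∑_{μ ≺ λ} q⁻¹ℤ[q⁻¹] M_μ`, where `M_μ = (q + q⁻¹)^{-z(μ)} N_μ`. -/
structure IsDualCanonical {n : ℕ} (l : Wt n) (x : FT n) : Prop where
  bar_eq : bar n x = x
  leading : x l = two⁻¹ ^ zeros l
  support : ∀ m, x m ≠ 0 → Succeq l m
  coeff : ∀ m, m ≠ l → ∃ p ∈ qInvZ, x m = p * two⁻¹ ^ zeros m

open scoped Classical in
/-- The dual canonical basis `L_λ` of `T̂ⁿ`. -/
def dualCan {n : ℕ} (l : Wt n) : FT n :=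
  if h : ∃ x, IsDualCanonical l x then h.choose else 0

/-! ## The `q`-exterior power `F̂ⁿ` and its canonical basis -/

/-- The quadratic relations of the `q`-exterior algebra of the natural representation, as elements
of `V ⊗ V` (coordinates with respect to `v_a ⊗ v_b`), one for each `a ≥ b` with `(a, b) ≠ (0, 0)`:
`v_a ⊗ v_a` for `a ≠ 0`; `v_a ⊗ v_b + q² v_b ⊗ v_a` for `a > b`, `a + b ≠ 0`;
`v_1 ⊗ v_{-1} + q v_0 ⊗ v_0 + q⁴ v_{-1} ⊗ v_1`; and
`v_a ⊗ v_{-a} + q² (v_{a-1} ⊗ v_{1-a} + v_{1-a} ⊗ v_{a-1}) + q⁴ v_{-a} ⊗ v_a` for `a ≥ 2`.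
They span the submodule of `V ⊗ V` generated by the `v_a ⊗ v_a` with `a ≠ 0`. -/
def wedgeRel (a b : ℤ) : ℤ × ℤ →₀ Qq :=
  if b < a then
    if a + b ≠ 0 then Finsupp.single (a, b) 1 + Finsupp.single (b, a) (q ^ 2)
    else if a = 1 then
      Finsupp.single (1, -1) 1 + Finsupp.single (0, 0) q
        + Finsupp.single (-1, 1) (q ^ 4)
    else
      Finsupp.single (a, -a) 1 + Finsupp.single (a - 1, 1 - a) (q ^ 2)
        + Finsupp.single (1 - a, a - 1) (q ^ 2) + Finsupp.single (-a, a) (q ^ 4)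
  else if a = b ∧ a ≠ 0 then Finsupp.single (a, a) 1
  else 0

open scoped Classical in
/-- The relation for `(λ_k, λ_{k+1})` placed in the tensor positions `k, k+1`, with the remaining
tensor factors `v_{λ_j}`. -/
def relAt {n : ℕ} (k : Fin n) (hk : (k : ℕ) + 1 < n) (l : Wt n) : FT n := fun m =>
  if ∀ j, j ≠ k → j ≠ ⟨k + 1, hk⟩ → m j = l j then
    wedgeRel (l k) (l ⟨k + 1, hk⟩) (m k, m ⟨k + 1, hk⟩)
  else 0

/-- The kernel of `T̂ⁿ → F̂ⁿ`: the completion of the degree-`n` part of the two-sided ideal generated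
by the quadratic relations, that is, the span of the sums `∑_λ c_λ r_λ` with `c ∈ T̂ⁿ`,
`r_λ` being the relation placed in positions `k, k+1`. -/
def wedgeKer (n : ℕ) : Submodule Qq (FT n) :=
  Submodule.span Qq {x | ∃ (k : Fin n) (hk : (k : ℕ) + 1 < n), ∃ c ∈ THat n,
    x = fun m => ∑ᶠ l : Wt n, c l * relAt k hk l m}

/-- `u = (u_μ)` is the coefficient family of the canonical basis element `U_λ = ∑_μ u_μ F_μ` of `F̂ⁿ`,
where `F_μ = v_{μ_n} ∧ ⋯ ∧ v_{μ_1}` is the image of `N_{w_0 μ}`: `U_λ` is bar-invariant and lies in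
`F_λ + ∑_{μ ≻ λ} qℤ[q] F_μ`. The function `fun ν => u (w0 ν)` is `∑_μ u_μ N_{w_0 μ}`, a lift of
`U_λ` to `T̂ⁿ`; the bar involution of `F̂ⁿ` is induced by that of `T̂ⁿ`. -/
structure IsCanonicalWedge {n : ℕ} (l : Wt n) (u : Wt n → Qq) : Prop where
  bar_eq : bar n (fun ν => u (w0 ν)) - (fun ν => u (w0 ν)) ∈ wedgeKer n
  leading : u l = 1
  support : ∀ m, u m ≠ 0 → IsDominant m ∧ Succeq m l
  coeff : ∀ m, m ≠ l → u m ∈ qZ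

open scoped Classical in
/-- `uCoef μ λ` is the coefficient `u_{μλ}(q)` of `F_μ` in the canonical basis element `U_λ`. -/
def uCoef {n : ℕ} (m l : Wt n) : Qq :=
  if h : ∃ u, IsCanonicalWedge l u then h.choose m else 0

/-! ## The space `Eⁿ` and its quotient -/

/-- `E_λ = ∑_{μ dominant, λ ⪰ μ} u_{-w_0 λ, -w_0 μ}(q⁻¹) L_μ`. -/
def stdE {n : ℕ} (l : Wt n) : FT n :=
  ∑ᶠ (m : Wt n) (_ : IsDominant m ∧ Succeq l m),
    barQ (uCoef (-w0 l) (-w0 m)) • dualCan m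

/-- `Eⁿ`, the span of the `E_λ` for `λ` dominant. -/
def En (n : ℕ) : Submodule Qq (FT n) :=
  Submodule.span Qq {x | ∃ l : Wt n, IsDominant l ∧ x = stdE l}

/-- `E^{n,0}`, the span of the `E_λ` for `λ` dominant with at least one zero part. -/
def En0 (n : ℕ) : Submodule Qq (FT n) :=
  Submodule.span Qq {x | ∃ l : Wt n, (IsDominant l ∧ ¬ NoZero l) ∧ x = stdE l}

/-- `E^{n,×} = Eⁿ / E^{n,0}`. -/
abbrev EnX (n : ℕ) : Type := ↥(En n) ⧸ (En0 n).submoduleOf (En n)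

/-- The canonical projection `Eⁿ → E^{n,×}`. -/
def proj (n : ℕ) : ↥(En n) →ₗ[Qq] EnX n := ((En0 n).submoduleOf (En n)).mkQ

theorem stdE_mem {n : ℕ} (l : DomX n) : stdE l.1 ∈ En n :=
  Submodule.subset_span ⟨l.1, l.2.1, rfl⟩

/-- `𝐄_λ`, the image of `E_λ` in `E^{n,×}`. -/
def bfE {n : ℕ} (l : DomX n) : EnX n := proj n ⟨stdE l.1, stdE_mem l⟩

/-- The family `B` is a basis of `E^{n,×}` whose members are invariant under `β` and satisfy
`B_λ ∈ 𝐄_λ + ∑_{μ ≺ λ} q⁻¹ℤ[q⁻¹] 𝐄_μ`. -/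
structure IsBarBasis {n : ℕ} (β : EnX n →ₛₗ[barQ] EnX n) (B : DomX n → EnX n) : Prop where
  linearIndependent : LinearIndependent Qq B
  span_eq_top : Submodule.span Qq (Set.range B) = ⊤
  bar_eq : ∀ l, β (B l) = B l
  triangular : ∀ l, B l - bfE l ∈ AddSubgroup.closure
    {y | ∃ m : DomX n, Succeq l.1 m.1 ∧ m ≠ l ∧ ∃ p ∈ qInvZ, y = p • bfE m}

end

end QueerFock

/-!
The first point is that none of the objects defined by choice is a junk value. The `R`-matrix of the
natural representation `V` of `U_q(b_∞)` is explicit (`locR`): its off-diagonal part is the strictly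
triangular part of a flip and of an operator of rank one given by an invariant vector. Fusing copies
of it (`rker`) and dividing by its diagonal part gives an operator on `Tⁿ ⊗ V` which satisfies the
defining relations of the quasi-`R`-matrix (`isQuasiR_thetaOp`), and these relations have only one
solution, since the `E_i` move along the chain `… ← v_a ← v_{a+1} ← …` with non-zero coefficients
(`IsQuasiR.unique`). So the bar map of `T̂ⁿ` is known explicitly. It commutes with `E_i` and `F_i`,
it squares to the identity (`bar_bar`), because its square is linear, commutes with the `E_i` and
has the right leading term, and its matrix is unitriangular for the Bruhat order, with entries in
`ℤ[q, q⁻¹]` both for the basis `N_λ` and for the basis `M_λ` (`barKer_mem`). Bruhat intervals are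
finite, and the usual recursion produces the `L_λ`, and likewise bar-invariant vectors in `N_λ +
∑_{μ ≺ λ} qℤ[q] N_μ` (`exists_bar_invariant`).

To obtain the canonical basis of the `q`-exterior power one needs that the bar involution preserves
the completed space of relations. This space is described by linear conditions on the coordinates in
two adjacent tensor positions (`IsRel`, `relSpace`). The conditions are stable under the quantum
group; for `n = 2` they are stable under the bar involution by a direct calculation, and tensor
factors are added on the right by means of the `E_i`, and on the left by means of the `F_i`
(`isStable_relSpace`). Straightening the bar-invariant vector with leading term `N_{w_0 λ}` modulo
the relations, whose non-leading coefficients lie in `qℤ[q]`, gives `U_λ`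
(`exists_isCanonicalWedge`).

Consequently `E_λ ∈ L_λ + ∑_{μ ≺ λ} q⁻¹ℤ[q⁻¹] L_μ`, a finite sum, since only finitely many dominant
weights lie below a given one. Going down in the Bruhat order on dominant weights never decreases
the number of zero parts (`zeros_le_of_succeq`). So `Eⁿ` and `E^{n,0}` are spanned by the `L_λ` with
`λ` dominant, respectively dominant with a zero part (`span_stdE`). All claims about the bar
involution and the basis property of the `𝐋_λ` follow; inverting the triangular relation between the
`E_λ` and the `L_λ` shows that `𝐋_λ` has the required form. Two families with the stated properties
differ by bar-invariant combinations of the `𝐋_μ` with coefficients in `q⁻¹ℤ[q⁻¹]`, and such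
combinations vanish, because `q⁻¹ℤ[q⁻¹]` contains no bar-invariant element except `0`.
-/

namespace QueerFock

noncomputable section

/-! ### The `R`-matrix of the natural representation -/

theorem q_ne_zero : q ≠ 0 := RatFunc.X_ne_zero

theorem two_ne_zero' : two ≠ 0 := by
  intro h
  have hq := q_ne_zero
  have h2 : q ^ 2 + 1 = 0 := by
    have : q * two = 0 := by rw [h, mul_zero]
    rw [two] at this
    field_simp at this
    exact this
  have h3 : (algebraMap (Polynomial ℚ) Qq) (Polynomial.X ^ 2 + 1) = 0 := by
    simpa [q] using h2
  rw [map_eq_zero_iff _ (RatFunc.algebraMap_injective ℚ)] at h3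
  have := congrArg (Polynomial.eval 0) h3
  simp at this

theorem eCoef_top (i : ℕ) : eCoef i (i + 1) = 1 := by simp [eCoef]

theorem eCoef_of_ne {i : ℕ} {a : ℤ} (h₁ : a ≠ i + 1) (h₂ : a ≠ -i) : eCoef i a = 0 := by
  simp [eCoef, h₁, h₂]

theorem eCoef_bot {i : ℕ} (h : i ≠ 0) : eCoef i (-i) = 1 := by
  have : ¬ (-(i : ℤ) = i + 1) := by omega
  simp [eCoef, h, this]

theorem fCoef_eq (i : ℕ) (a : ℤ) : fCoef i a = eCoef i (-a) := by
  unfold fCoef eCoef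
  have h1 : (a = -(i : ℤ) - 1) ↔ (-a = (i : ℤ) + 1) := by omega
  have h2 : (a = (i : ℤ)) ↔ (-a = -(i : ℤ)) := by omega
  simp only [h1, h2]

/-- The value of `(α_i, δ_a)`, case by case. -/
theorem pair_eq (i : ℕ) (a : ℤ) :
    pair i a = (if a = i ∧ a ≠ 0 then 2 else 0) - (if a = -i ∧ a ≠ 0 then 2 else 0)
      - (if a = i + 1 then 2 else 0) + (if a = -i - 1 then 2 else 0) := by
  unfold pair alpha delta
  have h1 : ((i : ℤ)).natAbs = i := by omega
  have h2 : ((i : ℤ) + 1).natAbs = i + 1 := by omega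
  have h3 : ((i : ℤ) + 1).sign = 1 := Int.sign_eq_one_of_pos (by omega)
  rw [h1, h2, h3]
  simp only [Finsupp.coe_sub, Pi.sub_apply, Finsupp.single_apply]
  rcases lt_trichotomy a 0 with ha | ha | ha
  · rw [Int.sign_eq_neg_one_of_neg ha]
    rcases Nat.eq_zero_or_pos i with hi | hi
    · subst hi; simp; split_ifs <;> omega
    · rw [Int.sign_eq_one_of_pos (by omega)]; split_ifs <;> omega
  · subst ha; simp; split_ifs <;> omega
  · rw [Int.sign_eq_one_of_pos ha]
    rcases Nat.eq_zero_or_pos i with hi | hi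
    · subst hi; simp; split_ifs <;> omega
    · rw [Int.sign_eq_one_of_pos (by omega)]; split_ifs <;> omega

theorem pair_neg (i : ℕ) (a : ℤ) : pair i (-a) = -pair i a := by
  unfold pair; simp

/-- The coefficients of an invariant vector `∑_b κ_b v_{-b} ⊗ v_b` of the (completed) tensor square
of the natural representation. -/
def kap (b : ℤ) : Qq :=
  if 1 ≤ b then (-q ^ (-2 : ℤ)) ^ b
  else if b = 0 then q ^ (-2 : ℤ) / two
  else q ^ (-2 : ℤ) * (-q ^ (-2 : ℤ)) ^ b

theorem kap_ne_zero (b : ℤ) : kap b ≠ 0 := by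
  have hq := q_ne_zero
  have h2 := two_ne_zero'
  have h3 : -q ^ (-2 : ℤ) ≠ 0 := neg_ne_zero.2 (zpow_ne_zero _ hq)
  unfold kap
  split_ifs
  · exact zpow_ne_zero _ h3
  · exact div_ne_zero (zpow_ne_zero _ hq) h2
  · exact mul_ne_zero (zpow_ne_zero _ hq) (zpow_ne_zero _ h3)

theorem kap_add_one {b : ℤ} (h₀ : b ≠ 0) (h₁ : b ≠ -1) :
    kap (b + 1) = -q ^ (-2 : ℤ) * kap b := by
  have h3 : -q ^ (-2 : ℤ) ≠ 0 := neg_ne_zero.2 (zpow_ne_zero _ q_ne_zero)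
  unfold kap
  rcases lt_or_ge b 0 with h | h
  · rw [if_neg (by omega), if_neg (by omega), if_neg (by omega), if_neg (by omega),
      zpow_add_one₀ h3]
    ring
  · rw [if_pos (by omega), if_pos (by omega), zpow_add_one₀ h3, mul_comm]

theorem kap_zero : kap 0 = q ^ (-2 : ℤ) / two := by simp [kap]
theorem kap_one : kap 1 = -q ^ (-2 : ℤ) := by simp [kap]
theorem kap_neg_one : kap (-1) = -1 := by
  have hq : q ≠ 0 := q_ne_zero
  simp [kap, zpow_ofNat]
  field_simp

/-- `(δ_a, δ_b)`. -/
def dform (a b : ℤ) : ℤ :=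
  (if a = b ∧ a ≠ 0 then 2 else 0) - (if a = -b ∧ a ≠ 0 then 2 else 0)

/-- The `R`-matrix of the natural representation of `U_q(b_∞)`: the coefficient of `v_p ⊗ v_b` in
the image of `v_{p'} ⊗ v_c`. The second summand flips the factors; the third comes from the
invariant vector `∑_b κ_b v_{-b} ⊗ v_b`. -/
def locR (b c p p' : ℤ) : Qq :=
  (if b = c ∧ p = p' then q ^ dform p' c else 0)
  + (if c < b ∧ p = c ∧ p' = b then q ^ (2 : ℤ) - q ^ (-2 : ℤ) else 0)
  - (if c < b ∧ p = -b ∧ p' = -c then (q ^ (2 : ℤ) - q ^ (-2 : ℤ)) * (kap b / kap c) else 0)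

theorem eCoef_cases (i : ℕ) (a : ℤ) : a = i + 1 ∨ a = -i ∨ (a ≠ i + 1 ∧ a ≠ -i) := by
  by_cases h : a = i + 1
  · exact Or.inl h
  · by_cases h' : a = -i
    · exact Or.inr (Or.inl h')
    · exact Or.inr (Or.inr ⟨h, h'⟩)

theorem kap_pred {b : ℤ} (h₀ : b ≠ 0) (h₁ : b ≠ 1) :
    kap b = -q ^ (-2 : ℤ) * kap (b - 1) := by
  have := kap_add_one (b := b - 1) (by omega) (by omega)
  rwa [sub_add_cancel] at this

theorem locR_of_ne {b c p p' : ℤ} (h : p + b ≠ p' + c) : locR b c p p' = 0 := by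
  unfold locR
  rw [if_neg (by omega), if_neg (by omega), if_neg (by omega)]
  simp

theorem locR_of_eq {b c p p' : ℤ} (h : p + b = p' + c) :
    locR b c p p' =
      (if b = c then q ^ dform p c else 0)
      + (if c < b ∧ p = c then q ^ (2 : ℤ) - q ^ (-2 : ℤ) else 0)
      - (if c < b ∧ p = -b then (q ^ (2 : ℤ) - q ^ (-2 : ℤ)) * (kap b / kap c) else 0) := by
  unfold locR
  have h1 : (b = c ∧ p = p') ↔ b = c := by omega
  have h2 : (c < b ∧ p = c ∧ p' = b) ↔ (c < b ∧ p = c) := by omega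
  have h3 : (c < b ∧ p = -b ∧ p' = -c) ↔ (c < b ∧ p = -b) := by omega
  simp only [h1, h2, h3]
  congr 2
  split_ifs with h4
  · rw [show p' = p by omega]
  · rfl

set_option maxHeartbeats 4000000 in
/-- The compatibility of the `R`-matrix with `E_i` for `i ≥ 1`: a case distinction according
to which of the vectors involved are annihilated by `E_i`. -/
theorem locR_E_pos (i : ℕ) (hi : i ≠ 0) (b c p p' : ℤ) :
    eCoef i (b + 1) * locR (b + 1) c p p' + q ^ (-pair i b) * eCoef i (p + 1) * locR b c (p + 1) p'
      = eCoef i c * locR b (c - 1) p p' * q ^ (-pair i p') + eCoef i p' * locR b c p (p' - 1) := by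
  by_cases hw : p + b + 1 = p' + c
  swap
  · rw [locR_of_ne (by omega), locR_of_ne (by omega), locR_of_ne (by omega), locR_of_ne (by omega)]
    ring
  rw [locR_of_eq (by omega), locR_of_eq (by omega), locR_of_eq (by omega), locR_of_eq (by omega)]
  have hq := q_ne_zero
  have n1 := kap_ne_zero b
  have n2 := kap_ne_zero c
  have n3 := kap_ne_zero (c - 1)
  rcases eCoef_cases i (b+1) with hb | hb | ⟨hb, hb'⟩ <;>
  rcases eCoef_cases i (p+1) with hp | hp | ⟨hp, hp'⟩ <;>
  rcases eCoef_cases i c with hc | hc | ⟨hc, hc'⟩ <;>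
  rcases eCoef_cases i p' with hd | hd | ⟨hd, hd'⟩ <;>
  (try omega) <;>
  (first
    | (have e1 : eCoef i (b+1) = 1 := by
        rw [hb]; first | exact eCoef_top i | exact eCoef_bot hi
       rw [kap_add_one (b := b) (by omega) (by omega)])
    | have e1 : eCoef i (b+1) = 0 := eCoef_of_ne hb hb') <;>
  (first
    | have e2 : eCoef i (p+1) = 1 := by
        rw [hp]; first | exact eCoef_top i | exact eCoef_bot hi
    | have e2 : eCoef i (p+1) = 0 := eCoef_of_ne hp hp') <;>
  (first
    | (have e3 : eCoef i c = 1 := by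
        rw [hc]; first | exact eCoef_top i | exact eCoef_bot hi
       rw [kap_pred (b := c) (by omega) (by omega)])
    | have e3 : eCoef i c = 0 := eCoef_of_ne hc hc') <;>
  (first
    | have e4 : eCoef i p' = 1 := by
        rw [hd]; first | exact eCoef_top i | exact eCoef_bot hi
    | have e4 : eCoef i p' = 0 := eCoef_of_ne hd hd') <;>
  rw [e1, e2, e3, e4] <;>
  simp (disch := omega) only [dform, pair_eq, if_pos, if_neg, zero_mul, mul_zero, one_mul, mul_one,
    add_zero, zero_add, sub_zero, zero_sub, neg_neg, sub_self, neg_zero, zpow_zero] <;>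
  (try split_ifs) <;> (try omega) <;>
  (first
    | (have h : c = b := by omega
       subst h
       try rw [kap_pred (b := c) (by omega) (by omega)])
    | skip) <;> field_simp <;> ring

set_option maxHeartbeats 4000000 in
/-- The compatibility of the `R`-matrix with `E_0`. -/
theorem locR_E_zero (b c p p' : ℤ) :
    eCoef 0 (b + 1) * locR (b + 1) c p p' + q ^ (-pair 0 b) * eCoef 0 (p + 1) * locR b c (p + 1) p'
      = eCoef 0 c * locR b (c - 1) p p' * q ^ (-pair 0 p') + eCoef 0 p' * locR b c p (p' - 1) := by
  by_cases hw : p + b + 1 = p' + c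
  swap
  · rw [locR_of_ne (by omega), locR_of_ne (by omega), locR_of_ne (by omega), locR_of_ne (by omega)]
    ring
  rw [locR_of_eq (by omega), locR_of_eq (by omega), locR_of_eq (by omega), locR_of_eq (by omega)]
  have hq := q_ne_zero
  have n1 := kap_ne_zero b
  have n2 := kap_ne_zero c
  have h2 : q ^ 2 + 1 ≠ 0 := by
    intro h
    apply two_ne_zero'
    unfold two
    field_simp
    simpa using h
  have n3 := kap_ne_zero (c - 1)
  have t0 : eCoef 0 0 = two := by simp [eCoef]
  have t1 : eCoef 0 1 = 1 := by simp [eCoef]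
  have ec := eCoef_cases 0
  simp only [Nat.cast_zero, neg_zero, zero_add] at ec
  rcases ec (b+1) with hb | hb | ⟨hb, hb'⟩ <;>
  rcases ec (p+1) with hp | hp | ⟨hp, hp'⟩ <;>
  rcases ec c with hc | hc | ⟨hc, hc'⟩ <;>
  rcases ec p' with hd | hd | ⟨hd, hd'⟩ <;>
  (try omega) <;>
  (first
    | (have h : b = 0 := by omega
       subst h
       rw [zero_add, t1])
    | (have h : b = -1 := by omega
       subst h
       rw [show (-1 + 1 : ℤ) = 0 by norm_num, t0])
    | rw [eCoef_of_ne (i := 0) (a := b + 1) (by simpa using hb) (by simpa using hb')]) <;>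
  (first
    | (have h : p = 0 := by omega
       subst h
       rw [zero_add, t1])
    | (have h : p = -1 := by omega
       subst h
       rw [show (-1 + 1 : ℤ) = 0 by norm_num, t0])
    | rw [eCoef_of_ne (i := 0) (a := p + 1) (by simpa using hp) (by simpa using hp')]) <;>
  (first
    | (have h : c = 1 := by omega
       subst h
       rw [t1])
    | (have h : c = 0 := by omega
       subst h
       rw [t0])
    | rw [eCoef_of_ne (i := 0) (a := c) (by simpa using hc) (by simpa using hc')]) <;>
  (first
    | (have h : p' = 1 := by omega
       subst h
       rw [t1])
    | (have h : p' = 0 := by omega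
       subst h
       rw [t0])
    | rw [eCoef_of_ne (i := 0) (a := p') (by simpa using hd) (by simpa using hd')]) <;>
  simp (disch := omega) only [dform, pair_eq, if_pos, if_neg, zero_mul, mul_zero, one_mul, mul_one,
    add_zero, zero_add, sub_zero, zero_sub, neg_neg, sub_self, neg_zero, zpow_zero, Nat.cast_zero,
    and_true, true_and, and_false, false_and, if_true, if_false, ne_eq, not_true, not_false_iff,
    Int.reduceLT, Int.reduceEq, Int.reduceNeg] <;>
  (try split_ifs) <;> (try omega) <;>
  (first
    | (have h : c = -1 := by omega
       subst h)
    | (have h : b = 1 := by omega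
       subst h)
    | skip) <;>
  (try simp only [kap_zero, kap_one, kap_neg_one, two]) <;> field_simp <;> ring

/-- The `R`-matrix of the natural representation intertwines the two coproducts of `E_i`. -/
theorem locR_E (i : ℕ) (b c p p' : ℤ) :
    eCoef i (b + 1) * locR (b + 1) c p p' + q ^ (-pair i b) * eCoef i (p + 1) * locR b c (p + 1) p'
      = eCoef i c * locR b (c - 1) p p' * q ^ (-pair i p')
        + eCoef i p' * locR b c p (p' - 1) := by
  rcases eq_or_ne i 0 with rfl | hi
  · exact locR_E_zero b c p p'
  · exact locR_E_pos i hi b c p p'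

theorem dform_comm (a b : ℤ) : dform a b = dform b a := by
  unfold dform; split_ifs <;> omega

theorem dform_neg (a b : ℤ) : dform (-a) (-b) = dform a b := by
  unfold dform; split_ifs <;> omega

/-- The symmetry of the `R`-matrix under `v_a ↦ v_{-a}` and the flip of the two factors, which
interchanges the actions of `E_i` and `F_i`. -/
theorem locR_symm (b c p p' : ℤ) : locR (-p) (-p') (-b) (-c) = locR b c p p' := by
  unfold locR
  have h1 : (-p = -p' ∧ -b = -c) ↔ (b = c ∧ p = p') := by omega
  have h2 : (-p' < -p ∧ -b = -p' ∧ -c = -p) ↔ (c < b ∧ p = c ∧ p' = b) := by omega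
  have h3 : (-p' < -p ∧ -b = - -p ∧ -c = - -p') ↔ (c < b ∧ p = -b ∧ p' = -c) := by omega
  simp only [h1, h2, h3, dform_neg, dform_comm c p']
  congr 1
  split_ifs with h
  · rw [h.2.1, h.2.2, neg_neg, neg_neg]
  · rfl

/-- The `R`-matrix of the natural representation intertwines the two coproducts of `F_i`. -/
theorem locR_F (i : ℕ) (b c p p' : ℤ) :
    fCoef i (b - 1) * q ^ pair i p * locR (b - 1) c p p' + fCoef i (p - 1) * locR b c (p - 1) p'
      = fCoef i c * locR b (c + 1) p p' + fCoef i p' * q ^ pair i c * locR b c p (p' + 1) := by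
  have h := locR_E i (-p) (-p') (-b) (-c)
  have e1 : (-p : ℤ) + 1 = -(p - 1) := by ring
  have e2 : (-b : ℤ) + 1 = -(b - 1) := by ring
  have e3 : (-p' : ℤ) - 1 = -(p' + 1) := by ring
  have e4 : (-c : ℤ) - 1 = -(c + 1) := by ring
  rw [e1, e2, e3, e4, locR_symm, locR_symm, locR_symm, locR_symm, pair_neg, pair_neg, neg_neg,
    neg_neg, ← fCoef_eq, ← fCoef_eq, ← fCoef_eq, ← fCoef_eq] at h
  linear_combination h

/-! ### The Bruhat order through tail sums -/

/-- The sum of the coefficients of `δ_s`, `s > r`, in `δ_a`. -/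
def lev (r : ℕ) (a : ℤ) : ℤ := (if (r : ℤ) < a then 1 else 0) - (if a < -r then 1 else 0)

/-- The sum of the coefficients of `δ_s`, `s > r`, in `∑_{i ≥ t} δ_{λ_i}` (positions counted
from `0`). -/
def tl {n : ℕ} (l : Wt n) (t r : ℕ) : ℤ := ∑ i : Fin n, if t ≤ (i : ℕ) then lev r (l i) else 0

theorem lev_mono (r : ℕ) {a b : ℤ} (h : a ≤ b) : lev r a ≤ lev r b := by
  unfold lev; split_ifs <;> omega

theorem lev_neg (r : ℕ) (a : ℤ) : lev r (-a) = -lev r a := by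
  unfold lev; split_ifs <;> omega

theorem lev_eq_zero {r : ℕ} {a : ℤ} (h : a.natAbs ≤ r) : lev r a = 0 := by
  unfold lev; split_ifs <;> omega

theorem natAbs_le_of_lev {r : ℕ} {a : ℤ} (h : lev r a = 0) : a.natAbs ≤ r := by
  unfold lev at h; split_ifs at h <;> omega

theorem le_of_lev_le {a b : ℤ} (h : ∀ r, lev r a ≤ lev r b) : a ≤ b := by
  by_contra hab
  push Not at hab
  rcases le_or_gt 0 b with hb | hb
  · have := h b.toNat
    unfold lev at this; split_ifs at this <;> omega
  · have := h (b + 1).natAbs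
    unfold lev at this; split_ifs at this <;> omega

theorem eq_of_lev_eq {a b : ℤ} (h : ∀ r, lev r a = lev r b) : a = b :=
  le_antisymm (le_of_lev_le fun r => (h r).le) (le_of_lev_le fun r => (h r).ge)

/-- The sum of the coefficients of `x` with index greater than `r`. -/
def tailSum (r : ℕ) : (ℕ →₀ ℤ) →+ ℤ :=
  Finsupp.liftAddHom fun s => if r < s then AddMonoidHom.id ℤ else 0

theorem tailSum_single (r s : ℕ) (x : ℤ) :
    tailSum r (Finsupp.single s x) = if r < s then x else 0 := by
  simp only [tailSum, Finsupp.liftAddHom_apply_single]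
  split_ifs <;> rfl

theorem tailSum_delta (r : ℕ) (a : ℤ) : tailSum r (delta a) = lev r a := by
  rw [delta, tailSum_single]
  unfold lev
  rcases lt_trichotomy a 0 with h | h | h
  · rw [Int.sign_eq_neg_one_of_neg h]; split_ifs <;> omega
  · subst h; simp
  · rw [Int.sign_eq_one_of_pos h]; split_ifs <;> omega

theorem tailSum_alpha (r i : ℕ) : tailSum r (alpha i) = if r = i then -1 else 0 := by
  rw [alpha, map_sub, tailSum_delta, tailSum_delta]
  unfold lev; split_ifs <;> omega

theorem apply_eq_tailSum (f : ℕ →₀ ℤ) (s : ℕ) : f (s + 1) = tailSum s f - tailSum (s + 1) f := by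
  induction f using Finsupp.induction_linear with
  | zero => simp
  | add f g hf hg =>
    rw [map_add (tailSum s), map_add (tailSum (s + 1)), Finsupp.add_apply, hf, hg]
    ring
  | single a b =>
    rw [tailSum_single, tailSum_single, Finsupp.single_apply]
    split_ifs <;> omega

theorem ext_of_tailSum {f g : ℕ →₀ ℤ} (h0 : f 0 = g 0) (h : ∀ r, tailSum r f = tailSum r g) :
    f = g := by
  ext s
  cases s with
  | zero => exact h0
  | succ s => rw [apply_eq_tailSum, apply_eq_tailSum, h, h]

theorem delta_apply_zero (a : ℤ) : delta a 0 = 0 := by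
  rw [delta, Finsupp.single_apply]
  split_ifs with h
  · have : a = 0 := by omega
    subst this; rfl
  · rfl

theorem alpha_apply_zero (i : ℕ) : alpha i 0 = 0 := by
  rw [alpha, Finsupp.sub_apply, delta_apply_zero, delta_apply_zero, sub_zero]

theorem exists_tailSum_eq_zero (f : ℕ →₀ ℤ) : ∃ N, ∀ r, N ≤ r → tailSum r f = 0 := by
  induction f using Finsupp.induction_linear with
  | zero => exact ⟨0, fun r _ => map_zero _⟩
  | add f g hf hg =>
    obtain ⟨N, hN⟩ := hf
    obtain ⟨M, hM⟩ := hg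
    exact ⟨max N M, fun r hr => by rw [map_add, hN r (by omega), hM r (by omega), add_zero]⟩
  | single a b => exact ⟨a, fun r hr => by rw [tailSum_single, if_neg (by omega)]⟩

/-- A vector is a non-negative combination of simple roots if and only if its tail sums are
non-positive: the tail sums are minus the coefficients of the simple roots. -/
theorem mem_posCone_iff {f : ℕ →₀ ℤ} (h0 : f 0 = 0) :
    f ∈ posCone ↔ ∀ r, tailSum r f ≤ 0 := by
  constructor
  · intro h r
    refine AddSubmonoid.closure_induction (motive := fun f _ => tailSum r f ≤ 0) ?_ ?_ ?_ h
    · rintro _ ⟨i, rfl⟩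
      rw [tailSum_alpha]; split_ifs <;> omega
    · rw [map_zero]
    · intro x y _ _ hx hy
      rw [map_add]; omega
  · intro h
    obtain ⟨N, hN⟩ := exists_tailSum_eq_zero f
    have key : f = ∑ i ∈ Finset.range N, (-tailSum i f).toNat • alpha i := by
      refine ext_of_tailSum ?_ fun r => ?_
      · rw [h0, Finsupp.finsetSum_apply]
        exact (Finset.sum_eq_zero fun i _ => by
          rw [Finsupp.smul_apply, alpha_apply_zero, smul_zero]).symm
      · rw [map_sum]
        simp only [map_nsmul, tailSum_alpha, smul_ite, smul_zero, Finset.sum_ite_eq,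
          Finset.mem_range]
        split_ifs with hr
        · have := h r
          rw [nsmul_eq_mul, Int.toNat_of_nonneg (by omega)]; ring
        · exact hN r (by omega)
    rw [key]
    exact AddSubmonoid.sum_mem _ fun i _ => nsmul_mem
      (AddSubmonoid.subset_closure (Set.mem_range_self i)) _

theorem tailSum_wt {n : ℕ} (l : Wt n) (r : ℕ) : tailSum r (wt l) = tl l 0 r := by
  simp [wt, tl, map_sum, tailSum_delta]

theorem tailSum_wtFrom {n : ℕ} (l : Wt n) (s : Fin n) (r : ℕ) :
    tailSum r (wtFrom l s) = tl l s r := by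
  rw [wtFrom, map_sum, Finset.sum_filter]
  simp only [tl, tailSum_delta, Fin.le_def]

theorem wt_apply_zero {n : ℕ} (l : Wt n) : wt l 0 = 0 := by
  simp [wt, Finsupp.finsetSum_apply, delta_apply_zero]

theorem wtFrom_apply_zero {n : ℕ} (l : Wt n) (s : Fin n) : wtFrom l s 0 = 0 := by
  simp [wtFrom, Finsupp.finsetSum_apply, delta_apply_zero]

theorem tl_of_le {n : ℕ} (l : Wt n) {t : ℕ} (ht : n ≤ t) (r : ℕ) : tl l t r = 0 :=
  Finset.sum_eq_zero fun i _ => if_neg (by omega)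

/-- The Bruhat order is the coordinatewise order of the tail sums `tl`, with equality for the full
sums. -/
theorem succeq_iff {n : ℕ} {l m : Wt n} :
    Succeq l m ↔ (∀ r, tl l 0 r = tl m 0 r) ∧ ∀ t r, tl l t r ≤ tl m t r := by
  unfold Succeq
  refine and_congr ⟨fun h r => ?_, fun h => ?_⟩ ⟨fun h t r => ?_, fun h s => ?_⟩
  · rw [← tailSum_wt, ← tailSum_wt, h]
  · refine ext_of_tailSum ?_ fun r => ?_
    · rw [wt_apply_zero, wt_apply_zero]
    · rw [tailSum_wt, tailSum_wt, h]
  · rcases lt_or_ge t n with ht | ht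
    · have := h ⟨t, ht⟩
      rw [mem_posCone_iff (by simp [wtFrom_apply_zero])] at this
      have := this r
      rw [map_sub, tailSum_wtFrom, tailSum_wtFrom] at this
      simpa using this
    · rw [tl_of_le l ht, tl_of_le m ht]
  · rw [mem_posCone_iff (by simp [wtFrom_apply_zero])]
    intro r
    rw [map_sub, tailSum_wtFrom, tailSum_wtFrom]
    have := h s r
    omega

theorem succeq_refl {n : ℕ} (l : Wt n) : Succeq l l :=
  succeq_iff.2 ⟨fun _ => rfl, fun _ _ => le_rfl⟩

theorem succeq_trans {n : ℕ} {l m k : Wt n} (h : Succeq l m) (h' : Succeq m k) : Succeq l k := by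
  rw [succeq_iff] at *
  exact ⟨fun r => (h.1 r).trans (h'.1 r), fun t r => (h.2 t r).trans (h'.2 t r)⟩

theorem lev_eq_tl_sub {n : ℕ} (l : Wt n) (i : Fin n) (r : ℕ) :
    lev r (l i) = tl l i r - tl l (i + 1) r := by
  unfold tl
  rw [← Finset.sum_sub_distrib, Finset.sum_eq_single i]
  · rw [if_pos le_rfl, if_neg (by omega), sub_zero]
  · intro j _ hj
    have : (j : ℕ) ≠ i := fun h => hj (Fin.ext h)
    by_cases h : (i : ℕ) ≤ j
    · rw [if_pos h, if_pos (by omega), sub_self]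
    · rw [if_neg h, if_neg (by omega), sub_self]
  · simp

theorem succeq_antisymm {n : ℕ} {l m : Wt n} (h : Succeq l m) (h' : Succeq m l) : l = m := by
  rw [succeq_iff] at *
  funext i
  refine eq_of_lev_eq fun r => ?_
  have := h.2 i r; have := h'.2 i r; have := h.2 (i + 1) r; have := h'.2 (i + 1) r
  rw [lev_eq_tl_sub, lev_eq_tl_sub]; omega

/-- All parts of `λ` have absolute value at most `N`. -/
def InBox {n : ℕ} (N : ℕ) (l : Wt n) : Prop := ∀ i, (l i).natAbs ≤ N

theorem InBox.mono {n : ℕ} {N M : ℕ} {l : Wt n} (h : InBox N l) (hNM : N ≤ M) : InBox M l :=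
  fun i => (h i).trans hNM

theorem exists_inBox {n : ℕ} (l : Wt n) : ∃ N, InBox N l :=
  ⟨∑ i, (l i).natAbs, fun i =>
    Finset.single_le_sum (f := fun i => (l i).natAbs) (fun _ _ => Nat.zero_le _)
      (Finset.mem_univ i)⟩

theorem finite_inBox (n N : ℕ) : {l : Wt n | InBox N l}.Finite := by
  refine (Set.Finite.pi' (t := fun _ : Fin n => Set.Icc (-(N : ℤ)) N)
    fun _ => Set.finite_Icc _ _).subset fun l hl i => ?_
  have := hl i
  constructor <;> omega

theorem tl_eq_zero_of_inBox {n N : ℕ} {l : Wt n} (h : InBox N l) (t : ℕ) {r : ℕ} (hr : N ≤ r) :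
    tl l t r = 0 :=
  Finset.sum_eq_zero fun i _ => by
    rw [lev_eq_zero ((h i).trans hr), ite_self]

/-- Boxes are convex for the Bruhat order, hence Bruhat intervals are finite. -/
theorem inBox_of_between {n N : ℕ} {l m k : Wt n} (hl : InBox N l) (hm : InBox N m)
    (h : Succeq l k) (h' : Succeq k m) : InBox N k := by
  rw [succeq_iff] at *
  intro i
  refine natAbs_le_of_lev ?_
  have e : ∀ t, tl k t N = 0 := fun t => by
    have h1 := h.2 t N; have h2 := h'.2 t N
    rw [tl_eq_zero_of_inBox hl t le_rfl] at h1
    rw [tl_eq_zero_of_inBox hm t le_rfl] at h2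
    omega
  rw [lev_eq_tl_sub, e, e, sub_zero]

theorem finite_interval {n : ℕ} (l m : Wt n) : {k | Succeq l k ∧ Succeq k m}.Finite := by
  obtain ⟨N, hN⟩ := exists_inBox l
  obtain ⟨M, hM⟩ := exists_inBox m
  exact (finite_inBox n (max N M)).subset fun k hk =>
    inBox_of_between (hN.mono (le_max_left _ _)) (hM.mono (le_max_right _ _)) hk.1 hk.2

/-- The truncation of all parts to `[-N, N]`. -/
def clamp {n : ℕ} (N : ℕ) (l : Wt n) : Wt n := fun i => max (-(N : ℤ)) (min N (l i))

theorem inBox_clamp {n : ℕ} (N : ℕ) (l : Wt n) : InBox N (clamp N l) := fun i => by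
  unfold clamp; omega

theorem tl_clamp {n N : ℕ} (l : Wt n) (t : ℕ) {r : ℕ} (hr : r < N) :
    tl (clamp N l) t r = tl l t r := by
  refine Finset.sum_congr rfl fun i _ => ?_
  have : lev r (clamp N l i) = lev r (l i) := by
    unfold lev clamp; split_ifs <;> omega
  rw [this]

/-- The condition that `λ` lies below some weight with parts in `[-N, N]`. -/
def Below {n : ℕ} (N : ℕ) (l : Wt n) : Prop :=
  ∀ r, N ≤ r → tl l 0 r = 0 ∧ ∀ t, 0 ≤ tl l t r

theorem Below.mono {n N M : ℕ} {l : Wt n} (h : Below N l) (hNM : N ≤ M) : Below M l :=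
  fun r hr => h r (hNM.trans hr)

theorem below_of_succeq {n N : ℕ} {l m : Wt n} (h : Succeq l m) (hl : InBox N l) : Below N m := by
  rw [succeq_iff] at h
  intro r hr
  refine ⟨?_, fun t => ?_⟩
  · rw [← h.1, tl_eq_zero_of_inBox hl _ hr]
  · rw [← tl_eq_zero_of_inBox hl t hr]; exact h.2 t r

/-- Truncation makes a weight larger in the Bruhat order, which shows that the weights below a box
are bounded above by the finitely many weights in the box. -/
theorem clamp_succeq {n N : ℕ} {l : Wt n} (h : Below N l) : Succeq (clamp N l) l := by
  rw [succeq_iff]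
  constructor
  · intro r
    rcases lt_or_ge r N with hr | hr
    · exact tl_clamp l 0 hr
    · rw [tl_eq_zero_of_inBox (inBox_clamp N l) 0 hr, (h r hr).1]
  · intro t r
    rcases lt_or_ge r N with hr | hr
    · exact (tl_clamp l t hr).le
    · rw [tl_eq_zero_of_inBox (inBox_clamp N l) t hr]; exact (h r hr).2 t

theorem mem_THat_iff {n : ℕ} {c : FT n} :
    c ∈ THat n ↔ ∃ N, ∀ m, c m ≠ 0 → Below N m := by
  constructor
  · rintro ⟨S, hS⟩
    choose N hN using fun l : Wt n => exists_inBox l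
    refine ⟨S.sup N, fun m hm => ?_⟩
    obtain ⟨l, hl, h⟩ := hS m hm
    exact below_of_succeq h ((hN l).mono (Finset.le_sup hl))
  · rintro ⟨N, hN⟩
    exact ⟨(finite_inBox n N).toFinset, fun m hm =>
      ⟨clamp N m, by simpa using inBox_clamp N m, clamp_succeq (hN m hm)⟩⟩

/-! ### Adding a part at either end -/

theorem tl_snoc {n : ℕ} (l : Wt n) (a : ℤ) (t r : ℕ) :
    tl (Fin.snoc (α := fun _ => ℤ) l a : Wt (n + 1)) t r
      = tl l t r + if t ≤ n then lev r a else 0 := by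
  simp [tl, Fin.sum_univ_castSucc]

theorem tl_cons_zero {n : ℕ} (l : Wt n) (a : ℤ) (r : ℕ) :
    tl (Fin.cons (α := fun _ => ℤ) a l : Wt (n + 1)) 0 r = lev r a + tl l 0 r := by
  simp [tl, Fin.sum_univ_succ]

theorem tl_cons_succ {n : ℕ} (l : Wt n) (a : ℤ) (t r : ℕ) :
    tl (Fin.cons (α := fun _ => ℤ) a l : Wt (n + 1)) (t + 1) r = tl l t r := by
  simp [tl, Fin.sum_univ_succ]

/-! ### The operators `E_i`, `F_i` on the last tensor factor -/

/-- The integer `∑_l (α_i, δ_{λ_l}) = (α_i, wt λ)`. -/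
def psum {n : ℕ} (i : ℕ) (m : Wt n) : ℤ := ∑ l, pair i (m l)

theorem psum_snoc {n : ℕ} (i : ℕ) (m : Wt n) (p : ℤ) :
    psum i (Fin.snoc (α := fun _ => ℤ) m p : Wt (n + 1)) = psum i m + pair i p := by
  simp [psum, Fin.sum_univ_castSucc]

theorem psum_cons {n : ℕ} (i : ℕ) (m : Wt n) (p : ℤ) :
    psum i (Fin.cons (α := fun _ => ℤ) p m : Wt (n + 1)) = pair i p + psum i m := by
  simp [psum, Fin.sum_univ_succ]

theorem pair_eq_lev (i : ℕ) (a : ℤ) :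
    pair i a = 2 * ((if i = 0 then 0 else lev (i - 1) a - lev i a)
      - (lev i a - lev (i + 1) a)) := by
  rw [pair_eq]
  unfold lev
  rcases Nat.eq_zero_or_pos i with rfl | hi
  · simp; split_ifs <;> omega
  · obtain ⟨j, rfl⟩ := Nat.exists_eq_add_of_le' hi
    simp only [Nat.add_sub_cancel]
    push_cast
    split_ifs <;> omega

theorem psum_eq_tl {n : ℕ} (i : ℕ) (m : Wt n) :
    psum i m = 2 * ((if i = 0 then 0 else tl m 0 (i - 1) - tl m 0 i)
      - (tl m 0 i - tl m 0 (i + 1))) := by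
  simp only [psum, pair_eq_lev, tl, Nat.zero_le, if_true]
  by_cases h : i = 0
  · simp only [if_pos h, ← Finset.mul_sum, Finset.sum_sub_distrib, Finset.sum_const_zero]
  · simp only [if_neg h, ← Finset.mul_sum, Finset.sum_sub_distrib]

theorem opE_snoc {n : ℕ} (i : ℕ) (c : FT (n + 1)) (m : Wt n) (p : ℤ) :
    opE (n + 1) i c (Fin.snoc (α := fun _ => ℤ) m p)
      = eCoef i (p + 1) * c (Fin.snoc (α := fun _ => ℤ) m (p + 1))
        + q ^ (-pair i p) * opE n i (fun l => c (Fin.snoc (α := fun _ => ℤ) l p)) m := by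
  simp only [opE, LinearMap.coe_mk, AddHom.coe_mk, Finset.sum_filter, Fin.sum_univ_castSucc,
    Fin.snoc_castSucc, Fin.snoc_last, Fin.castSucc_lt_castSucc_iff, Fin.castSucc_lt_last, if_true,
    Fin.update_snoc_last, ← Fin.snoc_update, Finset.mul_sum, lt_irrefl, if_false]
  rw [add_comm]
  congr 1
  · simp [Fin.not_lt.2 (Fin.castSucc_lt_last _).le]
  · refine Finset.sum_congr rfl fun k _ => ?_
    rw [neg_add, zpow_add₀ q_ne_zero]; ring

theorem opF_snoc {n : ℕ} (i : ℕ) (c : FT (n + 1)) (m : Wt n) (p : ℤ) :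
    opF (n + 1) i c (Fin.snoc (α := fun _ => ℤ) m p)
      = fCoef i (p - 1) * q ^ psum i m * c (Fin.snoc (α := fun _ => ℤ) m (p - 1))
        + opF n i (fun l => c (Fin.snoc (α := fun _ => ℤ) l p)) m := by
  simp only [opF, LinearMap.coe_mk, AddHom.coe_mk, Finset.sum_filter, Fin.sum_univ_castSucc,
    Fin.snoc_castSucc, Fin.snoc_last, Fin.castSucc_lt_castSucc_iff, Fin.castSucc_lt_last, if_true,
    Fin.update_snoc_last, ← Fin.snoc_update, lt_irrefl, if_false, psum]
  rw [add_comm]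
  congr 1
  · rw [add_zero]; ring
  · simp [Fin.not_lt.2 (Fin.castSucc_lt_last _).le]

theorem opE_cons {n : ℕ} (i : ℕ) (c : FT (n + 1)) (m : Wt n) (p : ℤ) :
    opE (n + 1) i c (Fin.cons (α := fun _ => ℤ) p m)
      = q ^ (-psum i m) * eCoef i (p + 1) * c (Fin.cons (α := fun _ => ℤ) (p + 1) m)
        + opE n i (fun l => c (Fin.cons (α := fun _ => ℤ) p l)) m := by
  simp only [opE, LinearMap.coe_mk, AddHom.coe_mk, Finset.sum_filter, Fin.sum_univ_succ,
    Fin.cons_succ, Fin.cons_zero, Fin.succ_lt_succ_iff, Fin.succ_pos, if_true,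
    Fin.update_cons_zero, ← Fin.cons_update, lt_irrefl, if_false, psum]
  simp

theorem opF_cons {n : ℕ} (i : ℕ) (c : FT (n + 1)) (m : Wt n) (p : ℤ) :
    opF (n + 1) i c (Fin.cons (α := fun _ => ℤ) p m)
      = fCoef i (p - 1) * c (Fin.cons (α := fun _ => ℤ) (p - 1) m)
        + q ^ pair i p * opF n i (fun l => c (Fin.cons (α := fun _ => ℤ) p l)) m := by
  simp only [opF, LinearMap.coe_mk, AddHom.coe_mk, Finset.sum_filter, Fin.sum_univ_succ,
    Fin.cons_succ, Fin.cons_zero, Fin.succ_lt_succ_iff, Fin.succ_pos, if_true,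
    Fin.update_cons_zero, ← Fin.cons_update, lt_irrefl, if_false, Finset.mul_sum]
  congr 1
  · simp
  · refine Finset.sum_congr rfl fun k _ => ?_
    rw [zpow_add₀ q_ne_zero]; ring

/-- The transpose of `E_i`: if `k` is the matrix of an operator `A`, then `tpE n i (k m)` is the
row with index `m` of the matrix of `A E_i`. -/
def tpE (n i : ℕ) (f : Wt n → Qq) (m : Wt n) : Qq :=
  ∑ k : Fin n, q ^ (-∑ l ∈ Finset.univ.filter (k < ·), pair i (m l)) * eCoef i (m k)
    * f (Function.update m k (m k - 1))

/-- The transpose of `F_i`, see `tpE`. -/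
def tpF (n i : ℕ) (f : Wt n → Qq) (m : Wt n) : Qq :=
  ∑ k : Fin n, q ^ (∑ l ∈ Finset.univ.filter (· < k), pair i (m l)) * fCoef i (m k)
    * f (Function.update m k (m k + 1))

theorem tpE_snoc {n : ℕ} (i : ℕ) (c : FT (n + 1)) (m : Wt n) (p : ℤ) :
    tpE (n + 1) i c (Fin.snoc (α := fun _ => ℤ) m p)
      = eCoef i p * c (Fin.snoc (α := fun _ => ℤ) m (p - 1))
        + q ^ (-pair i p) * tpE n i (fun l => c (Fin.snoc (α := fun _ => ℤ) l p)) m := by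
  simp only [tpE, Finset.sum_filter, Fin.sum_univ_castSucc,
    Fin.snoc_castSucc, Fin.snoc_last, Fin.castSucc_lt_castSucc_iff, Fin.castSucc_lt_last, if_true,
    Fin.update_snoc_last, ← Fin.snoc_update, Finset.mul_sum, lt_irrefl, if_false]
  rw [add_comm]
  congr 1
  · simp [Fin.not_lt.2 (Fin.castSucc_lt_last _).le]
  · refine Finset.sum_congr rfl fun k _ => ?_
    rw [neg_add, zpow_add₀ q_ne_zero]; ring

theorem tpF_snoc {n : ℕ} (i : ℕ) (c : FT (n + 1)) (m : Wt n) (p : ℤ) :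
    tpF (n + 1) i c (Fin.snoc (α := fun _ => ℤ) m p)
      = fCoef i p * q ^ psum i m * c (Fin.snoc (α := fun _ => ℤ) m (p + 1))
        + tpF n i (fun l => c (Fin.snoc (α := fun _ => ℤ) l p)) m := by
  simp only [tpF, Finset.sum_filter, Fin.sum_univ_castSucc,
    Fin.snoc_castSucc, Fin.snoc_last, Fin.castSucc_lt_castSucc_iff, Fin.castSucc_lt_last, if_true,
    Fin.update_snoc_last, ← Fin.snoc_update, lt_irrefl, if_false, psum]
  rw [add_comm]
  congr 1
  · rw [add_zero]; ring
  · simp [Fin.not_lt.2 (Fin.castSucc_lt_last _).le]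

theorem tpE_sum {n i : ℕ} {ι : Type*} (s : Finset ι) (x : ι → Qq) (f : ι → Wt n → Qq) (m : Wt n) :
    tpE n i (fun l => ∑ c ∈ s, x c * f c l) m = ∑ c ∈ s, x c * tpE n i (f c) m := by
  simp only [tpE, Finset.mul_sum]
  rw [Finset.sum_comm]
  exact Finset.sum_congr rfl fun _ _ => Finset.sum_congr rfl fun _ _ => by ring

theorem tpF_sum {n i : ℕ} {ι : Type*} (s : Finset ι) (x : ι → Qq) (f : ι → Wt n → Qq) (m : Wt n) :
    tpF n i (fun l => ∑ c ∈ s, x c * f c l) m = ∑ c ∈ s, x c * tpF n i (f c) m := by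
  simp only [tpF, Finset.mul_sum]
  rw [Finset.sum_comm]
  exact Finset.sum_congr rfl fun _ _ => Finset.sum_congr rfl fun _ _ => by ring

theorem end_sum {n : ℕ} (A : Module.End Qq (FT n)) {ι : Type*} (s : Finset ι) (x : ι → Qq)
    (f : ι → FT n) (m : Wt n) :
    A (fun l => ∑ c ∈ s, x c * f c l) m = ∑ c ∈ s, x c * A (f c) m := by
  have : (fun l => ∑ c ∈ s, x c * f c l) = ∑ c ∈ s, x c • f c := by
    funext l; simp [Finset.sum_apply]
  rw [this, map_sum, Finset.sum_apply]
  simp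

/-! ### Fusion of the `R`-matrix -/

/-- The matrix coefficients of the `R`-matrix on `Tⁿ ⊗ V`: the coefficient of `N_m ⊗ v_b` in the
image of `N_{m'} ⊗ v_a`. It is the product of the `R`-matrices on the `n` tensor factors. -/
def rker : (n : ℕ) → ℤ → ℤ → Wt n → Wt n → Qq
  | 0, b, a, _, _ => if a = b then 1 else 0
  | n + 1, b, a, m, m' => ∑ c ∈ Finset.Icc a b,
      locR b c (m (Fin.last n)) (m' (Fin.last n)) * rker n c a (Fin.init m) (Fin.init m')

theorem rker_snoc {n : ℕ} (b a : ℤ) (m m' : Wt n) (p p' : ℤ) :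
    rker (n + 1) b a (Fin.snoc (α := fun _ => ℤ) m p) (Fin.snoc (α := fun _ => ℤ) m' p')
      = ∑ c ∈ Finset.Icc a b, locR b c p p' * rker n c a m m' := by
  simp [rker]

theorem le_of_locR_ne_zero {b c p p' : ℤ} (h : locR b c p p' ≠ 0) : c ≤ b := by
  by_contra hbc
  apply h
  unfold locR
  rw [if_neg (by omega), if_neg (by omega), if_neg (by omega)]; simp

theorem lev_of_locR_ne_zero {b c p p' : ℤ} (h : locR b c p p' ≠ 0) (r : ℕ) :
    lev r p + lev r b = lev r p' + lev r c := by
  have h' : (b = c ∧ p = p') ∨ (p = c ∧ p' = b) ∨ (p = -b ∧ p' = -c) := by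
    by_contra hc
    apply h
    unfold locR
    rw [if_neg (by tauto), if_neg (by tauto), if_neg (by tauto)]; simp
  rcases h' with ⟨rfl, rfl⟩ | ⟨rfl, rfl⟩ | ⟨rfl, rfl⟩
  · rfl
  · ring
  · rw [lev_neg, lev_neg]; ring

theorem wt_induction {P : ∀ n : ℕ, Wt n → Wt n → Prop} (h0 : ∀ m m', P 0 m m')
    (hs : ∀ n, (∀ m m', P n m m') → ∀ m m' p p', P (n + 1) (Fin.snoc (α := fun _ => ℤ) m p)
      (Fin.snoc (α := fun _ => ℤ) m' p')) : ∀ n m m', P n m m' := by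
  intro n
  induction n with
  | zero => exact h0
  | succ n ih =>
    intro m m'
    rw [← Fin.snoc_init_self m, ← Fin.snoc_init_self m']
    exact hs n ih _ _ _ _

theorem le_of_rker_ne_zero : ∀ (n : ℕ) (m m' : Wt n), ∀ {b a : ℤ},
    rker n b a m m' ≠ 0 → a ≤ b := by
  refine wt_induction ?_ ?_
  · intro m m' b a h
    simp only [rker, ne_eq, ite_eq_right_iff, Classical.not_imp] at h
    omega
  · intro n _ m m' p p' b a h
    rw [rker_snoc] at h
    obtain ⟨c, hc, -⟩ := Finset.exists_ne_zero_of_sum_ne_zero h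
    rw [Finset.mem_Icc] at hc
    omega

theorem rker_snoc_of_subset {n : ℕ} {b a : ℤ} (C : Finset ℤ) (hC : Finset.Icc a b ⊆ C)
    (m m' : Wt n) (p p' : ℤ) :
    rker (n + 1) b a (Fin.snoc (α := fun _ => ℤ) m p) (Fin.snoc (α := fun _ => ℤ) m' p')
      = ∑ c ∈ C, locR b c p p' * rker n c a m m' := by
  rw [rker_snoc]
  refine Finset.sum_subset hC fun c _ hc => ?_
  by_contra h
  obtain ⟨h1, h2⟩ := mul_ne_zero_iff.1 h
  exact hc (Finset.mem_Icc.2 ⟨le_of_rker_ne_zero _ _ _ h2, le_of_locR_ne_zero h1⟩)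

/-- The fused `R`-matrix preserves the weight, expressed through the tail sums `lev`. -/
theorem rker_weight : ∀ (n : ℕ) (m m' : Wt n), ∀ {b a : ℤ}, rker n b a m m' ≠ 0 →
    ∀ r, tl m 0 r + lev r b = tl m' 0 r + lev r a := by
  refine wt_induction ?_ ?_
  · intro m m' b a h r
    simp only [rker, ne_eq, ite_eq_right_iff, Classical.not_imp] at h
    rw [h.1]; simp [tl]
  · intro n ih m m' p p' b a h r
    rw [rker_snoc] at h
    obtain ⟨c, hc, h⟩ := Finset.exists_ne_zero_of_sum_ne_zero h
    obtain ⟨h1, h2⟩ := mul_ne_zero_iff.1 h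
    have := ih m m' h2 r
    have := lev_of_locR_ne_zero h1 r
    rw [tl_snoc, tl_snoc]
    simp only [Nat.zero_le, if_true]
    omega

theorem rker_psum {n : ℕ} {m m' : Wt n} {b a : ℤ} (h : rker n b a m m' ≠ 0) (i : ℕ) :
    psum i m + pair i b = psum i m' + pair i a := by
  have h' := rker_weight n m m' h
  rw [psum_eq_tl, psum_eq_tl, pair_eq_lev, pair_eq_lev]
  have h1 := h' i; have h2 := h' (i + 1); have h3 := h' (i - 1)
  split_ifs <;> omega

theorem locR_pair {b c p p' : ℤ} (h : locR b c p p' ≠ 0) (i : ℕ) :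
    pair i p + pair i b = pair i p' + pair i c := by
  have h' := lev_of_locR_ne_zero h
  simp only [pair_eq_lev]
  have h1 := h' i; have h2 := h' (i + 1); have h3 := h' (i - 1)
  split_ifs <;> omega

/-- Translation of the summation index by `1`, for finite sets containing the supports. -/
theorem sum_shift {M : Type*} [AddCommMonoid M] (h : ℤ → M) (C D : Finset ℤ)
    (hC : ∀ c, h c ≠ 0 → c ∈ C)
    (hD : ∀ c, h (c + 1) ≠ 0 → c ∈ D) : ∑ c ∈ C, h c = ∑ c ∈ D, h (c + 1) := by
  rw [← finsum_eq_sum_of_support_subset h (fun c hc => hC c hc),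
    ← finsum_eq_sum_of_support_subset (fun c => h (c + 1)) (fun c hc => hD c hc)]
  exact (finsum_comp_equiv (Equiv.addRight (1 : ℤ)) (f := h)).symm

/-- The fused `R`-matrix intertwines the two coproducts of `E_i` on `Tⁿ ⊗ V`. -/
theorem rker_E (i : ℕ) : ∀ (n : ℕ) (m m' : Wt n), ∀ (b a : ℤ),
    eCoef i (b + 1) * rker n (b + 1) a m m'
        + q ^ (-pair i b) * opE n i (fun l => rker n b a l m') m
      = eCoef i a * rker n b (a - 1) m m' * q ^ (-psum i m') + tpE n i (rker n b a m) m' := by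
  refine wt_induction ?_ ?_
  · intro m m' b a
    simp only [rker, opE, tpE, psum, LinearMap.coe_mk, AddHom.coe_mk, Finset.univ_eq_empty,
      Finset.sum_empty, mul_zero, add_zero, neg_zero, zpow_zero, mul_one]
    by_cases h : a = b + 1
    · rw [if_pos h, if_pos (by omega), h]
    · rw [if_neg h, if_neg (by omega), mul_zero, mul_zero]
  · intro n ih m m' p p' b a
    set C := Finset.Icc (a - 1) (b + 1) with hCdef
    have hC : ∀ c, a - 1 ≤ c → c ≤ b + 1 → c ∈ C := fun c h h' => Finset.mem_Icc.2 ⟨h, h'⟩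
    have hsub : ∀ {x y : ℤ}, a - 1 ≤ x → y ≤ b + 1 → Finset.Icc x y ⊆ C :=
      fun h h' => Finset.Icc_subset_Icc h h'
    rw [opE_snoc, tpE_snoc, psum_snoc]
    simp only [rker_snoc_of_subset C (hsub (show a - 1 ≤ a by omega) (show b ≤ b + 1 by omega)),
      rker_snoc_of_subset C (hsub (show a - 1 ≤ a by omega) (le_refl (b + 1))),
      rker_snoc_of_subset C (hsub (le_refl (a - 1)) (show b ≤ b + 1 by omega))]
    rw [end_sum (opE n i) C (fun c => locR b c p p') (fun c l => rker n c a l m'),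
      tpE_sum C (fun c => locR b c p p') (fun c l => rker n c a m l)]
    have s1 : ∑ c ∈ C, eCoef i c * locR b (c - 1) p p' * q ^ (-pair i p') * rker n c a m m'
        = ∑ c ∈ C, eCoef i (c + 1) * locR b c p p' * q ^ (-pair i p') * rker n (c + 1) a m m' := by
      have := sum_shift
        (fun c => eCoef i c * locR b (c - 1) p p' * q ^ (-pair i p') * rker n c a m m') C C
        (fun c hc => ?_) (fun c hc => ?_)
      · simpa only [add_sub_cancel_right] using this
      · have h1 := le_of_rker_ne_zero _ _ _ (right_ne_zero_of_mul hc)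
        have h2 := le_of_locR_ne_zero
          (right_ne_zero_of_mul (left_ne_zero_of_mul (left_ne_zero_of_mul hc)))
        exact hC c (by omega) (by omega)
      · have h1 := le_of_rker_ne_zero _ _ _ (right_ne_zero_of_mul hc)
        have h2 := le_of_locR_ne_zero
          (right_ne_zero_of_mul (left_ne_zero_of_mul (left_ne_zero_of_mul hc)))
        exact hC c (by omega) (by omega)
    have s2 : ∀ c, q ^ (-pair i b) * q ^ (-pair i p) * locR b c p p'
        = q ^ (-pair i p') * q ^ (-pair i c) * locR b c p p' := by
      intro c
      by_cases h : locR b c p p' = 0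
      · rw [h, mul_zero, mul_zero]
      · rw [← zpow_add₀ q_ne_zero, ← zpow_add₀ q_ne_zero]
        have := locR_pair h i
        congr 2; omega
    have e1 : eCoef i (b + 1) * ∑ c ∈ C, locR (b + 1) c p p' * rker n c a m m'
        + q ^ (-pair i b) * (eCoef i (p + 1) * ∑ c ∈ C, locR b c (p + 1) p' * rker n c a m m')
        = ∑ c ∈ C, eCoef i c * locR b (c - 1) p p' * q ^ (-pair i p') * rker n c a m m'
          + eCoef i p' * ∑ c ∈ C, locR b c p (p' - 1) * rker n c a m m' := by
      simp only [Finset.mul_sum, ← Finset.sum_add_distrib]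
      refine Finset.sum_congr rfl fun c _ => ?_
      linear_combination rker n c a m m' * locR_E i b c p p'
    have e2 : ∑ c ∈ C, eCoef i (c + 1) * locR b c p p' * q ^ (-pair i p') * rker n (c + 1) a m m'
        + q ^ (-pair i b) * (q ^ (-pair i p) *
          ∑ c ∈ C, locR b c p p' * opE n i (fun l => rker n c a l m') m)
        = eCoef i a * (∑ c ∈ C, locR b c p p' * rker n c (a - 1) m m')
            * (q ^ (-psum i m') * q ^ (-pair i p'))
          + q ^ (-pair i p') * ∑ c ∈ C, locR b c p p' * tpE n i (rker n c a m) m' := by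
      simp only [Finset.mul_sum, Finset.sum_mul, ← Finset.sum_add_distrib]
      refine Finset.sum_congr rfl fun c _ => ?_
      linear_combination (q ^ (-pair i p') * locR b c p p') * ih m m' c a
        + (opE n i (fun l => rker n c a l m') m) * s2 c
    rw [neg_add, zpow_add₀ q_ne_zero]
    linear_combination e1 + e2 + s1

/-- The fused `R`-matrix intertwines the two coproducts of `F_i` on `Tⁿ ⊗ V`. -/
theorem rker_F (i : ℕ) : ∀ (n : ℕ) (m m' : Wt n), ∀ (b a : ℤ),
    fCoef i (b - 1) * q ^ psum i m * rker n (b - 1) a m m'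
        + opF n i (fun l => rker n b a l m') m
      = fCoef i a * rker n b (a + 1) m m' + q ^ pair i a * tpF n i (rker n b a m) m' := by
  refine wt_induction ?_ ?_
  · intro m m' b a
    simp only [rker, opF, tpF, psum, LinearMap.coe_mk, AddHom.coe_mk, Finset.univ_eq_empty,
      Finset.sum_empty, mul_zero, add_zero, zpow_zero, mul_one]
    by_cases h : a = b - 1
    · rw [if_pos h, if_pos (by omega), h]
    · rw [if_neg h, if_neg (by omega), mul_zero, mul_zero]
  · intro n ih m m' p p' b a
    set C := Finset.Icc (a - 1) (b + 1) with hCdef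
    have hC : ∀ c, a - 1 ≤ c → c ≤ b + 1 → c ∈ C := fun c h h' => Finset.mem_Icc.2 ⟨h, h'⟩
    have hsub : ∀ {x y : ℤ}, a - 1 ≤ x → y ≤ b + 1 → Finset.Icc x y ⊆ C :=
      fun h h' => Finset.Icc_subset_Icc h h'
    rw [opF_snoc, tpF_snoc, psum_snoc]
    simp only [rker_snoc_of_subset C (hsub (show a - 1 ≤ a by omega) (show b ≤ b + 1 by omega)),
      rker_snoc_of_subset C (hsub (show a - 1 ≤ a by omega) (show b - 1 ≤ b + 1 by omega)),
      rker_snoc_of_subset C (hsub (show a - 1 ≤ a + 1 by omega) (show b ≤ b + 1 by omega))]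
    rw [end_sum (opF n i) C (fun c => locR b c p p') (fun c l => rker n c a l m'),
      tpF_sum C (fun c => locR b c p p') (fun c l => rker n c a m l)]
    have s1 : ∑ c ∈ C, q ^ psum i m * (fCoef i (c - 1) * locR b c p p' * rker n (c - 1) a m m')
        = ∑ c ∈ C, q ^ psum i m * (fCoef i c * locR b (c + 1) p p' * rker n c a m m') := by
      have := sum_shift
        (fun c => q ^ psum i m * (fCoef i (c - 1) * locR b c p p' * rker n (c - 1) a m m')) C C
        (fun c hc => ?_) (fun c hc => ?_)
      · simpa only [add_sub_cancel_right] using this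
      · have hc := right_ne_zero_of_mul hc
        have h1 := le_of_rker_ne_zero _ _ _ (right_ne_zero_of_mul hc)
        have h2 := le_of_locR_ne_zero (right_ne_zero_of_mul (left_ne_zero_of_mul hc))
        exact hC c (by omega) (by omega)
      · have hc := right_ne_zero_of_mul hc
        have h1 := le_of_rker_ne_zero _ _ _ (right_ne_zero_of_mul hc)
        have h2 := le_of_locR_ne_zero (right_ne_zero_of_mul (left_ne_zero_of_mul hc))
        exact hC c (by omega) (by omega)
    have s2 : ∀ c, q ^ psum i m * q ^ pair i c * rker n c a m m'
        = q ^ psum i m' * q ^ pair i a * rker n c a m m' := by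
      intro c
      by_cases h : rker n c a m m' = 0
      · rw [h, mul_zero, mul_zero]
      · rw [← zpow_add₀ q_ne_zero, ← zpow_add₀ q_ne_zero, rker_psum h i]
    have e1 : fCoef i (b - 1) * (q ^ psum i m * q ^ pair i p)
          * ∑ c ∈ C, locR (b - 1) c p p' * rker n c a m m'
        + fCoef i (p - 1) * q ^ psum i m * ∑ c ∈ C, locR b c (p - 1) p' * rker n c a m m'
        = ∑ c ∈ C, q ^ psum i m * (fCoef i c * locR b (c + 1) p p' * rker n c a m m')
          + q ^ pair i a * (fCoef i p' * q ^ psum i m'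
            * ∑ c ∈ C, locR b c p (p' + 1) * rker n c a m m') := by
      simp only [Finset.mul_sum, ← Finset.sum_add_distrib]
      refine Finset.sum_congr rfl fun c _ => ?_
      linear_combination (rker n c a m m' * q ^ psum i m) * locR_F i b c p p'
        + fCoef i p' * locR b c p (p' + 1) * s2 c
    have e2 : ∑ c ∈ C, q ^ psum i m * (fCoef i (c - 1) * locR b c p p' * rker n (c - 1) a m m')
        + ∑ c ∈ C, locR b c p p' * opF n i (fun l => rker n c a l m') m
        = fCoef i a * (∑ c ∈ C, locR b c p p' * rker n c (a + 1) m m')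
          + q ^ pair i a * ∑ c ∈ C, locR b c p p' * tpF n i (rker n c a m) m' := by
      simp only [Finset.mul_sum, ← Finset.sum_add_distrib]
      refine Finset.sum_congr rfl fun c _ => ?_
      linear_combination locR b c p p' * ih m m' c a
    rw [zpow_add₀ q_ne_zero]
    linear_combination e1 + e2 - s1

/-! ### Operators with row-finite kernels -/

/-- A kernel all of whose rows have finite support. -/
def RowFin {n : ℕ} (k : Wt n → Wt n → Qq) : Prop := ∀ m, (Function.support (k m)).Finite

theorem RowFin.mul {n : ℕ} {k : Wt n → Wt n → Qq} (hk : RowFin k) (m : Wt n) (c : FT n) :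
    (Function.support fun m' => k m m' * c m').Finite :=
  (hk m).subset fun _ h => left_ne_zero_of_mul h

/-- The operator on formal sums with a given row-finite kernel. -/
def kerOp {n : ℕ} (k : Wt n → Wt n → Qq) (hk : RowFin k) : Module.End Qq (FT n) where
  toFun c := fun m => ∑ᶠ m', k m m' * c m'
  map_add' c d := by
    funext m
    simp only [Pi.add_apply, mul_add]
    exact finsum_add_distrib (hk.mul m c) (hk.mul m d)
  map_smul' r c := by
    funext m
    simp only [Pi.smul_apply, smul_eq_mul, RingHom.id_apply]
    rw [mul_finsum]
    exact finsum_congr fun m' => by ring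

theorem kerOp_apply {n : ℕ} (k : Wt n → Wt n → Qq) (hk : RowFin k) (c : FT n) (m : Wt n) :
    kerOp k hk c m = ∑ᶠ m', k m m' * c m' := rfl

theorem RowFin.opE {n : ℕ} {k : Wt n → Wt n → Qq} (hk : RowFin k) (i : ℕ) :
    RowFin fun m m' => opE n i (fun l => k l m') m := fun m =>
  (Set.finite_iUnion fun j : Fin n => hk (Function.update m j (m j + 1))).subset fun m' h => by
    simp only [QueerFock.opE, LinearMap.coe_mk, AddHom.coe_mk, Function.mem_support] at h
    obtain ⟨j, -, hj⟩ := Finset.exists_ne_zero_of_sum_ne_zero h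
    exact Set.mem_iUnion.2 ⟨j, right_ne_zero_of_mul hj⟩

theorem RowFin.opF {n : ℕ} {k : Wt n → Wt n → Qq} (hk : RowFin k) (i : ℕ) :
    RowFin fun m m' => opF n i (fun l => k l m') m := fun m =>
  (Set.finite_iUnion fun j : Fin n => hk (Function.update m j (m j - 1))).subset fun m' h => by
    simp only [QueerFock.opF, LinearMap.coe_mk, AddHom.coe_mk, Function.mem_support] at h
    obtain ⟨j, -, hj⟩ := Finset.exists_ne_zero_of_sum_ne_zero h
    exact Set.mem_iUnion.2 ⟨j, right_ne_zero_of_mul hj⟩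

/-- The bijection of weights which adds `x` to the part in position `j`. -/
def addAt {n : ℕ} (j : Fin n) (x : ℤ) : Wt n ≃ Wt n where
  toFun m := Function.update m j (m j + x)
  invFun m := Function.update m j (m j - x)
  left_inv m := by simp
  right_inv m := by simp

theorem addAt_apply {n : ℕ} (j : Fin n) (x : ℤ) (m : Wt n) :
    addAt j x m = Function.update m j (m j + x) := rfl

theorem RowFin.comp_addAt {n : ℕ} {k : Wt n → Wt n → Qq} (hk : RowFin k) (j : Fin n) (x : ℤ) :
    RowFin fun m m' => k m (addAt j x m') := fun m =>
  (hk m).preimage ((addAt j x).injective.injOn)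

theorem RowFin.tpE {n : ℕ} {k : Wt n → Wt n → Qq} (hk : RowFin k) (i : ℕ) :
    RowFin fun m m' => tpE n i (k m) m' := fun m =>
  (Set.finite_iUnion fun j : Fin n => hk.comp_addAt j (-1) m).subset fun m' h => by
    obtain ⟨j, -, hj⟩ := Finset.exists_ne_zero_of_sum_ne_zero h
    exact Set.mem_iUnion.2 ⟨j, right_ne_zero_of_mul hj⟩

theorem RowFin.tpF {n : ℕ} {k : Wt n → Wt n → Qq} (hk : RowFin k) (i : ℕ) :
    RowFin fun m m' => tpF n i (k m) m' := fun m =>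
  (Set.finite_iUnion fun j : Fin n => hk.comp_addAt j 1 m).subset fun m' h => by
    obtain ⟨j, -, hj⟩ := Finset.exists_ne_zero_of_sum_ne_zero h
    exact Set.mem_iUnion.2 ⟨j, right_ne_zero_of_mul hj⟩

theorem opE_kerOp {n : ℕ} (k : Wt n → Wt n → Qq) (hk : RowFin k) (i : ℕ) (c : FT n) (m : Wt n) :
    opE n i (kerOp k hk c) m = ∑ᶠ m', opE n i (fun l => k l m') m * c m' := by
  simp only [opE, LinearMap.coe_mk, AddHom.coe_mk, kerOp_apply, Finset.sum_mul]
  rw [finsum_sum_comm]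
  · refine Finset.sum_congr rfl fun j _ => ?_
    rw [mul_finsum]
    exact finsum_congr fun m' => by ring
  · exact fun j _ => (hk (Function.update m j (m j + 1))).subset fun m' h =>
      right_ne_zero_of_mul (left_ne_zero_of_mul h)

theorem opF_kerOp {n : ℕ} (k : Wt n → Wt n → Qq) (hk : RowFin k) (i : ℕ) (c : FT n) (m : Wt n) :
    opF n i (kerOp k hk c) m = ∑ᶠ m', opF n i (fun l => k l m') m * c m' := by
  simp only [opF, LinearMap.coe_mk, AddHom.coe_mk, kerOp_apply, Finset.sum_mul]
  rw [finsum_sum_comm]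
  · refine Finset.sum_congr rfl fun j _ => ?_
    rw [mul_finsum]
    exact finsum_congr fun m' => by ring
  · exact fun j _ => (hk (Function.update m j (m j - 1))).subset fun m' h =>
      right_ne_zero_of_mul (left_ne_zero_of_mul h)

theorem kerOp_opE {n : ℕ} (k : Wt n → Wt n → Qq) (hk : RowFin k) (i : ℕ) (c : FT n) (m : Wt n) :
    kerOp k hk (opE n i c) m = ∑ᶠ m', tpE n i (k m) m' * c m' := by
  simp only [opE, tpE, LinearMap.coe_mk, AddHom.coe_mk, kerOp_apply, Finset.sum_mul,
    Finset.mul_sum]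
  rw [finsum_sum_comm, finsum_sum_comm]
  · refine Finset.sum_congr rfl fun j _ => ?_
    refine Eq.trans (finsum_congr fun m' => ?_) (finsum_comp_equiv (addAt j 1))
    have e : ∑ l ∈ Finset.univ.filter (j < ·), pair i (addAt j 1 m' l)
        = ∑ l ∈ Finset.univ.filter (j < ·), pair i (m' l) := by
      refine Finset.sum_congr rfl fun l hl => ?_
      rw [Finset.mem_filter] at hl
      rw [addAt_apply, Function.update_of_ne hl.2.ne']
    rw [e]
    simp only [addAt_apply, Function.update_self, Function.update_idem, add_sub_cancel_right,
      Function.update_eq_self]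
    ring
  · exact fun j _ => (hk.comp_addAt j (-1) m).subset fun m' h =>
      right_ne_zero_of_mul (left_ne_zero_of_mul h)
  · exact fun j _ => (hk m).subset fun m' h => left_ne_zero_of_mul h

theorem kerOp_opF {n : ℕ} (k : Wt n → Wt n → Qq) (hk : RowFin k) (i : ℕ) (c : FT n) (m : Wt n) :
    kerOp k hk (opF n i c) m = ∑ᶠ m', tpF n i (k m) m' * c m' := by
  simp only [opF, tpF, LinearMap.coe_mk, AddHom.coe_mk, kerOp_apply, Finset.sum_mul,
    Finset.mul_sum]
  rw [finsum_sum_comm, finsum_sum_comm]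
  · refine Finset.sum_congr rfl fun j _ => ?_
    refine Eq.trans (finsum_congr fun m' => ?_) (finsum_comp_equiv (addAt j (-1)))
    have e : ∑ l ∈ Finset.univ.filter (· < j), pair i (addAt j (-1) m' l)
        = ∑ l ∈ Finset.univ.filter (· < j), pair i (m' l) := by
      refine Finset.sum_congr rfl fun l hl => ?_
      rw [Finset.mem_filter] at hl
      rw [addAt_apply, Function.update_of_ne hl.2.ne]
    rw [e]
    simp only [addAt_apply, Function.update_self, Function.update_idem, ← sub_eq_add_neg,
      sub_add_cancel,
      Function.update_eq_self]
    ring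
  · exact fun j _ => (hk.comp_addAt j 1 m).subset fun m' h =>
      right_ne_zero_of_mul (left_ne_zero_of_mul h)
  · exact fun j _ => (hk m).subset fun m' h => left_ne_zero_of_mul h

/-! ### The quasi-`R`-matrix -/

theorem locR_cases {b c p p' : ℤ} (h : locR b c p p' ≠ 0) : p' = p ∨ p' = b ∨ p' = -c := by
  by_contra hc
  apply h
  unfold locR
  rw [if_neg (by omega), if_neg (by omega), if_neg (by omega)]; simp

theorem rker_inBox {N : ℕ} : ∀ (n : ℕ) (m m' : Wt n), ∀ {b a : ℤ}, rker n b a m m' ≠ 0 →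
    InBox N m → b.natAbs ≤ N → a.natAbs ≤ N → InBox N m' := by
  refine wt_induction ?_ ?_
  · intro m m' b a _ _ _ _ i
    exact i.elim0
  · intro n ih m m' p p' b a h hm hb ha
    rw [rker_snoc] at h
    obtain ⟨c, hc, h⟩ := Finset.exists_ne_zero_of_sum_ne_zero h
    rw [Finset.mem_Icc] at hc
    obtain ⟨h1, h2⟩ := mul_ne_zero_iff.1 h
    have hm' : InBox N m := fun i => by simpa using hm i.castSucc
    have hp : p.natAbs ≤ N := by simpa using hm (Fin.last n)
    have := ih m m' h2 hm' (by omega) ha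
    intro i
    induction i using Fin.lastCases with
    | last =>
      rw [Fin.snoc_last]
      rcases locR_cases h1 with h | h | h <;> omega
    | cast i => rw [Fin.snoc_castSucc]; exact this i

/-- `(wt λ, δ_a)`. -/
def dsum {n : ℕ} (m : Wt n) (a : ℤ) : ℤ := ∑ l, dform (m l) a

/-- The matrix coefficients of the quasi-`R`-matrix on `Tⁿ ⊗ V`: the fused `R`-matrix composed with
the inverse `N_λ ⊗ v_a ↦ q^{-(wt λ, δ_a)} N_λ ⊗ v_a` of its diagonal part. -/
def thetaKer (n : ℕ) (b a : ℤ) (m m' : Wt n) : Qq := rker n b a m m' * q ^ (-dsum m' a)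

theorem rker_rowFin (n : ℕ) (b a : ℤ) : RowFin (rker n b a) := fun m => by
  obtain ⟨N, hN⟩ := exists_inBox m
  refine (finite_inBox n (max N (max b.natAbs a.natAbs))).subset fun m' h => ?_
  exact rker_inBox n m m' h (hN.mono (le_max_left _ _)) (by omega) (by omega)

theorem thetaKer_rowFin (n : ℕ) (b a : ℤ) : RowFin (thetaKer n b a) := fun m =>
  (rker_rowFin n b a m).subset fun _ h => left_ne_zero_of_mul h

theorem eCoef_ne_zero {i : ℕ} {a : ℤ} (h : eCoef i a ≠ 0) : a = i + 1 ∨ a = -i := by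
  by_contra h'
  push Not at h'
  exact h (eCoef_of_ne h'.1 h'.2)

theorem dform_sub_one {i : ℕ} {a : ℤ} (h : eCoef i a ≠ 0) (x : ℤ) :
    dform x (a - 1) = dform x a + pair i x := by
  rw [pair_eq]
  unfold dform
  rcases eCoef_ne_zero h with rfl | rfl <;> split_ifs <;> omega

theorem dsum_sub_one {n i : ℕ} {a : ℤ} (h : eCoef i a ≠ 0) (m : Wt n) :
    dsum m (a - 1) = dsum m a + psum i m := by
  simp only [dsum, psum, dform_sub_one h, Finset.sum_add_distrib]

theorem dsum_update {n i : ℕ} (m : Wt n) (k : Fin n) (h : eCoef i (m k) ≠ 0) (a : ℤ) :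
    dsum (Function.update m k (m k - 1)) a = dsum m a + pair i a := by
  unfold dsum
  rw [Fintype.sum_eq_add_sum_compl k, Fintype.sum_eq_add_sum_compl k, Function.update_self,
    dform_comm, dform_sub_one h, dform_comm a]
  have : ∑ l ∈ {k}ᶜ, dform (Function.update m k (m k - 1) l) a = ∑ l ∈ {k}ᶜ, dform (m l) a :=
    Finset.sum_congr rfl fun l hl => by
      rw [Function.update_of_ne (by simpa using hl)]
  rw [this]; ring

theorem thetaKer_E (n i : ℕ) (b a : ℤ) (m m' : Wt n) :
    eCoef i (b + 1) * thetaKer n (b + 1) a m m'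
        + q ^ (-pair i b) * opE n i (fun l => thetaKer n b a l m') m
      = eCoef i a * thetaKer n b (a - 1) m m' + q ^ pair i a * tpE n i (thetaKer n b a m) m' := by
  have h := rker_E i n m m' b a
  have e1 : opE n i (fun l => thetaKer n b a l m') m
      = opE n i (fun l => rker n b a l m') m * q ^ (-dsum m' a) := by
    simp only [opE, LinearMap.coe_mk, AddHom.coe_mk, thetaKer, Finset.sum_mul, mul_assoc]
  have e2 : eCoef i a * thetaKer n b (a - 1) m m'
      = eCoef i a * rker n b (a - 1) m m' * q ^ (-psum i m') * q ^ (-dsum m' a) := by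
    by_cases h0 : eCoef i a = 0
    · rw [h0]; ring
    · rw [thetaKer, dsum_sub_one h0, neg_add, zpow_add₀ q_ne_zero]; ring
  have e3 : q ^ pair i a * tpE n i (thetaKer n b a m) m'
      = tpE n i (rker n b a m) m' * q ^ (-dsum m' a) := by
    simp only [tpE, thetaKer, Finset.sum_mul, Finset.mul_sum]
    refine Finset.sum_congr rfl fun k _ => ?_
    by_cases h0 : eCoef i (m' k) = 0
    · rw [h0]; ring
    · rw [dsum_update m' k h0, neg_add, zpow_add₀ q_ne_zero (-dsum m' a), zpow_neg _ (pair i a)]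
      have := zpow_ne_zero (pair i a) q_ne_zero
      field_simp
  rw [e1, e2, e3, thetaKer]
  linear_combination q ^ (-dsum m' a) * h

theorem thetaKer_F (n i : ℕ) (b a : ℤ) (m m' : Wt n) :
    fCoef i (b - 1) * (q ^ psum i m * thetaKer n (b - 1) a m m')
        + opF n i (fun l => thetaKer n b a l m') m
      = fCoef i a * (thetaKer n b (a + 1) m m' * q ^ (-psum i m'))
        + tpF n i (thetaKer n b a m) m' := by
  have h := rker_F i n m m' b a
  have e1 : opF n i (fun l => thetaKer n b a l m') m
      = opF n i (fun l => rker n b a l m') m * q ^ (-dsum m' a) := by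
    simp only [opF, LinearMap.coe_mk, AddHom.coe_mk, thetaKer, Finset.sum_mul, mul_assoc]
  have key : ∀ x, fCoef i x ≠ 0 → eCoef i (x + 1) ≠ 0 := by
    intro x hx h0
    rw [fCoef_eq] at hx
    rcases eCoef_ne_zero hx with h | h
    · rcases eq_or_ne i 0 with rfl | hi
      · obtain rfl : x = -1 := by push_cast at h; omega
        simp [eCoef, two_ne_zero'] at h0
      · rw [show x + 1 = -i by omega, eCoef_bot hi] at h0
        exact one_ne_zero h0
    · rw [show x + 1 = i + 1 by omega, eCoef_top] at h0
      exact one_ne_zero h0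
  have e2 : fCoef i a * (thetaKer n b (a + 1) m m' * q ^ (-psum i m'))
      = fCoef i a * rker n b (a + 1) m m' * q ^ (-dsum m' a) := by
    by_cases h0 : fCoef i a = 0
    · rw [h0]; ring
    · have := dsum_sub_one (key a h0) m'
      rw [add_sub_cancel_right] at this
      rw [thetaKer, this, neg_add, zpow_add₀ q_ne_zero]; ring
  have e3 : tpF n i (thetaKer n b a m) m'
      = q ^ pair i a * tpF n i (rker n b a m) m' * q ^ (-dsum m' a) := by
    simp only [tpF, thetaKer, Finset.sum_mul, Finset.mul_sum]
    refine Finset.sum_congr rfl fun k _ => ?_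
    by_cases h0 : fCoef i (m' k) = 0
    · rw [h0]; ring
    · have := dsum_update (i := i) (Function.update m' k (m' k + 1)) k
        (by rw [Function.update_self]; exact key _ h0) a
      rw [Function.update_self, Function.update_idem, add_sub_cancel_right,
        Function.update_eq_self] at this
      rw [this, neg_add, zpow_add₀ q_ne_zero (-dsum _ a), zpow_neg _ (pair i a)]
      have := zpow_ne_zero (pair i a) q_ne_zero
      field_simp
  rw [e1, e2, e3, thetaKer]
  linear_combination q ^ (-dsum m' a) * h

/-- The matrix of operators of the quasi-`R`-matrix on `Tⁿ ⊗ V`. -/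
def thetaOp (n : ℕ) (b a : ℤ) : Module.End Qq (FT n) :=
  kerOp (thetaKer n b a) (thetaKer_rowFin n b a)

theorem thetaOp_apply (n : ℕ) (b a : ℤ) (c : FT n) (m : Wt n) :
    thetaOp n b a c m = ∑ᶠ m', thetaKer n b a m m' * c m' := rfl

/-- The diagonal part of the fused `R`-matrix. -/
theorem rker_self_apply : ∀ (n : ℕ) (m m' : Wt n), ∀ a : ℤ,
    rker n a a m m' = if m = m' then q ^ dsum m' a else 0 := by
  refine wt_induction ?_ ?_
  · intro m m' a
    rw [if_pos (Subsingleton.elim _ _)]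
    simp [rker, dsum]
  · intro n ih m m' p p' a
    rw [rker_snoc, Finset.Icc_self, Finset.sum_singleton, ih]
    have e : locR a a p p' = if p = p' then q ^ dform p' a else 0 := by
      unfold locR; simp
    rw [e]
    have hd : dsum (Fin.snoc (α := fun _ => ℤ) m' p' : Wt (n + 1)) a
        = dsum m' a + dform p' a := by
      simp [dsum, Fin.sum_univ_castSucc]
    rw [hd, zpow_add₀ q_ne_zero]
    by_cases h1 : p = p'
    · by_cases h2 : m = m'
      · rw [if_pos h1, if_pos h2, if_pos (by rw [h1, h2])]; ring
      · rw [if_neg h2, if_neg (fun h => h2 (Fin.snoc_inj.1 h).1), mul_zero]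
    · rw [if_neg h1, if_neg (fun h => h1 (Fin.snoc_inj.1 h).2), zero_mul]

/-- The quasi-`R`-matrix on `Tⁿ ⊗ V` exists. -/
theorem isQuasiR_thetaOp (n : ℕ) : IsQuasiR n (thetaOp n) where
  diag a := by
    refine LinearMap.ext fun c => funext fun m => ?_
    rw [thetaOp_apply, finsum_eq_single _ m]
    · rw [thetaKer, rker_self_apply, if_pos rfl, ← zpow_add₀ q_ne_zero]
      simp
    · intro m' hm'
      rw [thetaKer, rker_self_apply, if_neg (Ne.symm hm'), zero_mul, zero_mul]
  lower b a h := by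
    refine LinearMap.ext fun c => funext fun m => ?_
    rw [thetaOp_apply]
    refine (finsum_congr fun m' => ?_).trans finsum_zero
    have : rker n b a m m' = 0 := by
      by_contra h0
      exact absurd (le_of_rker_ne_zero n m m' h0) (by omega)
    rw [thetaKer, this, zero_mul, zero_mul]
  compE i b a := by
    refine LinearMap.ext fun c => funext fun m => ?_
    simp only [LinearMap.add_apply, LinearMap.smul_apply, Module.End.mul_apply, Pi.add_apply,
      Pi.smul_apply, smul_eq_mul]
    have f1 := (thetaKer_rowFin n (b + 1) a).mul m c
    have f2 := (thetaKer_rowFin n b (a - 1)).mul m c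
    have f3 := ((thetaKer_rowFin n b a).opE i).mul m c
    have f4 := ((thetaKer_rowFin n b a).tpE i).mul m c
    simp only [thetaOp]
    rw [opE_kerOp, kerOp_opE, kerOp_apply, kerOp_apply, mul_finsum, mul_finsum,
      mul_finsum, mul_finsum, ← finsum_add_distrib, ← finsum_add_distrib]
    · refine finsum_congr fun m' => ?_
      linear_combination c m' * thetaKer_E n i b a m m'
    · exact f2.subset fun _ h => right_ne_zero_of_mul h
    · exact f4.subset fun _ h => right_ne_zero_of_mul h
    · exact f1.subset fun _ h => right_ne_zero_of_mul h
    · exact f3.subset fun _ h => right_ne_zero_of_mul h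
  compF i b a := by
    refine LinearMap.ext fun c => funext fun m => ?_
    simp only [LinearMap.add_apply, LinearMap.smul_apply, Module.End.mul_apply, Pi.add_apply,
      Pi.smul_apply, smul_eq_mul]
    have f1 := (thetaKer_rowFin n (b - 1) a).mul m c
    have f2 := (thetaKer_rowFin n b (a + 1)).mul m (opK n i (-1) c)
    have f3 := ((thetaKer_rowFin n b a).opF i).mul m c
    have f4 := ((thetaKer_rowFin n b a).tpF i).mul m c
    have hK : ∀ (x : FT n) (l : Wt n), opK n i 1 x l = q ^ psum i l * x l := fun x l => by
      simp [opK, psum]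
    have hK' : ∀ (x : FT n) (l : Wt n), opK n i (-1) x l = q ^ (-psum i l) * x l := fun x l => by
      simp [opK, psum]
    simp only [thetaOp]
    rw [opF_kerOp, kerOp_opF, hK, kerOp_apply, kerOp_apply, ← mul_assoc, mul_finsum,
      mul_finsum, ← finsum_add_distrib, ← finsum_add_distrib]
    · refine finsum_congr fun m' => ?_
      rw [hK']
      linear_combination c m' * thetaKer_F n i b a m m'
    · exact f2.subset fun _ h => right_ne_zero_of_mul h
    · exact f4
    · exact f1.subset fun _ h => right_ne_zero_of_mul h
    · exact f3
  compK i b a := by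
    refine LinearMap.ext fun c => funext fun m => ?_
    simp only [LinearMap.smul_apply, Module.End.mul_apply, Pi.smul_apply, smul_eq_mul]
    have hK : ∀ (x : FT n) (l : Wt n), opK n i 1 x l = q ^ psum i l * x l := fun x l => by
      simp [opK, psum]
    simp only [thetaOp]
    rw [hK, kerOp_apply, kerOp_apply, ← mul_assoc, mul_finsum, mul_finsum]
    refine finsum_congr fun m' => ?_
    rw [hK]
    by_cases h : rker n b a m m' = 0
    · rw [thetaKer, h]; ring
    · have := rker_psum h i
      have e : q ^ pair i b * q ^ psum i m = q ^ pair i a * q ^ psum i m' := by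
        rw [← zpow_add₀ q_ne_zero, ← zpow_add₀ q_ne_zero]; congr 1; omega
      linear_combination (thetaKer n b a m m' * c m') * e

/-! ### Uniqueness of the quasi-`R`-matrix -/

/-- Induction along the chain `v_a, v_{a+1}, …` of the natural representation: a property of pairs
`(b, a)` propagates along the recursion for the coefficients of `v_b` in an intertwiner at `v_a`
which is provided by the action of the `E_i`. -/
theorem chain_induction {P : ℤ → ℤ → Prop} (hdiag : ∀ a, P a a) (hlow : ∀ b a, b < a → P b a)
    (step : ∀ i b a, eCoef i (b + 1) ≠ 0 → a ≤ b → P b a → (eCoef i a ≠ 0 → P b (a - 1)) →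
      P (b + 1) a) : ∀ b a, P b a := by
  -- `v_{b+1}` is mapped to a non-zero multiple of `v_b` by exactly one `E_i`
  have hex : ∀ b : ℤ, ∃ i : ℕ, eCoef i (b + 1) ≠ 0 ∧ (b = i ∨ b + 1 = -i) := by
    intro b
    rcases le_or_gt 0 b with hb | hb
    · obtain ⟨k, rfl⟩ := Int.eq_ofNat_of_zero_le hb
      exact ⟨k, by rw [eCoef_top]; exact one_ne_zero, Or.inl rfl⟩
    · refine ⟨(b + 1).natAbs, ?_, Or.inr (by omega)⟩
      rcases eq_or_ne (b + 1).natAbs 0 with h0 | h0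
      · have : b + 1 = 0 := by omega
        rw [this]; simp [eCoef, two_ne_zero']
      · have : b + 1 = -((b + 1).natAbs : ℤ) := by omega
        rw [this, Int.natAbs_neg, Int.natAbs_natCast, eCoef_bot h0]
        exact one_ne_zero
  have main : ∀ d : ℕ, ∀ b a : ℤ, b - a ≤ d → P b a := by
    intro d
    induction d with
    | zero =>
      intro b a h
      rcases eq_or_ne b a with rfl | hne
      · exact hdiag b
      · exact hlow b a (by push_cast at h; omega)
    | succ d ih =>
      have generic : ∀ i b a, eCoef i (b + 1) ≠ 0 → eCoef i a = 0 → b + 1 - a ≤ (d + 1 : ℕ) →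
          P (b + 1) a := by
        intro i b a hi h0 hba
        rcases le_or_gt a b with hab | hab
        · exact step i b a hi hab (ih b a (by push_cast at hba; omega)) fun h => absurd h0 h
        · rcases eq_or_ne (b + 1) a with h | h
          · rw [h]; exact hdiag a
          · exact hlow _ _ (by omega)
      intro b a hba
      rcases le_or_gt b a with hab | hab
      · exact ih b a (by omega)
      obtain ⟨i, hi, hi'⟩ := hex (b - 1)
      rw [show b = b - 1 + 1 by ring]
      refine step i (b - 1) a hi (by omega) (ih _ _ (by push_cast at hba; omega)) fun h => ?_
      -- the pair `(b - 1, a - 1)` has the same distance as `(b, a)`, but for it the next `E_j`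
      -- kills `v_{a-1}`, so the recursion has no second term
      obtain ⟨j, hj, hj'⟩ := hex (b - 1 - 1)
      rw [show b - 1 = b - 1 - 1 + 1 by ring]
      refine generic j _ _ hj ?_ (by push_cast at hba ⊢; omega)
      have := eCoef_ne_zero h
      refine eCoef_of_ne ?_ ?_ <;> omega
  exact fun b a => main (b - a).toNat b a (by omega)

/-- The quasi-`R`-matrix is determined by its leading term and the relations for the `E_i`. -/
theorem IsQuasiR.unique {n : ℕ} {Θ Θ' : ℤ → ℤ → Module.End Qq (FT n)} (h : IsQuasiR n Θ)
    (h' : IsQuasiR n Θ') : Θ = Θ' := by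
  funext b a
  refine chain_induction (P := fun b a => Θ b a = Θ' b a) ?_ ?_ ?_ b a
  · intro a; rw [h.diag, h'.diag]
  · intro b a hba; rw [h.lower b a hba, h'.lower b a hba]
  · intro i b a hi _ h1 h2
    have e : eCoef i a • Θ b (a - 1) = eCoef i a • Θ' b (a - 1) := by
      by_cases h0 : eCoef i a = 0
      · rw [h0, zero_smul, zero_smul]
      · rw [h2 h0]
    have c1 := h.compE i b a
    have c2 := h'.compE i b a
    rw [h1, e, ← c2] at c1
    exact smul_right_injective _ hi (add_right_cancel c1)

theorem quasiR_eq (n : ℕ) : quasiR n = thetaOp n := by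
  have hex : ∃ Θ, IsQuasiR n Θ := ⟨_, isQuasiR_thetaOp n⟩
  rw [quasiR, dif_pos hex]
  exact hex.choose_spec.unique (isQuasiR_thetaOp n)

/-- A subspace stable under all `E_i` is stable under the quasi-`R`-matrix. -/
theorem thetaOp_mem {n : ℕ} (W : Submodule Qq (FT n)) (hW : ∀ i, ∀ x ∈ W, opE n i x ∈ W)
    (b a : ℤ) : ∀ x ∈ W, thetaOp n b a x ∈ W := by
  have h := isQuasiR_thetaOp n
  refine chain_induction (P := fun b a => ∀ x ∈ W, thetaOp n b a x ∈ W) ?_ ?_ ?_ b a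
  · intro a x hx; rw [h.diag]; exact hx
  · intro b a hba x _; rw [h.lower b a hba]; exact W.zero_mem
  · intro i b a hi _ h1 h2 x hx
    have c := LinearMap.congr_fun (h.compE i b a) x
    simp only [LinearMap.add_apply, LinearMap.smul_apply, Module.End.mul_apply] at c
    have e : eCoef i a • thetaOp n b (a - 1) x ∈ W := by
      by_cases h0 : eCoef i a = 0
      · rw [h0, zero_smul]; exact W.zero_mem
      · exact W.smul_mem _ (h2 h0 x hx)
    have : eCoef i (b + 1) • thetaOp n (b + 1) a x ∈ W := by
      rw [eq_sub_of_add_eq c]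
      exact W.sub_mem (W.add_mem e (W.smul_mem _ (h1 _ (hW i x hx))))
        (W.smul_mem _ (hW i _ (h1 x hx)))
    exact (W.smul_mem_iff hi).1 this

/-! ### The bar involution on `T̂ⁿ` -/

/-- The coefficient of `v_a` in the last tensor factor. -/
def slice {n : ℕ} (c : FT (n + 1)) (a : ℤ) : FT n := fun l => c (Fin.snoc (α := fun _ => ℤ) l a)

theorem slice_apply {n : ℕ} (c : FT (n + 1)) (a : ℤ) (l : Wt n) :
    slice c a l = c (Fin.snoc (α := fun _ => ℤ) l a) := rfl

theorem ext_slice {n : ℕ} {c d : FT (n + 1)} (h : ∀ a, slice c a = slice d a) : c = d := by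
  funext m
  rw [← Fin.snoc_init_self m]
  exact congrFun (h _) _

theorem slice_add {n : ℕ} (c d : FT (n + 1)) (a : ℤ) : slice (c + d) a = slice c a + slice d a :=
  rfl

theorem slice_smul {n : ℕ} (r : Qq) (c : FT (n + 1)) (a : ℤ) : slice (r • c) a = r • slice c a :=
  rfl

theorem slice_opE {n : ℕ} (i : ℕ) (c : FT (n + 1)) (b : ℤ) :
    slice (opE (n + 1) i c) b
      = eCoef i (b + 1) • slice c (b + 1) + q ^ (-pair i b) • opE n i (slice c b) :=
  funext fun m => opE_snoc i c m b

theorem opK_apply {n : ℕ} (i : ℕ) (ε : ℤ) (c : FT n) (m : Wt n) :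
    opK n i ε c m = q ^ (ε * psum i m) * c m := rfl

theorem slice_opF {n : ℕ} (i : ℕ) (c : FT (n + 1)) (b : ℤ) :
    slice (opF (n + 1) i c) b
      = fCoef i (b - 1) • opK n i 1 (slice c (b - 1)) + opF n i (slice c b) :=
  funext fun m => by
    rw [slice_apply, opF_snoc, Pi.add_apply, Pi.smul_apply, opK_apply, one_mul, smul_eq_mul,
      mul_assoc]
    rfl

theorem Below.of_snoc {n N : ℕ} {l : Wt n} {a : ℤ}
    (h : Below N (Fin.snoc (α := fun _ => ℤ) l a : Wt (n + 1))) :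
    Below (max N a.natAbs) l := fun r hr => by
  have h' := h r (by omega)
  have e : lev r a = 0 := lev_eq_zero (by omega)
  simp only [tl_snoc, e, ite_self, add_zero] at h'
  exact h'

theorem Below.neg_le {n N : ℕ} {l : Wt n} {a : ℤ}
    (h : Below N (Fin.snoc (α := fun _ => ℤ) l a : Wt (n + 1))) : -(N : ℤ) ≤ a := by
  have h' := (h N le_rfl).2 n
  rw [tl_snoc, if_pos le_rfl, tl_of_le l le_rfl, zero_add] at h'
  unfold lev at h'; split_ifs at h' <;> omega

theorem slice_mem_THat {n : ℕ} {c : FT (n + 1)} (hc : c ∈ THat (n + 1)) (a : ℤ) :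
    slice c a ∈ THat n := by
  rw [mem_THat_iff] at *
  obtain ⟨N, hN⟩ := hc
  exact ⟨_, fun m hm => (hN _ hm).of_snoc⟩

theorem exists_slice_eq_zero {n : ℕ} {c : FT (n + 1)} (hc : c ∈ THat (n + 1)) :
    ∃ A : ℤ, ∀ a, a < A → slice c a = 0 := by
  rw [mem_THat_iff] at hc
  obtain ⟨N, hN⟩ := hc
  refine ⟨-N, fun a ha => funext fun m => ?_⟩
  by_contra h
  have := (hN _ h).neg_le
  omega

theorem bar_snoc {n : ℕ} (c : FT (n + 1)) (m : Wt n) (b : ℤ) :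
    bar (n + 1) c (Fin.snoc (α := fun _ => ℤ) m b)
      = ∑ᶠ a : ℤ, thetaOp n b a (bar n (slice c a)) m := by
  simp only [bar, Fin.snoc_last, Fin.snoc_castSucc, quasiR_eq]
  rfl

theorem thetaOp_lower {n : ℕ} {b a : ℤ} (h : b < a) : thetaOp n b a = 0 :=
  (isQuasiR_thetaOp n).lower b a h

theorem thetaOp_diag {n : ℕ} (a : ℤ) : thetaOp n a a = 1 := (isQuasiR_thetaOp n).diag a

theorem bar_zero : ∀ n : ℕ, bar n 0 = 0
  | 0 => funext fun _ => map_zero barQ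
  | n + 1 => by
    refine ext_slice fun b => funext fun m => ?_
    rw [slice_apply, bar_snoc]
    refine (finsum_congr fun a => ?_).trans finsum_zero
    have : slice (0 : FT (n + 1)) a = 0 := rfl
    rw [this, bar_zero n, map_zero]; rfl

theorem slice_bar {n : ℕ} (c : FT (n + 1)) (b : ℤ) (C : Finset ℤ)
    (hC : ∀ a, a ≤ b → a ∉ C → slice c a = 0) :
    slice (bar (n + 1) c) b = ∑ a ∈ C, thetaOp n b a (bar n (slice c a)) := by
  funext m
  rw [slice_apply, bar_snoc, Finset.sum_apply]
  refine finsum_eq_sum_of_support_subset _ fun a ha => ?_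
  by_contra h
  apply ha
  change thetaOp n b a (bar n (slice c a)) m = 0
  rcases le_or_gt a b with hab | hab
  · rw [hC a hab (by simpa using h), bar_zero, map_zero]; rfl
  · rw [thetaOp_lower hab]; rfl

/-- The non-zero entries of the fused `R`-matrix are triangular for the Bruhat order. -/
theorem rker_succeq : ∀ (n : ℕ) (m m' : Wt n), ∀ {b a : ℤ}, rker n b a m m' ≠ 0 →
    Succeq (Fin.snoc (α := fun _ => ℤ) m' a : Wt (n + 1)) (Fin.snoc (α := fun _ => ℤ) m b) := by
  have main : ∀ (n : ℕ) (m m' : Wt n), ∀ {b a : ℤ}, rker n b a m m' ≠ 0 →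
      ∀ t r, t ≤ n → tl m' t r + lev r a ≤ tl m t r + lev r b := by
    refine wt_induction ?_ ?_
    · intro m m' b a h t r _
      simp only [rker, ne_eq, ite_eq_right_iff, Classical.not_imp] at h
      rw [h.1]; simp [tl]
    · intro n ih m m' p p' b a h t r ht
      rcases Nat.lt_or_ge n t with ht' | ht'
      · rw [tl_of_le _ (by omega), tl_of_le _ (by omega), zero_add, zero_add]
        exact lev_mono r (le_of_rker_ne_zero _ _ _ h)
      rw [rker_snoc] at h
      obtain ⟨c, hc, h⟩ := Finset.exists_ne_zero_of_sum_ne_zero h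
      obtain ⟨h1, h2⟩ := mul_ne_zero_iff.1 h
      have := ih m m' h2 t r ht'
      have := lev_of_locR_ne_zero h1 r
      rw [tl_snoc, tl_snoc, if_pos ht', if_pos ht']
      omega
  intro n m m' b a h
  rw [succeq_iff]
  constructor
  · intro r
    rw [tl_snoc, tl_snoc, if_pos (Nat.zero_le _), if_pos (Nat.zero_le _), rker_weight n m m' h r]
  · intro t r
    rw [tl_snoc, tl_snoc]
    split_ifs with ht
    · exact main n m m' h t r ht
    · rw [tl_of_le _ (by omega), tl_of_le _ (by omega)]

theorem succeq_snoc {n : ℕ} {l m : Wt n} (h : Succeq l m) (a : ℤ) :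
    Succeq (Fin.snoc (α := fun _ => ℤ) l a : Wt (n + 1)) (Fin.snoc (α := fun _ => ℤ) m a) := by
  rw [succeq_iff] at *
  simp only [tl_snoc]
  exact ⟨fun r => by rw [h.1 r], fun t r => by have := h.2 t r; omega⟩

theorem last_le_of_succeq {n : ℕ} {l m : Wt n} {a b : ℤ}
    (h : Succeq (Fin.snoc (α := fun _ => ℤ) l a : Wt (n + 1)) (Fin.snoc (α := fun _ => ℤ) m b)) :
    a ≤ b := by
  rw [succeq_iff] at h
  refine le_of_lev_le fun r => ?_
  have := h.2 n r
  simpa [tl_snoc, tl_of_le] using this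

theorem thetaOp_congr {n : ℕ} {b a : ℤ} {x y : FT n} {m : Wt n}
    (h : ∀ l, Succeq (Fin.snoc (α := fun _ => ℤ) l a : Wt (n + 1))
      (Fin.snoc (α := fun _ => ℤ) m b) → x l = y l) : thetaOp n b a x m = thetaOp n b a y m := by
  rw [thetaOp_apply, thetaOp_apply]
  refine finsum_congr fun l => ?_
  by_cases h0 : rker n b a m l = 0
  · rw [thetaKer, h0]; ring
  · rw [h l (rker_succeq n m l h0)]

/-- Locality: the coefficient of `N_m` in `x̄` depends only on the coefficients of the `N_l` in `x`
with `l ⪰ m`. -/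
theorem bar_congr : ∀ {n : ℕ} {c d : FT n}, c ∈ THat n → d ∈ THat n → ∀ {m : Wt n},
    (∀ l, Succeq l m → c l = d l) → bar n c m = bar n d m
  | 0, c, d, _, _, m, h => congrArg barQ (h m (succeq_refl m))
  | n + 1, c, d, hc, hd, m, h => by
    rw [← Fin.snoc_init_self m] at h ⊢
    generalize m (Fin.last n) = b at h ⊢
    generalize Fin.init m = m at h ⊢
    rw [bar_snoc, bar_snoc]
    refine finsum_congr fun a => thetaOp_congr fun l hl => ?_
    exact bar_congr (slice_mem_THat hc a) (slice_mem_THat hd a)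
      fun k hk => h _ (succeq_trans (succeq_snoc hk a) hl)

theorem bar_add : ∀ {n : ℕ} {c d : FT n}, c ∈ THat n → d ∈ THat n →
    bar n (c + d) = bar n c + bar n d
  | 0, c, d, _, _ => funext fun _ => map_add barQ _ _
  | n + 1, c, d, hc, hd => by
    obtain ⟨A, hA⟩ := exists_slice_eq_zero hc
    obtain ⟨B, hB⟩ := exists_slice_eq_zero hd
    refine ext_slice fun b => ?_
    have h1 : ∀ a, a ≤ b → a ∉ Finset.Icc (min A B) b → slice c a = 0 := fun a h h' => by
      rw [Finset.mem_Icc] at h'; exact hA a (by omega)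
    have h2 : ∀ a, a ≤ b → a ∉ Finset.Icc (min A B) b → slice d a = 0 := fun a h h' => by
      rw [Finset.mem_Icc] at h'; exact hB a (by omega)
    rw [slice_add, slice_bar c b _ h1, slice_bar d b _ h2,
      slice_bar (c + d) b (Finset.Icc (min A B) b)
      (fun a h h' => by rw [slice_add, h1 a h h', h2 a h h', add_zero]), ← Finset.sum_add_distrib]
    refine Finset.sum_congr rfl fun a _ => ?_
    rw [slice_add, bar_add (slice_mem_THat hc a) (slice_mem_THat hd a), map_add]

theorem bar_smul : ∀ {n : ℕ} (r : Qq) {c : FT n}, c ∈ THat n → bar n (r • c) = barQ r • bar n c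
  | 0, r, c, _ => funext fun _ => map_mul barQ _ _
  | n + 1, r, c, hc => by
    obtain ⟨A, hA⟩ := exists_slice_eq_zero hc
    refine ext_slice fun b => ?_
    have h1 : ∀ a, a ≤ b → a ∉ Finset.Icc A b → slice c a = 0 := fun a h h' => by
      rw [Finset.mem_Icc] at h'; exact hA a (by omega)
    rw [slice_smul, slice_bar c b _ h1, slice_bar (r • c) b (Finset.Icc A b)
      (fun a h h' => by rw [slice_smul, h1 a h h', smul_zero]), Finset.smul_sum]
    refine Finset.sum_congr rfl fun a _ => ?_
    rw [slice_smul, bar_smul r (slice_mem_THat hc a), map_smul]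

theorem bar_sum {n : ℕ} {ι : Type*} (s : Finset ι) (f : ι → FT n) (hf : ∀ i ∈ s, f i ∈ THat n) :
    bar n (∑ i ∈ s, f i) = ∑ i ∈ s, bar n (f i) := by
  classical
  induction s using Finset.induction_on with
  | empty => rw [Finset.sum_empty, Finset.sum_empty, bar_zero]
  | insert a s ha ih =>
    rw [Finset.sum_insert ha, Finset.sum_insert ha, bar_add (hf a (Finset.mem_insert_self a s))
      (Submodule.sum_mem _ fun i hi => hf i (Finset.mem_insert_of_mem hi)),
      ih fun i hi => hf i (Finset.mem_insert_of_mem hi)]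

theorem bar_sub {n : ℕ} {c d : FT n} (hc : c ∈ THat n) (hd : d ∈ THat n) :
    bar n (c - d) = bar n c - bar n d := by
  have e : c - d = c + (-1 : Qq) • d := by rw [neg_one_smul, sub_eq_add_neg]
  rw [e, bar_add hc (Submodule.smul_mem _ _ hd), bar_smul _ hd, map_neg, map_one, neg_one_smul,
    sub_eq_add_neg]

theorem exists_of_bar_ne_zero {n : ℕ} {c : FT n} (hc : c ∈ THat n) {m : Wt n}
    (h : bar n c m ≠ 0) : ∃ l, Succeq l m ∧ c l ≠ 0 := by
  by_contra h'
  push Not at h'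
  apply h
  rw [bar_congr hc (THat n).zero_mem h', bar_zero]; rfl

theorem bar_mem_THat {n : ℕ} {c : FT n} (hc : c ∈ THat n) : bar n c ∈ THat n := by
  have hc' := hc
  obtain ⟨S, hS⟩ := hc
  refine ⟨S, fun m hm => ?_⟩
  obtain ⟨l, hl, h⟩ := exists_of_bar_ne_zero hc' hm
  obtain ⟨s, hs, h'⟩ := hS l h
  exact ⟨s, hs, succeq_trans h' hl⟩

/-! ### Compatibility of the bar involution with the quantum group -/

theorem barQ_zpow (k : ℤ) : barQ (q ^ k) = q ^ (-k) := by
  rw [map_zpow₀, barQ_q, inv_zpow, zpow_neg]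

theorem barQ_two : barQ two = two := by
  rw [two, map_add, map_inv₀, barQ_q, inv_inv, add_comm]

theorem barQ_eCoef (i : ℕ) (a : ℤ) : barQ (eCoef i a) = eCoef i a := by
  unfold eCoef
  split_ifs
  · exact map_one _
  · exact barQ_two
  · exact map_one _
  · exact map_zero _

theorem barQ_fCoef (i : ℕ) (a : ℤ) : barQ (fCoef i a) = fCoef i a := by
  rw [fCoef_eq, barQ_eCoef]

theorem fCoef_ne_zero {i : ℕ} {a : ℤ} (h : fCoef i a ≠ 0) : a = i ∨ a = -i - 1 := by
  rw [fCoef_eq] at h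
  have := eCoef_ne_zero h
  omega

theorem Below.of_update {n N : ℕ} {m : Wt n} {k : Fin n} {x : ℤ}
    (h : Below N (Function.update m k x)) (hx : x.natAbs ≤ N) (hk : (m k).natAbs ≤ N) :
    Below N m := fun r hr => by
  have e : ∀ t, tl m t r = tl (Function.update m k x) t r := fun t =>
    Finset.sum_congr rfl fun j _ => by
      rcases eq_or_ne j k with rfl | hj
      · rw [Function.update_self, lev_eq_zero (hx.trans hr), lev_eq_zero (hk.trans hr)]
      · rw [Function.update_of_ne hj]
  simp only [e]
  exact h r hr

theorem opE_mem_THat {n : ℕ} (i : ℕ) {c : FT n} (hc : c ∈ THat n) : opE n i c ∈ THat n := by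
  rw [mem_THat_iff] at *
  obtain ⟨N, hN⟩ := hc
  refine ⟨max N (i + 1), fun m hm => ?_⟩
  simp only [opE, LinearMap.coe_mk, AddHom.coe_mk] at hm
  obtain ⟨k, -, hk⟩ := Finset.exists_ne_zero_of_sum_ne_zero hm
  have := eCoef_ne_zero (right_ne_zero_of_mul (left_ne_zero_of_mul hk))
  exact ((hN _ (right_ne_zero_of_mul hk)).mono (le_max_left _ _)).of_update (by omega) (by omega)

theorem opF_mem_THat {n : ℕ} (i : ℕ) {c : FT n} (hc : c ∈ THat n) : opF n i c ∈ THat n := by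
  rw [mem_THat_iff] at *
  obtain ⟨N, hN⟩ := hc
  refine ⟨max N (i + 1), fun m hm => ?_⟩
  simp only [opF, LinearMap.coe_mk, AddHom.coe_mk] at hm
  obtain ⟨k, -, hk⟩ := Finset.exists_ne_zero_of_sum_ne_zero hm
  have := fCoef_ne_zero (right_ne_zero_of_mul (left_ne_zero_of_mul hk))
  exact ((hN _ (right_ne_zero_of_mul hk)).mono (le_max_left _ _)).of_update (by omega) (by omega)

theorem opK_mem_THat {n : ℕ} (i : ℕ) (ε : ℤ) {c : FT n} (hc : c ∈ THat n) :
    opK n i ε c ∈ THat n := by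
  obtain ⟨S, hS⟩ := hc
  exact ⟨S, fun m hm => hS m (right_ne_zero_of_mul hm)⟩

theorem psum_eq_of_succeq {n : ℕ} {l m : Wt n} (h : Succeq l m) (i : ℕ) : psum i l = psum i m := by
  rw [succeq_iff] at h
  rw [psum_eq_tl, psum_eq_tl, h.1, h.1, h.1]

theorem bar_opK {n : ℕ} (i : ℕ) (ε : ℤ) {c : FT n} (hc : c ∈ THat n) :
    bar n (opK n i ε c) = opK n i (-ε) (bar n c) := by
  funext m
  have : bar n (opK n i ε c) m = bar n (q ^ (ε * psum i m) • c) m :=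
    bar_congr (opK_mem_THat i ε hc) (Submodule.smul_mem _ _ hc) fun l hl => by
      rw [opK_apply, psum_eq_of_succeq hl]; rfl
  rw [this, bar_smul _ hc, barQ_zpow, opK_apply, neg_mul]; rfl

/-- The bar involution commutes with the `E_i`. -/
theorem bar_opE : ∀ {n : ℕ} (i : ℕ) {c : FT n}, c ∈ THat n →
    bar n (opE n i c) = opE n i (bar n c)
  | 0, i, c, _ => by
    have h : ∀ x : FT 0, opE 0 i x = 0 := fun x => funext fun m => by simp [opE]
    rw [h, h, bar_zero]
  | n + 1, i, c, hc => by
    obtain ⟨A, hA⟩ := exists_slice_eq_zero hc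
    refine ext_slice fun b => ?_
    set C := Finset.Icc (A - 1) (b + 1) with hCdef
    have hC : ∀ a, a ∉ C → a ≤ b + 1 → slice c a = 0 := fun a h h' => by
      rw [hCdef, Finset.mem_Icc] at h; exact hA a (by omega)
    have hs := fun a => slice_mem_THat hc a
    rw [slice_opE, slice_bar c (b + 1) C fun a h h' => hC a h' h,
      slice_bar c b C fun a h h' => hC a h' (by omega),
      slice_bar (opE (n + 1) i c) b C, map_sum, Finset.smul_sum, Finset.smul_sum,
      ← Finset.sum_add_distrib]
    swap
    · intro a h h'
      rw [hCdef, Finset.mem_Icc] at h'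
      rw [slice_opE, hA a (by omega), hA (a + 1) (by omega), smul_zero, map_zero, smul_zero,
        add_zero]
    have e1 : ∀ a, thetaOp n b a (bar n (slice (opE (n + 1) i c) a))
        = eCoef i (a + 1) • thetaOp n b a (bar n (slice c (a + 1)))
          + q ^ pair i a • thetaOp n b a (opE n i (bar n (slice c a))) := by
      intro a
      rw [slice_opE, bar_add (Submodule.smul_mem _ _ (hs _))
        (Submodule.smul_mem _ _ (opE_mem_THat i (hs _))), bar_smul _ (hs _),
        bar_smul _ (opE_mem_THat i (hs _)), barQ_eCoef, barQ_zpow, neg_neg, bar_opE i (hs _),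
        map_add, map_smul, map_smul]
    rw [Finset.sum_congr rfl fun a _ => e1 a, Finset.sum_add_distrib]
    have e2 : ∑ a ∈ C, eCoef i (a + 1) • thetaOp n b a (bar n (slice c (a + 1)))
        = ∑ a ∈ C, eCoef i a • thetaOp n b (a - 1) (bar n (slice c a)) := by
      have := sum_shift (fun a => eCoef i a • thetaOp n b (a - 1) (bar n (slice c a))) C C
        (fun a ha => ?_) (fun a ha => ?_)
      · simpa only [add_sub_cancel_right] using this.symm
      · by_contra h
        rw [hCdef, Finset.mem_Icc] at h
        apply ha
        by_cases h1 : a < A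
        · rw [hA a h1, bar_zero, map_zero, smul_zero]
        · rw [thetaOp_lower (by omega), LinearMap.zero_apply, smul_zero]
      · by_contra h
        rw [hCdef, Finset.mem_Icc] at h
        apply ha
        by_cases h1 : a + 1 < A
        · rw [hA _ h1, bar_zero, map_zero, smul_zero]
        · rw [thetaOp_lower (by omega), LinearMap.zero_apply, smul_zero]
    rw [e2, ← Finset.sum_add_distrib]
    refine Finset.sum_congr rfl fun a _ => ?_
    exact (LinearMap.congr_fun ((isQuasiR_thetaOp n).compE i b a) (bar n (slice c a))).symm

/-- The bar involution commutes with the `F_i`. -/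
theorem bar_opF : ∀ {n : ℕ} (i : ℕ) {c : FT n}, c ∈ THat n →
    bar n (opF n i c) = opF n i (bar n c)
  | 0, i, c, _ => by
    have h : ∀ x : FT 0, opF 0 i x = 0 := fun x => funext fun m => by simp [opF]
    rw [h, h, bar_zero]
  | n + 1, i, c, hc => by
    obtain ⟨A, hA⟩ := exists_slice_eq_zero hc
    refine ext_slice fun b => ?_
    set C := Finset.Icc (A - 1) (b + 1) with hCdef
    have hC : ∀ a, a ∉ C → a ≤ b + 1 → slice c a = 0 := fun a h h' => by
      rw [hCdef, Finset.mem_Icc] at h; exact hA a (by omega)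
    have hs := fun a => slice_mem_THat hc a
    rw [slice_opF, slice_bar c (b - 1) C fun a h h' => hC a h' (by omega),
      slice_bar c b C fun a h h' => hC a h' (by omega),
      slice_bar (opF (n + 1) i c) b C, map_sum, map_sum, Finset.smul_sum,
      ← Finset.sum_add_distrib]
    swap
    · intro a h h'
      rw [hCdef, Finset.mem_Icc] at h'
      rw [slice_opF, hA a (by omega), hA (a - 1) (by omega), map_zero, map_zero, smul_zero,
        add_zero]
    have e1 : ∀ a, thetaOp n b a (bar n (slice (opF (n + 1) i c) a))
        = fCoef i (a - 1) • thetaOp n b a (opK n i (-1) (bar n (slice c (a - 1))))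
          + thetaOp n b a (opF n i (bar n (slice c a))) := by
      intro a
      rw [slice_opF, bar_add (Submodule.smul_mem _ _ (opK_mem_THat i 1 (hs _)))
        (opF_mem_THat i (hs _)), bar_smul _ (opK_mem_THat i 1 (hs _)), barQ_fCoef,
        bar_opK i 1 (hs _), bar_opF i (hs _), map_add, map_smul]
    rw [Finset.sum_congr rfl fun a _ => e1 a, Finset.sum_add_distrib]
    have e2 : ∑ a ∈ C, fCoef i (a - 1) • thetaOp n b a (opK n i (-1) (bar n (slice c (a - 1))))
        = ∑ a ∈ C, fCoef i a • thetaOp n b (a + 1) (opK n i (-1) (bar n (slice c a))) := by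
      have := sum_shift
        (fun a => fCoef i (a - 1) • thetaOp n b a (opK n i (-1) (bar n (slice c (a - 1))))) C C
        (fun a ha => ?_) (fun a ha => ?_)
      · simpa only [add_sub_cancel_right] using this
      · by_contra h
        rw [hCdef, Finset.mem_Icc] at h
        apply ha
        by_cases h1 : a - 1 < A
        · rw [hA _ h1, bar_zero, map_zero, map_zero, smul_zero]
        · rw [thetaOp_lower (by omega), LinearMap.zero_apply, smul_zero]
      · by_contra h
        rw [hCdef, Finset.mem_Icc] at h
        apply ha
        by_cases h1 : a + 1 - 1 < A
        · rw [hA _ h1, bar_zero, map_zero, map_zero, smul_zero]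
        · rw [thetaOp_lower (by omega), LinearMap.zero_apply, smul_zero]
    rw [e2, ← Finset.sum_add_distrib]
    refine Finset.sum_congr rfl fun a _ => ?_
    exact (LinearMap.congr_fun ((isQuasiR_thetaOp n).compF i b a) (bar n (slice c a))).symm

/-! ### The bar involution is an involution -/

theorem barQ_barQ (x : Qq) : barQ (barQ x) = x := by
  have h : barQ.comp barQ = RingHom.id Qq := by
    refine IsFractionRing.ringHom_ext (A := Polynomial ℚ) ?_
    intro p
    induction p using Polynomial.induction_on' with
    | add p r hp hr => simp only [map_add, hp, hr]
    | monomial k a =>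
      have hX : (algebraMap (Polynomial ℚ) Qq) Polynomial.X = q := RatFunc.algebraMap_X
      have hC : ∀ f : Qq →+* Qq, f (algebraMap (Polynomial ℚ) Qq (Polynomial.C a))
          = algebraMap (Polynomial ℚ) Qq (Polynomial.C a) := fun f =>
        RingHom.congr_fun (Subsingleton.elim
          (f.comp ((algebraMap (Polynomial ℚ) Qq).comp Polynomial.C))
          ((algebraMap (Polynomial ℚ) Qq).comp Polynomial.C)) a
      rw [← Polynomial.C_mul_X_pow_eq_monomial, map_mul, map_mul, map_pow, hX, hC, map_mul, map_pow,
        hC]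
      congr 1
      rw [RingHom.comp_apply, barQ_q, map_inv₀, barQ_q, inv_inv]
      rfl
  exact RingHom.congr_fun h x

/-- The formal sum `x ⊗ v_a`. -/
def single {n : ℕ} (a : ℤ) (x : FT n) : FT (n + 1) := fun m =>
  if m (Fin.last n) = a then x (Fin.init m) else 0

theorem slice_single {n : ℕ} (a b : ℤ) (x : FT n) :
    slice (single a x) b = if b = a then x else 0 := by
  funext m
  rw [slice_apply, single, Fin.snoc_last, Fin.init_snoc]
  split_ifs <;> rfl

theorem single_mem_THat {n : ℕ} (a : ℤ) {x : FT n} (hx : x ∈ THat n) :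
    single a x ∈ THat (n + 1) := by
  rw [mem_THat_iff] at *
  obtain ⟨N, hN⟩ := hx
  refine ⟨max N a.natAbs, fun m hm r hr => ?_⟩
  rw [← Fin.snoc_init_self m] at hm ⊢
  rw [single] at hm
  split_ifs at hm with h
  · rw [Fin.snoc_last] at h
    rw [Fin.init_snoc] at hm
    simp only [tl_snoc, h, lev_eq_zero (show a.natAbs ≤ r by omega), ite_self, add_zero]
    exact hN _ hm r (by omega)
  · exact absurd rfl hm

theorem opE_single {n : ℕ} (i : ℕ) (a : ℤ) (x : FT n) :
    opE (n + 1) i (single a x)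
      = eCoef i a • single (a - 1) x + q ^ (-pair i a) • single a (opE n i x) := by
  refine ext_slice fun b => ?_
  rw [slice_opE, slice_add, slice_smul, slice_smul, slice_single, slice_single, slice_single,
    slice_single]
  congr 1
  · by_cases h : b + 1 = a
    · rw [if_pos h, if_pos (by omega), h]
    · rw [if_neg h, if_neg (by omega), smul_zero, smul_zero]
  · split_ifs with h
    · rw [h]
    · rw [map_zero, smul_zero, smul_zero]

theorem slice_bar_of_le {n : ℕ} {c : FT (n + 1)} {b : ℤ} (hc : ∀ a, a < b → slice c a = 0) :
    slice (bar (n + 1) c) b = bar n (slice c b) := by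
  rw [slice_bar c b {b} fun a h h' => hc a (lt_of_le_of_ne h (by simpa using h')),
    Finset.sum_singleton, thetaOp_diag]
  rfl

theorem slice_bar_eq_zero {n : ℕ} {c : FT (n + 1)} {b : ℤ} (hc : ∀ a, a ≤ b → slice c a = 0) :
    slice (bar (n + 1) c) b = 0 := by
  rw [slice_bar_of_le fun a h => hc a h.le, hc b le_rfl, bar_zero]

/-- The bar involution squares to the identity: its square is linear, commutes with the `E_i`, and
has the leading term of the identity. -/
theorem bar_bar : ∀ {n : ℕ} {c : FT n}, c ∈ THat n → bar n (bar n c) = c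
  | 0, c, _ => funext fun _ => barQ_barQ _
  | n + 1, c, hc => by
    have hbb : ∀ {d : FT (n + 1)}, d ∈ THat (n + 1) → ∀ r : Qq,
        bar (n + 1) (bar (n + 1) (r • d)) = r • bar (n + 1) (bar (n + 1) d) := fun hd r => by
      rw [bar_smul _ hd, bar_smul _ (bar_mem_THat hd), barQ_barQ]
    -- the square of the bar involution fixes `y ⊗ v_a`
    have key : ∀ b a, ∀ y ∈ THat n, slice (bar (n + 1) (bar (n + 1) (single a y))) b
        = if b = a then y else 0 := by
      refine chain_induction ?_ ?_ ?_
      · intro a y hy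
        have h0 : ∀ a', a' < a → slice (single a y) a' = 0 := fun a' h => by
          rw [slice_single, if_neg (by omega)]
        rw [slice_bar_of_le fun a' h => slice_bar_eq_zero fun a'' h' => h0 a'' (by omega),
          slice_bar_of_le h0, slice_single, if_pos rfl, bar_bar hy]
      · intro b a hba y hy
        rw [if_neg (by omega)]
        exact slice_bar_eq_zero fun a' h => slice_bar_eq_zero fun a'' h' => by
          rw [slice_single, if_neg (by omega)]
      · intro i b a hi hab h1 h2 y hy
        have hs := single_mem_THat a hy
        have hs' := single_mem_THat (a - 1) hy
        have hsE := single_mem_THat a (opE_mem_THat i hy)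
        have e := congrArg (fun c => slice c b)
          ((bar_opE i (bar_mem_THat hs)).symm.trans (congrArg (bar (n + 1)) (bar_opE i hs).symm))
        simp only [slice_opE] at e
        rw [opE_single, bar_add (Submodule.smul_mem _ _ hs') (Submodule.smul_mem _ _ hsE),
          bar_add (bar_mem_THat (Submodule.smul_mem _ _ hs'))
            (bar_mem_THat (Submodule.smul_mem _ _ hsE)), hbb hs', hbb hsE, slice_add, slice_smul,
          slice_smul, h1 y hy, h1 _ (opE_mem_THat i hy)] at e
        have e0 : eCoef i a • slice (bar (n + 1) (bar (n + 1) (single (a - 1) y))) b = 0 := by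
          by_cases h0 : eCoef i a = 0
          · rw [h0, zero_smul]
          · rw [h2 h0 y hy, if_neg (by omega), smul_zero]
        rw [e0, zero_add] at e
        rw [if_neg (by omega)]
        have e3 : q ^ (-pair i b) • opE n i (if b = a then y else 0)
            = q ^ (-pair i a) • if b = a then opE n i y else 0 := by
          split_ifs with h
          · rw [h]
          · rw [map_zero, smul_zero, smul_zero]
        rw [e3] at e
        exact (smul_eq_zero.1 (add_eq_right.1 e)).resolve_left hi
    obtain ⟨A, hA⟩ := exists_slice_eq_zero hc
    refine ext_slice fun b => funext fun m => ?_
    -- by locality, `c` may be replaced by a finite sum of vectors of the form `y ⊗ v_a`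
    set d : FT (n + 1) := ∑ a ∈ Finset.Icc A b, single a (slice c a) with hd
    have hmem : ∀ a ∈ Finset.Icc A b, single a (slice c a) ∈ THat (n + 1) := fun a _ =>
      single_mem_THat a (slice_mem_THat hc a)
    have hdm : d ∈ THat (n + 1) := Submodule.sum_mem _ hmem
    have hcd : ∀ l, Succeq l (Fin.snoc (α := fun _ => ℤ) m b) → c l = d l := by
      intro l hl
      rw [← Fin.snoc_init_self l] at hl ⊢
      have hle := last_le_of_succeq hl
      generalize l (Fin.last n) = x at hl hle ⊢
      generalize Fin.init l = l at hl ⊢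
      rw [hd, Finset.sum_apply]
      have e : ∀ a ∈ Finset.Icc A b, single a (slice c a) (Fin.snoc (α := fun _ => ℤ) l x)
          = if x = a then slice c x l else 0 := fun a _ => by
        have := congrFun (slice_single a x (slice c a)) l
        rw [slice_apply] at this
        rw [this]
        split_ifs with h
        · rw [h]
        · rfl
      rw [Finset.sum_congr rfl e, Finset.sum_ite_eq]
      change slice c x l = _
      split_ifs with h
      · rfl
      · rw [Finset.mem_Icc] at h
        rw [hA x (by omega)]; rfl
    have e1 : bar (n + 1) (bar (n + 1) c) (Fin.snoc (α := fun _ => ℤ) m b)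
        = bar (n + 1) (bar (n + 1) d) (Fin.snoc (α := fun _ => ℤ) m b) :=
      bar_congr (bar_mem_THat hc) (bar_mem_THat hdm) fun l hl =>
        bar_congr hc hdm fun k hk => hcd k (succeq_trans hk hl)
    rw [slice_apply, e1, hd, bar_sum _ _ hmem, bar_sum _ _ fun a ha => bar_mem_THat (hmem a ha)]
    change slice (∑ a ∈ Finset.Icc A b, bar (n + 1) (bar (n + 1) (single a (slice c a)))) b m = _
    have e2 : slice (∑ a ∈ Finset.Icc A b, bar (n + 1) (bar (n + 1) (single a (slice c a)))) b
        = ∑ a ∈ Finset.Icc A b, slice (bar (n + 1) (bar (n + 1) (single a (slice c a)))) b := by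
      funext m; simp only [slice_apply, Finset.sum_apply]
    rw [e2, Finset.sum_congr rfl fun a _ => key b a _ (slice_mem_THat hc a), Finset.sum_ite_eq]
    split_ifs with h
    · rfl
    · rw [Finset.mem_Icc] at h
      have : slice c b = 0 := by
        by_contra h0
        have : A ≤ b := by
          by_contra h'; exact h0 (hA b (by omega))
        omega
      rw [this]

/-! ### The matrix of the bar involution -/

/-- The basis vector `N_λ`. -/
def bas {n : ℕ} (l : Wt n) : FT n := Pi.single l 1

theorem bas_mem_THat {n : ℕ} (l : Wt n) : bas l ∈ THat n := by
  refine ⟨{l}, fun m hm => ⟨l, Finset.mem_singleton_self l, ?_⟩⟩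
  by_cases h : m = l
  · rw [h]; exact succeq_refl l
  · exact absurd (Pi.single_eq_of_ne h _) hm

/-- The coefficient of `N_m` in the image of `N_l` under the bar involution. -/
def barKer {n : ℕ} (m l : Wt n) : Qq := bar n (bas l) m

theorem succeq_of_barKer_ne_zero {n : ℕ} {m l : Wt n} (h : barKer m l ≠ 0) : Succeq l m := by
  obtain ⟨k, hk, h'⟩ := exists_of_bar_ne_zero (bas_mem_THat l) h
  by_cases hkl : k = l
  · rwa [hkl] at hk
  · exact absurd (Pi.single_eq_of_ne hkl _) h'

theorem finite_above {n : ℕ} {c : FT n} (hc : c ∈ THat n) (m : Wt n) :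
    {l | Succeq l m ∧ c l ≠ 0}.Finite := by
  obtain ⟨S, hS⟩ := hc
  refine (S.finite_toSet.biUnion fun s _ => finite_interval s m).subset fun l hl => ?_
  obtain ⟨s, hs, h⟩ := hS l hl.2
  exact Set.mem_biUnion hs ⟨h, hl.1⟩

/-- The bar involution is given by its matrix; the sum is finite since only the weights between
the support and `m` contribute. -/
theorem bar_apply {n : ℕ} {c : FT n} (hc : c ∈ THat n) (m : Wt n) (S : Finset (Wt n))
    (hS : ∀ l, Succeq l m → c l ≠ 0 → l ∈ S) :
    bar n c m = ∑ l ∈ S, barKer m l * barQ (c l) := by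
  have h1 : bar n c m = bar n (∑ l ∈ S, c l • bas l) m := by
    refine bar_congr hc (Submodule.sum_mem _ fun l _ => Submodule.smul_mem _ _ (bas_mem_THat l))
      fun l hl => ?_
    rw [Finset.sum_apply]
    simp only [bas, Pi.smul_apply, Pi.single_apply, smul_eq_mul, mul_ite, mul_one, mul_zero,
      Finset.sum_ite_eq]
    split_ifs with h
    · rfl
    · by_contra h0
      exact h (hS l hl h0)
  rw [h1, bar_sum _ _ fun l _ => Submodule.smul_mem _ _ (bas_mem_THat l), Finset.sum_apply]
  refine Finset.sum_congr rfl fun l _ => ?_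
  rw [bar_smul _ (bas_mem_THat l), Pi.smul_apply, smul_eq_mul, mul_comm]
  rfl

theorem bas_snoc {n : ℕ} (l : Wt n) (a : ℤ) :
    bas (Fin.snoc (α := fun _ => ℤ) l a : Wt (n + 1)) = single a (bas l) := by
  refine ext_slice fun b => funext fun m => ?_
  rw [slice_single, slice_apply]
  unfold bas
  rw [Pi.single_apply]
  by_cases hb : b = a
  · rw [if_pos hb, Pi.single_apply, hb]
    exact if_congr (by rw [Fin.snoc_inj]; simp) rfl rfl
  · rw [if_neg hb, if_neg (fun h => hb (Fin.snoc_inj.1 h).2)]; rfl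

theorem barKer_snoc {n : ℕ} (m l : Wt n) (b a : ℤ) :
    barKer (Fin.snoc (α := fun _ => ℤ) m b : Wt (n + 1)) (Fin.snoc (α := fun _ => ℤ) l a)
      = ∑ᶠ m', thetaKer n b a m m' * barKer m' l := by
  unfold barKer
  rw [bas_snoc, ← slice_apply (bar (n + 1) (single a (bas l))) b m,
    slice_bar _ b {a} fun a' _ h => by
      rw [slice_single, if_neg (by simpa using h)], Finset.sum_singleton, slice_single, if_pos rfl]
  rfl

theorem barKer_self : ∀ {n : ℕ} (l : Wt n), barKer l l = 1
  | 0, l => by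
    unfold barKer bar bas
    rw [Pi.single_eq_same, map_one]
  | n + 1, l => by
    rw [← Fin.snoc_init_self l]
    unfold barKer
    rw [bas_snoc, ← slice_apply (bar (n + 1) (single _ (bas _))) _ _, slice_bar_of_le fun a h => by
      rw [slice_single, if_neg (by omega)], slice_single, if_pos rfl]
    exact barKer_self _

theorem barKer_mul_barKer {n : ℕ} (m k : Wt n) (S : Finset (Wt n))
    (hS : ∀ l, Succeq k l → Succeq l m → l ∈ S) :
    ∑ l ∈ S, barKer m l * barQ (barKer l k) = if m = k then 1 else 0 := by
  have h := bar_apply (bar_mem_THat (bas_mem_THat k)) m S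
    fun l hl h => hS l (succeq_of_barKer_ne_zero h) hl
  rw [bar_bar (bas_mem_THat k)] at h
  rw [bas, Pi.single_apply] at h
  exact h.symm

/-! ### Laurent polynomials with integer coefficients -/

/-- The subring `ℤ[q, q⁻¹]` of `ℚ(q)`. -/
def laurentZ : Subring Qq := Subring.closure {q, q⁻¹}

theorem q_mem : q ∈ laurentZ := Subring.subset_closure (Or.inl rfl)

theorem q_inv_mem : q⁻¹ ∈ laurentZ := Subring.subset_closure (Or.inr rfl)

theorem q_zpow_mem (k : ℤ) : q ^ k ∈ laurentZ := by
  rcases k with k | k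
  · rw [Int.ofNat_eq_natCast, zpow_natCast]; exact pow_mem q_mem k
  · rw [zpow_negSucc, ← inv_pow]; exact pow_mem q_inv_mem _

theorem aeval_eq_eval₂ (x : Qq) (p : Polynomial ℤ) :
    Polynomial.aeval x p = Polynomial.eval₂ (Int.castRingHom Qq) x p := by
  rw [Polynomial.aeval_def, Subsingleton.elim (algebraMap ℤ Qq)]

theorem aeval_mem {x : Qq} (hx : x ∈ laurentZ) (p : Polynomial ℤ) :
    Polynomial.aeval x p ∈ laurentZ := by
  rw [aeval_eq_eval₂, Polynomial.eval₂_eq_sum_range]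
  exact sum_mem fun i _ => mul_mem (intCast_mem _ _) (pow_mem hx i)

theorem qInvZ_subset : qInvZ ⊆ laurentZ := by
  rintro _ ⟨p, rfl⟩
  exact mul_mem q_inv_mem (aeval_mem q_inv_mem p)

theorem qZ_subset : qZ ⊆ laurentZ := by
  rintro _ ⟨p, rfl⟩
  exact mul_mem q_mem (aeval_mem q_mem p)

theorem barQ_aeval (x : Qq) (p : Polynomial ℤ) :
    barQ (Polynomial.aeval x p) = Polynomial.aeval (barQ x) p := by
  rw [aeval_eq_eval₂, aeval_eq_eval₂, Polynomial.hom_eval₂,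
    Subsingleton.elim (barQ.comp _)]

theorem barQ_mem_qZ {x : Qq} (hx : x ∈ qInvZ) : barQ x ∈ qZ := by
  obtain ⟨p, rfl⟩ := hx
  exact ⟨p, by rw [map_mul, barQ_aeval, map_inv₀, barQ_q, inv_inv]⟩

theorem barQ_mem_qInvZ {x : Qq} (hx : x ∈ qZ) : barQ x ∈ qInvZ := by
  obtain ⟨p, rfl⟩ := hx
  exact ⟨p, by rw [map_mul, barQ_aeval, barQ_q]⟩

theorem zero_mem_qInvZ : (0 : Qq) ∈ qInvZ := ⟨0, by simp⟩

theorem zero_mem_qZ : (0 : Qq) ∈ qZ := ⟨0, by simp⟩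

theorem add_mem_qInvZ {x y : Qq} (hx : x ∈ qInvZ) (hy : y ∈ qInvZ) : x + y ∈ qInvZ := by
  obtain ⟨p, rfl⟩ := hx
  obtain ⟨r, rfl⟩ := hy
  exact ⟨p + r, by rw [map_add, mul_add]⟩

theorem neg_mem_qInvZ {x : Qq} (hx : x ∈ qInvZ) : -x ∈ qInvZ := by
  obtain ⟨p, rfl⟩ := hx
  exact ⟨-p, by rw [map_neg, mul_neg]⟩

theorem neg_mem_qZ {x : Qq} (hx : x ∈ qZ) : -x ∈ qZ := by
  obtain ⟨p, rfl⟩ := hx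
  exact ⟨-p, by rw [map_neg, mul_neg]⟩

theorem add_mem_qZ {x y : Qq} (hx : x ∈ qZ) (hy : y ∈ qZ) : x + y ∈ qZ := by
  obtain ⟨p, rfl⟩ := hx
  obtain ⟨r, rfl⟩ := hy
  exact ⟨p + r, by rw [map_add, mul_add]⟩

theorem mul_mem_qInvZ {x y : Qq} (hx : x ∈ qInvZ) (hy : y ∈ qInvZ) : x * y ∈ qInvZ := by
  obtain ⟨p, rfl⟩ := hx
  obtain ⟨r, rfl⟩ := hy
  exact ⟨p * (Polynomial.X * r), by rw [map_mul, map_mul, Polynomial.aeval_X]; ring⟩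

theorem mul_mem_qZ {x y : Qq} (hx : x ∈ qZ) (hy : y ∈ qZ) : x * y ∈ qZ := by
  obtain ⟨p, rfl⟩ := hx
  obtain ⟨r, rfl⟩ := hy
  exact ⟨p * (Polynomial.X * r), by rw [map_mul, map_mul, Polynomial.aeval_X]; ring⟩

theorem aeval_q_injective : Function.Injective (Polynomial.aeval q : Polynomial ℤ →ₐ[ℤ] Qq) := by
  intro x y h
  have hc : ∀ p : Polynomial ℤ, Polynomial.aeval q p
      = algebraMap (Polynomial ℚ) Qq (p.map (Int.castRingHom ℚ)) := fun p => by
    induction p using Polynomial.induction_on' with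
    | add p r hp hr => rw [map_add, hp, hr, Polynomial.map_add, map_add]
    | monomial k a =>
      rw [← Polynomial.C_mul_X_pow_eq_monomial]
      simp [q]
  rw [hc, hc] at h
  exact Polynomial.map_injective _ (RingHom.injective_int _) (RatFunc.algebraMap_injective ℚ h)

/-- The components of a Laurent polynomial with positive, zero and negative exponents are
unique. -/
theorem eq_zero_of_add_add_barQ {x y : Qq} (hx : x ∈ qInvZ) (hy : y ∈ qInvZ) (k : ℤ)
    (h : x + k + barQ y = 0) : y = 0 := by
  obtain ⟨p, rfl⟩ := hx
  obtain ⟨r, rfl⟩ := hy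
  set d := p.natDegree with hd
  have hq := q_ne_zero
  have e1 : q ^ d * Polynomial.aeval q⁻¹ p = Polynomial.aeval q (Polynomial.reflect d p) := by
    let _ : Invertible q := invertibleOfNonzero hq
    have := Polynomial.eval₂_reflect_mul_pow (Int.castRingHom Qq) q d (Polynomial.reflect d p)
      (Polynomial.natDegree_reflect_le.trans (by rw [max_eq_left le_rfl]))
    rw [Polynomial.reflect_reflect, invOf_eq_inv, mul_comm] at this
    rw [aeval_eq_eval₂, aeval_eq_eval₂]
    exact this
  rw [map_mul, barQ_aeval, map_inv₀, barQ_q, inv_inv] at h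
  -- multiplication by `q ^ (d + 1)` turns the relation into one between polynomials in `q`
  have e2 : Polynomial.aeval q (Polynomial.reflect d p
      + Polynomial.C k * Polynomial.X ^ (d + 1) + Polynomial.X ^ (d + 2) * r) = 0 := by
    rw [map_add, map_add, ← e1, map_mul, map_mul, map_pow, map_pow, Polynomial.aeval_X,
      Polynomial.aeval_C]
    have : q ^ (d + 1) * (q⁻¹ * Polynomial.aeval q⁻¹ p + k + q * Polynomial.aeval q r) = 0 := by
      rw [h, mul_zero]
    rw [← this]
    have e3 : q ^ (d + 1) * (q⁻¹ * Polynomial.aeval q⁻¹ p) = q ^ d * Polynomial.aeval q⁻¹ p := by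
      rw [pow_succ, mul_assoc, mul_inv_cancel_left₀ hq]
    rw [mul_add, mul_add, e3, eq_intCast]
    ring
  have e4 := aeval_q_injective (e2.trans (map_zero _).symm)
  have hr : r = 0 := by
    ext j
    have := congrArg (fun f => Polynomial.coeff f (j + (d + 2))) e4
    simp only [Polynomial.coeff_add, Polynomial.coeff_X_pow_mul, Polynomial.coeff_C_mul,
      Polynomial.coeff_X_pow, Polynomial.coeff_zero] at this
    rw [if_neg (by omega), mul_zero, add_zero, Polynomial.coeff_eq_zero_of_natDegree_lt
      (lt_of_le_of_lt (Polynomial.natDegree_reflect_le.trans (by rw [max_eq_left le_rfl]))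
        (by omega : d < j + (d + 2))), zero_add] at this
    rw [this, Polynomial.coeff_zero]
  rw [hr, map_zero, mul_zero]

theorem eq_zero_of_barQ_eq {x : Qq} (hx : x ∈ qInvZ) (h : barQ x = x) : x = 0 := by
  have := eq_zero_of_add_add_barQ hx (neg_mem_qInvZ hx) 0 (by rw [map_neg, h]; simp)
  exact neg_eq_zero.1 this

/-- A Laurent polynomial is the sum of its parts with negative, zero and positive exponents. -/
theorem exists_decomposition {f : Qq} (hf : f ∈ laurentZ) :
    ∃ p ∈ qInvZ, ∃ k : ℤ, ∃ r ∈ qInvZ, f = p + k + barQ r := by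
  rw [laurentZ, Subring.mem_closure_iff] at hf
  induction hf using AddSubgroup.closure_induction with
  | mem x hx =>
    have : ∃ k : ℤ, x = q ^ k := by
      induction hx using Submonoid.closure_induction with
      | mem x hx =>
        rcases hx with rfl | rfl
        · exact ⟨1, (zpow_one _).symm⟩
        · exact ⟨-1, (zpow_neg_one _).symm⟩
      | one => exact ⟨0, (zpow_zero _).symm⟩
      | mul x y _ _ hx hy =>
        obtain ⟨a, rfl⟩ := hx
        obtain ⟨b, rfl⟩ := hy
        exact ⟨a + b, (zpow_add₀ q_ne_zero _ _).symm⟩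
    obtain ⟨k, rfl⟩ := this
    have hn : ∀ j : ℕ, q⁻¹ ^ (j + 1) ∈ qInvZ := fun j =>
      ⟨Polynomial.X ^ j, by rw [map_pow, Polynomial.aeval_X, pow_succ']⟩
    rcases lt_trichotomy k 0 with h | h | h
    · obtain ⟨j, rfl⟩ : ∃ j : ℕ, k = -((j : ℤ) + 1) := ⟨(-k - 1).toNat, by omega⟩
      refine ⟨_, hn j, 0, 0, zero_mem_qInvZ, ?_⟩
      rw [zpow_neg, map_zero, Int.cast_zero, add_zero, add_zero, inv_pow]
      rfl
    · subst h
      exact ⟨0, zero_mem_qInvZ, 1, 0, zero_mem_qInvZ, by simp⟩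
    · obtain ⟨j, rfl⟩ : ∃ j : ℕ, k = (j : ℤ) + 1 := ⟨(k - 1).toNat, by omega⟩
      refine ⟨0, zero_mem_qInvZ, 0, _, hn j, ?_⟩
      rw [map_pow, map_inv₀, barQ_q, inv_inv, Int.cast_zero, add_zero, zero_add]
      rfl
  | zero => exact ⟨0, zero_mem_qInvZ, 0, 0, zero_mem_qInvZ, by simp⟩
  | add x y _ _ hx hy =>
    obtain ⟨p, hp, k, r, hr, rfl⟩ := hx
    obtain ⟨p', hp', k', r', hr', rfl⟩ := hy
    refine ⟨_, add_mem_qInvZ hp hp', k + k', _, add_mem_qInvZ hr hr', ?_⟩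
    rw [map_add, Int.cast_add]; ring
  | neg x _ hx =>
    obtain ⟨p, hp, k, r, hr, rfl⟩ := hx
    refine ⟨_, neg_mem_qInvZ hp, -k, _, neg_mem_qInvZ hr, ?_⟩
    rw [map_neg, Int.cast_neg]; ring

/-- For an antisymmetric Laurent polynomial, the part with negative exponents solves
`p - p̄ = f`. -/
theorem exists_sub_barQ_qInvZ {f : Qq} (hf : f ∈ laurentZ) (h : barQ f = -f) :
    ∃ p ∈ qInvZ, p - barQ p = f := by
  obtain ⟨p, hp, k, r, hr, rfl⟩ := exists_decomposition hf
  rw [map_add, map_add, barQ_barQ, map_intCast] at h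
  have hpr := add_mem_qInvZ hp hr
  have h0 : p + r = 0 := eq_zero_of_add_add_barQ hpr hpr (2 * k) (by
    rw [map_add]; push_cast; linear_combination h)
  have hr' : r = -p := by linear_combination h0
  have hk : (k : Qq) = 0 := by
    rw [hr', map_neg] at h
    have : (2 : Qq) * k = 0 := by linear_combination h
    simpa using this
  exact ⟨p, hp, by rw [hr', hk, map_neg]; ring⟩

theorem exists_sub_barQ_qZ {f : Qq} (hf : f ∈ laurentZ) (h : barQ f = -f) :
    ∃ p ∈ qZ, p - barQ p = f := by
  obtain ⟨p, hp, h'⟩ := exists_sub_barQ_qInvZ hf h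
  refine ⟨_, neg_mem_qZ (barQ_mem_qZ hp), ?_⟩
  rw [map_neg, barQ_barQ, ← h']; ring

theorem barQ_mem {x : Qq} (hx : x ∈ laurentZ) : barQ x ∈ laurentZ := by
  obtain ⟨p, hp, k, r, hr, rfl⟩ := exists_decomposition hx
  rw [map_add, map_add, barQ_barQ, map_intCast]
  exact add_mem (add_mem (qZ_subset (barQ_mem_qZ hp)) (intCast_mem _ k)) (qInvZ_subset hr)

/-! ### Integrality of the bar involution -/

/-- `s` is an admissible rescaling for the lattice spanned by the `s^{-z(λ)} N_λ`. The conditions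
`up` and `down` concern the entries of the `R`-matrix between `v_0 ⊗ v_0` and `v_{-b} ⊗ v_b`, the
only ones which change the number of zero parts. -/
structure IsScale (s : Qq) : Prop where
  ne_zero : s ≠ 0
  barQ_eq : barQ s = s
  up : (q ^ (2 : ℤ) - q ^ (-2 : ℤ)) / two * s ^ (2 : ℤ) ∈ laurentZ
  down : (q ^ (2 : ℤ) - q ^ (-2 : ℤ)) * two * s ^ (-2 : ℤ) ∈ laurentZ

theorem sq_sub_div_two : (q ^ (2 : ℤ) - q ^ (-2 : ℤ)) / two = q - q⁻¹ := by
  rw [div_eq_iff two_ne_zero', two, zpow_neg]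
  have := q_ne_zero
  simp only [zpow_ofNat]
  field_simp
  ring

theorem two_mem : two ∈ laurentZ := add_mem q_mem q_inv_mem

theorem isScale_one : IsScale 1 where
  ne_zero := one_ne_zero
  barQ_eq := map_one _
  up := by
    rw [one_zpow, mul_one, sq_sub_div_two]
    exact sub_mem q_mem q_inv_mem
  down := by
    rw [one_zpow, mul_one]
    exact mul_mem (sub_mem (q_zpow_mem _) (q_zpow_mem _)) two_mem

theorem isScale_two : IsScale two where
  ne_zero := two_ne_zero'
  barQ_eq := barQ_two
  up := by
    rw [sq_sub_div_two]
    exact mul_mem (sub_mem q_mem q_inv_mem) (pow_mem two_mem 2)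
  down := by
    have : (q ^ (2 : ℤ) - q ^ (-2 : ℤ)) * two * two ^ (-2 : ℤ)
        = (q ^ (2 : ℤ) - q ^ (-2 : ℤ)) / two := by
      have := two_ne_zero'
      rw [zpow_neg two 2, show two ^ (2 : ℤ) = two * two from zpow_two _]
      field_simp
    rw [this, sq_sub_div_two]
    exact sub_mem q_mem q_inv_mem

/-- `1` if `a = 0`, and `0` otherwise. -/
def zer (a : ℤ) : ℤ := if a = 0 then 1 else 0

theorem zeros_snoc {n : ℕ} (m : Wt n) (p : ℤ) :
    (zeros (Fin.snoc (α := fun _ => ℤ) m p : Wt (n + 1)) : ℤ) = zeros m + zer p := by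
  unfold zeros zer
  rw [Finset.card_filter, Finset.card_filter, Fin.sum_univ_castSucc]
  simp only [Fin.snoc_castSucc, Fin.snoc_last]
  push_cast
  rfl

theorem neg_q_zpow_mem (k : ℤ) : (-q ^ (-2 : ℤ)) ^ k ∈ laurentZ := by
  have h : -q ^ (-2 : ℤ) ∈ laurentZ := neg_mem (q_zpow_mem _)
  have h' : (-q ^ (-2 : ℤ))⁻¹ ∈ laurentZ := by
    rw [inv_neg, ← zpow_neg]; exact neg_mem (q_zpow_mem _)
  rcases k with k | k
  · rw [Int.ofNat_eq_natCast, zpow_natCast]; exact pow_mem h k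
  · rw [zpow_negSucc, ← inv_pow]; exact pow_mem h' _

theorem kap_mem {b : ℤ} (hb : b ≠ 0) : kap b ∈ laurentZ := by
  unfold kap
  split_ifs
  · exact neg_q_zpow_mem b
  · exact mul_mem (q_zpow_mem _) (neg_q_zpow_mem b)

theorem inv_kap_mem {b : ℤ} (hb : b ≠ 0) : (kap b)⁻¹ ∈ laurentZ := by
  unfold kap
  split_ifs
  · rw [← zpow_neg]; exact neg_q_zpow_mem _
  · rw [mul_inv, ← zpow_neg, ← zpow_neg]; exact mul_mem (q_zpow_mem _) (neg_q_zpow_mem _)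

theorem locR_mem {s : Qq} (hs : IsScale s) (b c p p' : ℤ) :
    locR b c p p' * s ^ (zer p + zer b - zer p' - zer c) ∈ laurentZ := by
  unfold locR
  rw [sub_mul, add_mul]
  refine sub_mem (add_mem ?_ ?_) ?_
  · split_ifs with h
    · rw [h.1, h.2, show zer p' + zer c - zer p' - zer c = 0 by ring, zpow_zero, mul_one]
      exact q_zpow_mem _
    · rw [zero_mul]; exact zero_mem _
  · split_ifs with h
    · rw [h.2.1, h.2.2, show zer c + zer b - zer b - zer c = 0 by ring, zpow_zero, mul_one]
      exact sub_mem (q_zpow_mem _) (q_zpow_mem _)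
    · rw [zero_mul]; exact zero_mem _
  · split_ifs with h
    · rw [h.2.1, h.2.2]
      have e : ∀ x, zer (-x) = zer x := fun x => by simp [zer]
      rw [e, e]
      by_cases hb : b = 0
      · have hc : c ≠ 0 := by omega
        rw [hb, kap_zero, zer, zer, if_pos rfl, if_neg hc]
        have := mul_mem (mul_mem hs.up (q_zpow_mem (-2))) (inv_kap_mem hc)
        convert this using 1
        rw [show (1 + 1 - 0 - 0 : ℤ) = 2 by norm_num]
        ring
      · by_cases hc : c = 0
        · rw [hc, kap_zero, zer, zer, if_pos rfl, if_neg hb]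
          have := mul_mem (mul_mem hs.down (q_zpow_mem 2)) (kap_mem hb)
          convert this using 1
          rw [show (0 + 0 - 1 - 1 : ℤ) = -2 by norm_num, zpow_neg q 2]
          have := q_ne_zero
          have := two_ne_zero'
          field_simp
        · rw [zer, zer, if_neg hb, if_neg hc, show (0 + 0 - 0 - 0 : ℤ) = 0 by norm_num, zpow_zero,
            mul_one, div_eq_mul_inv]
          exact mul_mem (sub_mem (q_zpow_mem _) (q_zpow_mem _))
            (mul_mem (kap_mem hb) (inv_kap_mem hc))
    · rw [zero_mul]; exact zero_mem _

theorem rker_mem {s : Qq} (hs : IsScale s) : ∀ (n : ℕ) (m m' : Wt n) (b a : ℤ),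
    rker n b a m m' * s ^ ((zeros m : ℤ) + zer b - zeros m' - zer a) ∈ laurentZ := by
  refine wt_induction ?_ ?_
  · intro m m' b a
    have e : zeros m = zeros m' := by rw [Subsingleton.elim m m']
    rw [rker, e]
    split_ifs with h
    · rw [h, show (zeros m' : ℤ) + zer b - zeros m' - zer b = 0 by ring, zpow_zero, mul_one]
      exact one_mem _
    · rw [zero_mul]; exact zero_mem _
  · intro n ih m m' p p' b a
    rw [rker_snoc, zeros_snoc, zeros_snoc, Finset.sum_mul]
    refine sum_mem fun c _ => ?_
    have := mul_mem (locR_mem hs b c p p') (ih m m' c a)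
    convert this using 1
    rw [mul_mul_mul_comm, ← zpow_add₀ hs.ne_zero]
    congr 2
    ring

/-- The matrix of the bar involution with respect to the basis `s^{-z(λ)} N_λ` has entries in
`ℤ[q, q⁻¹]`. -/
theorem barKer_mem {s : Qq} (hs : IsScale s) : ∀ (n : ℕ) (m l : Wt n),
    barKer m l * s ^ ((zeros m : ℤ) - zeros l) ∈ laurentZ := by
  refine wt_induction ?_ ?_
  · intro m l
    rw [Subsingleton.elim m l, barKer_self, sub_self, zpow_zero, mul_one]
    exact one_mem _
  · intro n ih m l b a
    rw [barKer_snoc, zeros_snoc, zeros_snoc, finsum_mul]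
    refine finsum_induction (· ∈ laurentZ) (zero_mem _) (fun _ _ => add_mem) fun m' => ?_
    have := mul_mem (mul_mem (rker_mem hs n m m' b a) (q_zpow_mem (-dsum m' a))) (ih m' l)
    convert this using 1
    have e : s ^ ((zeros m : ℤ) + zer b - (zeros l + zer a))
        = s ^ ((zeros m : ℤ) + zer b - zeros m' - zer a) * s ^ ((zeros m' : ℤ) - zeros l) := by
      rw [← zpow_add₀ hs.ne_zero]; congr 1; ring
    rw [e, thetaKer]
    ring

/-! ### Bases fixed by the bar involution -/

theorem wellFounded_interval {n : ℕ} (L : Wt n) :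
    WellFounded fun l m : Wt n => Succeq L l ∧ Succeq l m ∧ l ≠ m := by
  refine Subrelation.wf (fun {l m} h => ?_)
    (measure fun m => (finite_interval L m).toFinset.card).wf
  refine Finset.card_lt_card ⟨fun k hk => ?_, fun h' => ?_⟩
  · rw [Set.Finite.mem_toFinset] at *
    exact ⟨hk.1, succeq_trans hk.2 h.2.1⟩
  · have hm : m ∈ (finite_interval L m).toFinset := by
      rw [Set.Finite.mem_toFinset]; exact ⟨succeq_trans h.1 h.2.1, succeq_refl m⟩
    have := h' hm
    rw [Set.Finite.mem_toFinset] at this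
    exact h.2.2 (succeq_antisymm h.2.1 this.2)

/-- Recursion along the Bruhat order below a weight `L`: the value at `m` may depend on the values
at the `l ≠ m` with `L ⪰ l ⪰ m`, of which there are finitely many. -/
theorem exists_recursive {n : ℕ} (L : Wt n) (Φ : Wt n → (Wt n → Qq) → Qq) :
    ∃ g : Wt n → Qq, ∀ m,
      g m = Φ m (fun l => open scoped Classical in
        if Succeq L l ∧ Succeq l m ∧ l ≠ m then g l else 0) := by
  classical
  have hR := wellFounded_interval L
  refine ⟨hR.fix fun m ih => Φ m fun l =>
    if h : Succeq L l ∧ Succeq l m ∧ l ≠ m then ih l h else 0, fun m => ?_⟩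
  rw [hR.fix_eq]
  congr 1

/-- Existence of bar-invariant lifts. The matrix of the bar involution with respect to the basis
`s^{-z(μ)} N_μ` is unitriangular with entries in `ℤ[q, q⁻¹]`, and the off-diagonal coefficients of
an invariant vector can be chosen recursively in any set `I` of Laurent polynomials which contains
a solution `p` of `p - p̄ = f` for each antisymmetric `f`. -/
theorem exists_bar_invariant {n : ℕ} {s : Qq} (hs : IsScale s) {I : Set Qq} (hI : I ⊆ laurentZ)
    (hI0 : (0 : Qq) ∈ I)
    (hsplit : ∀ f ∈ laurentZ, barQ f = -f → ∃ p ∈ I, p - barQ p = f) (L : Wt n) :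
    ∃ t : Wt n → Qq, t L = 1 ∧ (∀ m, t m ≠ 0 → Succeq L m) ∧ (∀ m, m ≠ L → t m ∈ I) ∧
      bar n (fun m => t m * s⁻¹ ^ zeros m) = fun m => t m * s⁻¹ ^ zeros m := by
  classical
  set r : Wt n → Wt n → Qq := fun m l => barKer m l * s ^ ((zeros m : ℤ) - zeros l) with hr
  have hrm : ∀ m l, r m l ∈ laurentZ := fun m l => barKer_mem hs n m l
  have hrs : ∀ m, r m m = 1 := fun m => by
    simp only [hr]; rw [barKer_self, sub_self, zpow_zero, mul_one]
  have hinv : ∀ m k (S : Finset (Wt n)), (∀ l, Succeq k l → Succeq l m → l ∈ S) →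
      ∑ l ∈ S, barQ (r m l) * r l k = if m = k then 1 else 0 := fun m k S hS => by
    have e : ∀ l ∈ S, barQ (r m l) * r l k
        = barQ (barKer m l * barQ (barKer l k)) * s ^ ((zeros m : ℤ) - zeros k) := fun l _ => by
      have : s ^ ((zeros m : ℤ) - zeros k)
          = s ^ ((zeros m : ℤ) - zeros l) * s ^ ((zeros l : ℤ) - zeros k) := by
        rw [← zpow_add₀ hs.ne_zero]; congr 1; ring
      simp only [hr]
      rw [this, map_mul, map_mul, barQ_barQ, map_zpow₀, hs.barQ_eq]
      ring
    rw [Finset.sum_congr rfl e, ← Finset.sum_mul, ← map_sum, barKer_mul_barKer m k S hS]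
    split_ifs with h
    · rw [h, sub_self, zpow_zero, map_one, mul_one]
    · rw [map_zero, zero_mul]
  -- the interval `{l | L ⪰ l ⪰ m}`
  let J : Wt n → Finset (Wt n) := fun m => (finite_interval L m).toFinset
  have hJ : ∀ m l, l ∈ J m ↔ Succeq L l ∧ Succeq l m := fun m l => Set.Finite.mem_toFinset _
  obtain ⟨t, ht⟩ := exists_recursive L fun m g =>
    if m = L then 1 else
      if h : Succeq L m ∧ ∃ p ∈ I, p - barQ p = ∑ l ∈ (J m).erase m, r m l * barQ (g l) then
        h.2.choose else 0
  have htL : t L = 1 := by rw [ht, if_pos rfl]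
  have hts : ∀ m, t m ≠ 0 → Succeq L m := fun m hm => by
    by_contra h
    have hmL : m ≠ L := fun e => h (by rw [e]; exact succeq_refl L)
    exact hm ((ht m).trans ((if_neg hmL).trans (dif_neg fun h' => h h'.1)))
  have htI : ∀ m, m ≠ L → t m ∈ I := fun m hm => by
    rw [ht, if_neg hm]
    split_ifs with h
    · exact h.2.choose_spec.1
    · exact hI0
  have htA : ∀ m, t m ∈ laurentZ := fun m => by
    by_cases h : m = L
    · rw [h, htL]; exact one_mem _
    · exact hI (htI m h)
  have herase : ∀ m, ∑ l ∈ (J m).erase m, r m l * barQ (open scoped Classical in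
        if Succeq L l ∧ Succeq l m ∧ l ≠ m then t l else 0)
      = ∑ l ∈ (J m).erase m, r m l * barQ (t l) := fun m =>
    Finset.sum_congr rfl fun l hl => by
      rw [Finset.mem_erase, hJ] at hl
      rw [if_pos ⟨hl.2.1, hl.2.2, hl.1⟩]
  -- the choice of `t m` solves its equation as soon as that equation is solvable
  have hstep : ∀ m, Succeq L m → m ≠ L →
      (∃ p ∈ I, p - barQ p = ∑ l ∈ (J m).erase m, r m l * barQ (t l)) →
      t m - barQ (t m) = ∑ l ∈ (J m).erase m, r m l * barQ (t l) := fun m hm hmL h => by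
    have h' := h
    rw [← herase m] at h'
    have e := ht m
    rw [if_neg hmL, dif_pos ⟨hm, h'⟩] at e
    rw [e, h'.choose_spec.2, herase]
  have main : ∀ m, Succeq L m → t m = ∑ l ∈ J m, r m l * barQ (t l) := by
    intro m
    induction m using (wellFounded_interval L).induction with
    | _ m ih =>
    intro hm
    have hmJ : m ∈ J m := (hJ _ _).2 ⟨hm, succeq_refl m⟩
    rw [← Finset.add_sum_erase _ _ hmJ, hrs, one_mul]
    by_cases hmL : m = L
    · have : (J m).erase m = ∅ := by
        rw [Finset.eq_empty_iff_forall_notMem]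
        intro l hl
        rw [Finset.mem_erase, hJ, hmL] at hl
        exact hl.1 (succeq_antisymm hl.2.2 hl.2.1)
      rw [this, Finset.sum_empty, add_zero, hmL, htL, map_one]
    rw [← sub_eq_iff_eq_add']
    refine hstep m hm hmL (hsplit _ (sum_mem fun l _ => mul_mem (hrm m l) (barQ_mem (htA l))) ?_)
    -- the right-hand side is antisymmetric, by induction and since the involution squares to 1
    have hl : ∀ l ∈ (J m).erase m, t l = ∑ k ∈ J m, r l k * barQ (t k) := fun l hl => by
      rw [Finset.mem_erase, hJ] at hl
      have hsub : J l ⊆ J m := fun k hk => by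
        rw [hJ] at *; exact ⟨hk.1, succeq_trans hk.2 hl.2.2⟩
      rw [ih l ⟨hl.2.1, hl.2.2, hl.1⟩ hl.2.1]
      refine Finset.sum_subset hsub fun k hk hk' => ?_
      rw [hJ] at hk hk'
      by_contra h0
      exact hk' ⟨hk.1, succeq_of_barKer_ne_zero
        (left_ne_zero_of_mul (left_ne_zero_of_mul h0))⟩
    rw [map_sum]
    have e1 : ∀ l ∈ (J m).erase m, barQ (r m l * barQ (t l))
        = ∑ k ∈ J m, barQ (r m l) * r l k * barQ (t k) := fun l h => by
      rw [map_mul, barQ_barQ]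
      conv_lhs => rw [hl l h]
      rw [Finset.mul_sum]
      exact Finset.sum_congr rfl fun k _ => (mul_assoc _ _ _).symm
    rw [Finset.sum_congr rfl e1, Finset.sum_comm]
    have e2 : ∀ k ∈ J m, ∑ l ∈ (J m).erase m, barQ (r m l) * r l k * barQ (t k)
        = (if m = k then 1 else 0) * barQ (t k) - r m k * barQ (t k) := fun k hk => by
      rw [← Finset.sum_mul, ← hinv m k (J m) fun l h1 h2 =>
        (hJ _ _).2 ⟨succeq_trans ((hJ _ _).1 hk).1 h1, h2⟩, ← Finset.add_sum_erase _ _ hmJ, hrs,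
        map_one]
      ring
    rw [Finset.sum_congr rfl e2, ← Finset.add_sum_erase _ _ hmJ, if_pos rfl, hrs, sub_self,
      zero_add, ← Finset.sum_neg_distrib]
    refine Finset.sum_congr rfl fun k hk => ?_
    rw [if_neg (Finset.ne_of_mem_erase hk).symm]
    ring
  refine ⟨t, htL, hts, htI, funext fun m => ?_⟩
  have hx : (fun m => t m * s⁻¹ ^ zeros m) ∈ THat n :=
    ⟨{L}, fun m hm => ⟨L, Finset.mem_singleton_self L, hts m (left_ne_zero_of_mul hm)⟩⟩
  rw [bar_apply hx m (J m) fun l h1 h2 => (hJ _ _).2 ⟨hts l (left_ne_zero_of_mul h2), h1⟩]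
  by_cases hm : Succeq L m
  · rw [main m hm, Finset.sum_mul]
    refine Finset.sum_congr rfl fun l _ => ?_
    simp only [hr]
    rw [map_mul, map_pow, map_inv₀, hs.barQ_eq, zpow_sub₀ hs.ne_zero, zpow_natCast, zpow_natCast,
      inv_pow, inv_pow]
    have := hs.ne_zero
    field_simp
  · have h1 : J m = ∅ := by
      rw [Finset.eq_empty_iff_forall_notMem]
      intro l hl
      rw [hJ] at hl
      exact hm (succeq_trans hl.1 hl.2)
    have h2 : t m = 0 := by
      by_contra h; exact hm (hts m h)
    rw [h1, h2, Finset.sum_empty, zero_mul]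

/-- The dual canonical basis exists. -/
theorem isDualCanonical_dualCan {n : ℕ} (l : Wt n) : IsDualCanonical l (dualCan l) := by
  have h : ∃ x, IsDualCanonical l x := by
    obtain ⟨t, h1, h2, h3, h4⟩ := exists_bar_invariant isScale_two qInvZ_subset zero_mem_qInvZ
      (fun f hf => exists_sub_barQ_qInvZ hf) l
    exact ⟨_, h4, by rw [h1, one_mul], fun m hm => h2 m (left_ne_zero_of_mul hm),
      fun m hm => ⟨_, h3 m hm, rfl⟩⟩
  rw [dualCan, dif_pos h]
  exact h.choose_spec

/-- The bar-invariant elements of `N_λ + ∑_{μ ≺ λ} qℤ[q] N_μ` exist. -/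
theorem exists_canonical {n : ℕ} (l : Wt n) : ∃ t : FT n, bar n t = t ∧ t l = 1 ∧
    (∀ m, t m ≠ 0 → Succeq l m) ∧ ∀ m, m ≠ l → t m ∈ qZ := by
  obtain ⟨t, h1, h2, h3, h4⟩ := exists_bar_invariant isScale_one qZ_subset zero_mem_qZ
      (fun f hf => exists_sub_barQ_qZ hf) l
  simp only [inv_one, one_pow, mul_one] at h4
  exact ⟨t, h4, h1, h2, h3⟩

/-! ### The first tensor factor -/

/-- The coefficient of `v_a` in the first tensor factor. -/
def lslice {n : ℕ} (c : FT (n + 1)) (a : ℤ) : FT n := fun l => c (Fin.cons (α := fun _ => ℤ) a l)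

/-- The formal sum `v_a ⊗ x`. -/
def lsingle {n : ℕ} (a : ℤ) (x : FT n) : FT (n + 1) := fun m =>
  if m 0 = a then x (Fin.tail m) else 0

theorem lslice_apply {n : ℕ} (c : FT (n + 1)) (a : ℤ) (l : Wt n) :
    lslice c a l = c (Fin.cons (α := fun _ => ℤ) a l) := rfl

theorem ext_lslice {n : ℕ} {c d : FT (n + 1)} (h : ∀ a, lslice c a = lslice d a) : c = d := by
  funext m
  rw [← Fin.cons_self_tail m]
  exact congrFun (h _) _

theorem lslice_lsingle {n : ℕ} (a b : ℤ) (x : FT n) :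
    lslice (lsingle a x) b = if b = a then x else 0 := by
  funext m
  rw [lslice_apply, lsingle, Fin.cons_zero, Fin.tail_cons]
  split_ifs <;> rfl

theorem lslice_opE {n : ℕ} (i : ℕ) (c : FT (n + 1)) (b : ℤ) :
    lslice (opE (n + 1) i c) b
      = eCoef i (b + 1) • opK n i (-1) (lslice c (b + 1)) + opE n i (lslice c b) :=
  funext fun m => by
    rw [lslice_apply, opE_cons, Pi.add_apply, Pi.smul_apply, opK_apply, smul_eq_mul, neg_one_mul,
      mul_comm (q ^ _), mul_assoc]
    rfl

theorem lslice_opF {n : ℕ} (i : ℕ) (c : FT (n + 1)) (b : ℤ) :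
    lslice (opF (n + 1) i c) b
      = fCoef i (b - 1) • lslice c (b - 1) + q ^ pair i b • opF n i (lslice c b) :=
  funext fun m => opF_cons i c m b

theorem lslice_opK {n : ℕ} (i : ℕ) (ε : ℤ) (c : FT (n + 1)) (b : ℤ) :
    lslice (opK (n + 1) i ε c) b = q ^ (ε * pair i b) • opK n i ε (lslice c b) :=
  funext fun m => by
    rw [lslice_apply, opK_apply, Pi.smul_apply, opK_apply, psum_cons, mul_add,
      zpow_add₀ q_ne_zero, mul_assoc]
    rfl

theorem slice_opK {n : ℕ} (i : ℕ) (ε : ℤ) (c : FT (n + 1)) (b : ℤ) :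
    slice (opK (n + 1) i ε c) b = q ^ (ε * pair i b) • opK n i ε (slice c b) :=
  funext fun m => by
    rw [slice_apply, opK_apply, Pi.smul_apply, opK_apply, psum_snoc, mul_add,
      zpow_add₀ q_ne_zero, smul_eq_mul, mul_left_comm, mul_comm (q ^ (ε * pair i b)), mul_assoc,
      ← slice_apply c]
    ring

theorem opF_lsingle {n : ℕ} (i : ℕ) (a : ℤ) (x : FT n) :
    opF (n + 1) i (lsingle a x)
      = fCoef i a • lsingle (a + 1) x + q ^ pair i a • lsingle a (opF n i x) := by
  refine ext_lslice fun b => ?_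
  rw [lslice_opF]
  change _ = fCoef i a • lslice (lsingle (a + 1) x) b
    + q ^ pair i a • lslice (lsingle a (opF n i x)) b
  rw [lslice_lsingle, lslice_lsingle, lslice_lsingle, lslice_lsingle]
  congr 1
  · by_cases h : b - 1 = a
    · rw [if_pos h, if_pos (by omega), h]
    · rw [if_neg h, if_neg (by omega), smul_zero, smul_zero]
  · split_ifs with h
    · rw [h]
    · rw [map_zero, smul_zero, smul_zero]

theorem Below.of_cons {n N : ℕ} {l : Wt n} {a : ℤ}
    (h : Below N (Fin.cons (α := fun _ => ℤ) a l : Wt (n + 1))) :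
    Below (max N a.natAbs) l := fun r hr => by
  have h' := h r (by omega)
  have e : lev r a = 0 := lev_eq_zero (by omega)
  refine ⟨?_, fun t => ?_⟩
  · have := h'.1
    rwa [tl_cons_zero, e, zero_add] at this
  · have := h'.2 (t + 1)
    rwa [tl_cons_succ] at this

theorem Below.le_of_cons {n N : ℕ} {l : Wt n} {a : ℤ}
    (h : Below N (Fin.cons (α := fun _ => ℤ) a l : Wt (n + 1))) : a ≤ N := by
  have h1 := (h N le_rfl).1
  have h2 := (h N le_rfl).2 1
  rw [tl_cons_zero] at h1
  rw [tl_cons_succ] at h2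
  have : lev N a ≤ 0 := by omega
  unfold lev at this; split_ifs at this <;> omega

theorem lslice_mem_THat {n : ℕ} {c : FT (n + 1)} (hc : c ∈ THat (n + 1)) (a : ℤ) :
    lslice c a ∈ THat n := by
  rw [mem_THat_iff] at *
  obtain ⟨N, hN⟩ := hc
  exact ⟨_, fun m hm => (hN _ hm).of_cons⟩

theorem exists_lslice_eq_zero {n : ℕ} {c : FT (n + 1)} (hc : c ∈ THat (n + 1)) :
    ∃ A : ℤ, ∀ a, A < a → lslice c a = 0 := by
  rw [mem_THat_iff] at hc
  obtain ⟨N, hN⟩ := hc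
  refine ⟨N, fun a ha => funext fun m => ?_⟩
  by_contra h
  have := (hN _ h).le_of_cons
  omega

theorem lsingle_mem_THat {n : ℕ} (a : ℤ) {x : FT n} (hx : x ∈ THat n) :
    lsingle a x ∈ THat (n + 1) := by
  rw [mem_THat_iff] at *
  obtain ⟨N, hN⟩ := hx
  refine ⟨max N a.natAbs, fun m hm r hr => ?_⟩
  rw [← Fin.cons_self_tail m] at hm ⊢
  rw [lsingle] at hm
  split_ifs at hm with h
  · rw [Fin.cons_zero] at h
    rw [Fin.tail_cons] at hm
    have e : lev r a = 0 := lev_eq_zero (by omega)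
    have := hN _ hm r (by omega)
    refine ⟨by rw [tl_cons_zero, h, e, zero_add]; exact this.1, fun t => ?_⟩
    rcases t with _ | t
    · rw [tl_cons_zero, h, e, zero_add]; exact this.2 0
    · rw [tl_cons_succ]; exact this.2 t
  · exact absurd rfl hm

theorem first_le_of_succeq {n : ℕ} {l m : Wt n} {a b : ℤ}
    (h : Succeq (Fin.cons (α := fun _ => ℤ) a l : Wt (n + 1)) (Fin.cons (α := fun _ => ℤ) b m)) :
    b ≤ a := by
  rw [succeq_iff] at h
  refine le_of_lev_le fun r => ?_
  have h1 := h.1 r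
  have h2 := h.2 1 r
  rw [tl_cons_zero, tl_cons_zero] at h1
  rw [tl_cons_succ, tl_cons_succ] at h2
  omega

/-- The part of the `R`-matrix which fixes the vector in the first factor. -/
theorem locR_apply_self (b c p : ℤ) : locR b c p p = if b = c then q ^ dform p c else 0 := by
  unfold locR
  rw [if_neg (show ¬(c < b ∧ p = c ∧ p = b) by omega),
    if_neg (show ¬(c < b ∧ p = -b ∧ p = -c) by omega)]
  simp

/-- The part of the fused `R`-matrix which fixes the vector `v_p` in the first of the tensor
factors: that factor contributes the scalar `q^{(δ_p, δ_a)}`. -/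
theorem rker_cons (p : ℤ) : ∀ (n : ℕ) (m m' : Wt n) (b a : ℤ),
    rker (n + 1) b a (Fin.cons (α := fun _ => ℤ) p m) (Fin.cons (α := fun _ => ℤ) p m')
      = q ^ dform p a * rker n b a m m' := by
  refine wt_induction ?_ ?_
  · intro m m' b a
    have e : ∀ m : Wt 0, (Fin.cons (α := fun _ => ℤ) p m : Wt 1)
        = Fin.snoc (α := fun _ => ℤ) m p := fun m => funext fun j => by
      have hj : j = 0 := Fin.ext (by omega)
      rw [hj]; rfl
    rw [e, e, rker_snoc]
    simp only [rker, locR_apply_self, mul_ite, mul_one, mul_zero]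
    by_cases h : a = b
    · subst h; simp
    · rw [if_neg h]
      refine Finset.sum_eq_zero fun c _ => ?_
      split_ifs <;> first | rfl | omega
  · intro n ih m m' x x' b a
    have e : ∀ (m : Wt n) x,
        (Fin.cons (α := fun _ => ℤ) p (Fin.snoc (α := fun _ => ℤ) m x : Wt (n + 1)) : Wt (n + 2))
          = Fin.snoc (α := fun _ => ℤ) (Fin.cons (α := fun _ => ℤ) p m : Wt (n + 1)) x :=
      fun m x => Fin.cons_snoc_eq_snoc_cons p m x
    rw [e, e, rker_snoc, rker_snoc, Finset.mul_sum]
    exact Finset.sum_congr rfl fun c _ => by rw [ih]; ring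

theorem thetaKer_cons (p : ℤ) (n : ℕ) (m m' : Wt n) (b a : ℤ) :
    thetaKer (n + 1) b a (Fin.cons (α := fun _ => ℤ) p m) (Fin.cons (α := fun _ => ℤ) p m')
      = thetaKer n b a m m' := by
  have e : dsum (Fin.cons (α := fun _ => ℤ) p m' : Wt (n + 1)) a = dform p a + dsum m' a := by
    simp [dsum, Fin.sum_univ_succ]
  rw [thetaKer, thetaKer, rker_cons, e, neg_add, zpow_add₀ q_ne_zero, mul_assoc,
    mul_left_comm (rker n b a m m'), ← mul_assoc, ← zpow_add₀ q_ne_zero, add_neg_cancel, zpow_zero,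
    one_mul]

theorem slice_lsingle {n : ℕ} (a p : ℤ) (x : FT (n + 1)) :
    slice (lsingle a x) p = lsingle a (slice x p) := by
  refine ext_lslice fun b => funext fun m => ?_
  rw [lslice_apply, slice_apply, ← Fin.cons_snoc_eq_snoc_cons]
  have h1 := congrFun (lslice_lsingle a b x) (Fin.snoc (α := fun _ => ℤ) m p)
  have h2 := congrFun (lslice_lsingle a b (slice x p)) m
  rw [lslice_apply] at h1
  rw [h2]
  refine h1.trans ?_
  split_ifs <;> rfl

theorem lslice_bar_lsingle_of_lt {n : ℕ} {a b : ℤ} (hab : a < b) {x : FT n} (hx : x ∈ THat n) :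
    lslice (bar (n + 1) (lsingle a x)) b = 0 := by
  funext m
  by_contra h
  obtain ⟨l, hl, h'⟩ := exists_of_bar_ne_zero (lsingle_mem_THat a hx) h
  rw [← Fin.cons_self_tail l] at hl
  have := first_le_of_succeq hl
  unfold lsingle at h'
  split_ifs at h' with h0
  · omega
  · exact h' rfl

/-- The leading term of the bar involution with respect to the first tensor factor. -/
theorem lslice_bar_lsingle_self : ∀ {n : ℕ} (a : ℤ) {x : FT n}, x ∈ THat n →
    lslice (bar (n + 1) (lsingle a x)) a = bar n x
  | 0, a, x, hx => by
    funext m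
    have e : (Fin.cons (α := fun _ => ℤ) a m : Wt 1) = Fin.snoc (α := fun _ => ℤ) m a :=
      funext fun j => by
        have hj : j = 0 := Fin.ext (by omega)
        rw [hj]; rfl
    have e' : lsingle a x = single a x := by
      funext l
      have h0 : Fin.last 0 = 0 := rfl
      unfold lsingle single
      rw [h0, Subsingleton.elim (Fin.tail l) (Fin.init l)]
    rw [lslice_apply, e, e']
    change slice (bar 1 (single a x)) a m = _
    rw [slice_bar_of_le fun a' h => by rw [slice_single, if_neg (by omega)], slice_single,
      if_pos rfl]
  | n + 1, a, x, hx => by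
    refine ext_slice fun p => funext fun m => ?_
    rw [slice_apply, lslice_apply, Fin.cons_snoc_eq_snoc_cons, bar_snoc, slice_apply, bar_snoc]
    refine finsum_congr fun p' => ?_
    have hxp := slice_mem_THat hx p'
    rw [slice_lsingle, thetaOp_apply, thetaOp_apply]
    set f : Wt (n + 1) → Qq := fun m' => thetaKer (n + 1) p p' (Fin.cons (α := fun _ => ℤ) a m) m'
      * bar (n + 1) (lsingle a (slice x p')) m' with hf
    have hinj : Function.Injective
        (fun m' : Wt n => (Fin.cons (α := fun _ => ℤ) a m' : Wt (n + 1))) :=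
      Fin.cons_right_injective (α := fun _ => ℤ) a
    -- both the bar involution and `Θ` can only lower the first part, so it stays equal to `a`
    have hsupp : Function.support f
        ⊆ Set.range (fun m' : Wt n => (Fin.cons (α := fun _ => ℤ) a m' : Wt (n + 1))) := by
      intro m' hm'
      have h1 : thetaKer (n + 1) p p' (Fin.cons (α := fun _ => ℤ) a m) m' ≠ 0 :=
        left_ne_zero_of_mul hm'
      have h2 : bar (n + 1) (lsingle a (slice x p')) m' ≠ 0 := right_ne_zero_of_mul hm'
      rw [← Fin.cons_self_tail m'] at h1 h2 ⊢
      generalize m' 0 = b at h1 h2 ⊢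
      have hba : b ≤ a := by
        by_contra h
        exact h2 (congrFun (lslice_bar_lsingle_of_lt (not_le.1 h) hxp) _)
      have h3 := rker_succeq _ _ _ (left_ne_zero_of_mul h1)
      rw [← Fin.cons_snoc_eq_snoc_cons, ← Fin.cons_snoc_eq_snoc_cons] at h3
      have hab := first_le_of_succeq h3
      exact ⟨Fin.tail m', by rw [le_antisymm hab hba]⟩
    change ∑ᶠ m', f m' = _
    rw [← Set.indicator_eq_self.2 hsupp, ← finsum_mem_def, finsum_mem_range hinj]
    refine finsum_congr fun m' => ?_
    simp only [hf]
    rw [thetaKer_cons]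
    congr 1
    exact congrFun (lslice_bar_lsingle_self a hxp) m'

/-- A subspace which is stable under the `F_i` and the bar involution is preserved by the
coefficients of `bar (v_a ⊗ y)` in the first tensor factor. These coefficients obey a recursion
provided by the `F_i`; it has the form of `chain_induction` after the reflection `a ↦ -a`. -/
theorem lslice_bar_lsingle_mem {n : ℕ} (W : Submodule Qq (FT n)) (hW : W ≤ THat n)
    (hF : ∀ i, ∀ x ∈ W, opF n i x ∈ W) (hbar : ∀ x ∈ W, bar n x ∈ W) (b a : ℤ) :
    ∀ y ∈ W, lslice (bar (n + 1) (lsingle a y)) b ∈ W := by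
  have main := chain_induction
    (P := fun b a => ∀ y ∈ W, lslice (bar (n + 1) (lsingle (-a) y)) (-b) ∈ W) ?_ ?_ ?_ (-b) (-a)
  · rwa [neg_neg, neg_neg] at main
  · intro a y hy
    rw [lslice_bar_lsingle_self _ (hW hy)]
    exact hbar y hy
  · intro b a hba y hy
    rw [lslice_bar_lsingle_of_lt (by omega) (hW hy)]
    exact W.zero_mem
  · intro i b a hi _ h1 h2 y hy
    have hs := lsingle_mem_THat (-a) (hW hy)
    have hs' := lsingle_mem_THat (-a + 1) (hW hy)
    have hsF := lsingle_mem_THat (-a) (hW (hF i y hy))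
    have e := congrArg (fun c => lslice c (-b)) (bar_opF i hs)
    simp only [lslice_opF] at e
    rw [opF_lsingle, bar_add (Submodule.smul_mem _ _ hs') (Submodule.smul_mem _ _ hsF),
      bar_smul _ hs', bar_smul _ hsF, barQ_fCoef, fCoef_eq, fCoef_eq,
      show -(-b - 1) = b + 1 by ring, neg_neg] at e
    have e' : eCoef i a • lslice (bar (n + 1) (lsingle (-a + 1) y)) (-b)
        + barQ (q ^ pair i (-a)) • lslice (bar (n + 1) (lsingle (-a) (opF n i y))) (-b)
        = eCoef i (b + 1) • lslice (bar (n + 1) (lsingle (-a) y)) (-b - 1)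
        + q ^ pair i (-b) • opF n i (lslice (bar (n + 1) (lsingle (-a) y)) (-b)) := e
    have m1 : eCoef i a • lslice (bar (n + 1) (lsingle (-a + 1) y)) (-b) ∈ W := by
      by_cases h0 : eCoef i a = 0
      · rw [h0, zero_smul]; exact W.zero_mem
      · have := h2 h0 y hy
        rw [show -(a - 1) = -a + 1 by ring] at this
        exact W.smul_mem _ this
    rw [show -(b + 1) = -b - 1 by ring]
    refine (W.smul_mem_iff hi).1 ?_
    rw [eq_sub_of_add_eq e'.symm]
    exact W.sub_mem (W.add_mem m1 (W.smul_mem _ (h1 _ (hF i y hy))))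
      (W.smul_mem _ (hF i _ (h1 y hy)))

theorem lslice_bar_mem {n : ℕ} (W : Submodule Qq (FT n)) (hW : W ≤ THat n)
    (hF : ∀ i, ∀ x ∈ W, opF n i x ∈ W) (hbar : ∀ x ∈ W, bar n x ∈ W) {x : FT (n + 1)}
    (hx : x ∈ THat (n + 1)) (h : ∀ a, lslice x a ∈ W) (b : ℤ) :
    lslice (bar (n + 1) x) b ∈ W := by
  obtain ⟨A, hA⟩ := exists_lslice_eq_zero hx
  have hmem : ∀ a ∈ Finset.Icc b A, lsingle a (lslice x a) ∈ THat (n + 1) := fun a _ =>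
    lsingle_mem_THat a (lslice_mem_THat hx a)
  have e : lslice (bar (n + 1) x) b
      = ∑ a ∈ Finset.Icc b A, lslice (bar (n + 1) (lsingle a (lslice x a))) b := by
    funext m
    rw [lslice_apply, bar_congr hx (Submodule.sum_mem _ hmem), bar_sum _ _ hmem, Finset.sum_apply,
      Finset.sum_apply]
    · rfl
    · intro l hl
      rw [← Fin.cons_self_tail l] at hl ⊢
      have hle := first_le_of_succeq hl
      generalize l 0 = p at hl hle ⊢
      generalize Fin.tail l = l at hl ⊢
      rw [Finset.sum_apply]
      have e : ∀ a ∈ Finset.Icc b A, lsingle a (lslice x a) (Fin.cons (α := fun _ => ℤ) p l)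
          = if p = a then lslice x p l else 0 := fun a _ => by
        have := congrFun (lslice_lsingle a p (lslice x a)) l
        rw [lslice_apply] at this
        rw [this]
        split_ifs with h
        · rw [h]
        · rfl
      rw [Finset.sum_congr rfl e, Finset.sum_ite_eq]
      change lslice x p l = _
      split_ifs with h
      · rfl
      · rw [Finset.mem_Icc] at h
        rw [hA p (by omega)]; rfl
  rw [e]
  exact W.sum_mem fun a _ => lslice_bar_lsingle_mem W hW hF hbar b a _ (h a)

theorem slice_bar_mem {n : ℕ} (W : Submodule Qq (FT n))
    (hE : ∀ i, ∀ x ∈ W, opE n i x ∈ W) (hbar : ∀ x ∈ W, bar n x ∈ W) {x : FT (n + 1)}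
    (hx : x ∈ THat (n + 1)) (h : ∀ a, slice x a ∈ W) (b : ℤ) :
    slice (bar (n + 1) x) b ∈ W := by
  obtain ⟨A, hA⟩ := exists_slice_eq_zero hx
  rw [slice_bar x b (Finset.Icc A b) fun a h h' => by
    rw [Finset.mem_Icc] at h'; exact hA a (by omega)]
  exact W.sum_mem fun a _ => thetaOp_mem W hE b a _ (hbar _ (h a))

/-! ### The quadratic relations -/

/-- Linear conditions on the coordinates `f a b` at `v_a ⊗ v_b` of a vector of the completed tensor
square, which characterise the (completed) span of the quadratic relations of the `q`-exterior
algebra. The fields `zero` and `step` are obtained by eliminating the coefficients of the relations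
of weight zero (see `relCoef`), and `bounded` says that these are finite in number. -/
structure IsRel (f : ℤ → ℤ → Qq) : Prop where
  swap : ∀ a b, b < a → a + b ≠ 0 → f b a = q ^ 2 * f a b
  zero : (1 - q ^ 4) * f 0 0 = q * (f 1 (-1) - f (-1) 1)
  step : ∀ a, 1 ≤ a →
    q ^ 2 * (f (a + 1) (-a - 1) - f (-a - 1) (a + 1)) = f (-a) a - q ^ 4 * f a (-a)
  bounded : ∃ A : ℤ, ∀ a, A ≤ a → f a (-a) = 0 ∧ f (-a) a = 0

theorem isRel_zero : IsRel 0 where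
  swap a b _ _ := by simp
  zero := by simp
  step a _ := by simp
  bounded := ⟨0, fun a _ => ⟨rfl, rfl⟩⟩

theorem IsRel.add {f g : ℤ → ℤ → Qq} (hf : IsRel f) (hg : IsRel g) : IsRel (f + g) where
  swap a b h h' := by
    simp only [Pi.add_apply]; rw [hf.swap a b h h', hg.swap a b h h']; ring
  zero := by
    simp only [Pi.add_apply]; linear_combination hf.zero + hg.zero
  step a ha := by
    simp only [Pi.add_apply]; linear_combination hf.step a ha + hg.step a ha
  bounded := by
    obtain ⟨A, hA⟩ := hf.bounded
    obtain ⟨B, hB⟩ := hg.bounded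
    refine ⟨max A B, fun a ha => ?_⟩
    simp only [Pi.add_apply]
    rw [(hA a (le_of_max_le_left ha)).1, (hA a (le_of_max_le_left ha)).2,
      (hB a (le_of_max_le_right ha)).1, (hB a (le_of_max_le_right ha)).2]
    simp

theorem IsRel.smul {f : ℤ → ℤ → Qq} (r : Qq) (hf : IsRel f) : IsRel (r • f) where
  swap a b h h' := by
    simp only [Pi.smul_apply, smul_eq_mul]; rw [hf.swap a b h h']; ring
  zero := by
    simp only [Pi.smul_apply, smul_eq_mul]; linear_combination r * hf.zero
  step a ha := by
    simp only [Pi.smul_apply, smul_eq_mul]; linear_combination r * hf.step a ha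
  bounded := by
    obtain ⟨A, hA⟩ := hf.bounded
    refine ⟨A, fun a ha => ?_⟩
    simp only [Pi.smul_apply]
    rw [(hA a ha).1, (hA a ha).2]
    simp

/-- The conditions are stable under the reflection `v_a ⊗ v_b ↦ v_{-b} ⊗ v_{-a}`, which
interchanges `E_i` and `F_i`. -/
theorem IsRel.reflect {f : ℤ → ℤ → Qq} (hf : IsRel f) : IsRel fun a b => f (-b) (-a) where
  swap a b h h' := hf.swap (-b) (-a) (by omega) (by omega)
  zero := by simpa using hf.zero
  step a ha := by
    have := hf.step a ha
    simp only [neg_neg]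
    rw [show -(-a - 1) = a + 1 by ring, show -(a + 1) = -a - 1 by ring]
    exact this
  bounded := by
    obtain ⟨A, hA⟩ := hf.bounded
    exact ⟨A, fun a ha => by rw [neg_neg]; exact hA a ha⟩

/-- The action of `E_i` on the tensor square. -/
def actE (i : ℕ) (f : ℤ → ℤ → Qq) (a b : ℤ) : Qq :=
  q ^ (-pair i b) * eCoef i (a + 1) * f (a + 1) b + eCoef i (b + 1) * f a (b + 1)

theorem pair_of_ne {i : ℕ} {a : ℤ} (h1 : a ≠ i) (h2 : a ≠ -i) (h3 : a ≠ i + 1)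
    (h4 : a ≠ -i - 1) : pair i a = 0 := by
  rw [pair_eq, if_neg (fun h => h1 h.1), if_neg (fun h => h2 h.1), if_neg h3, if_neg h4]; rfl

theorem pair_top (i : ℕ) : pair i (i + 1) = -2 := by
  rw [pair_eq]; split_ifs <;> omega

theorem pair_self {i : ℕ} (hi : i ≠ 0) : pair i i = 2 := by
  rw [pair_eq]; split_ifs <;> omega

theorem pair_neg_self {i : ℕ} (hi : i ≠ 0) : pair i (-i) = -2 := by
  rw [pair_neg, pair_self hi]

theorem pair_bot (i : ℕ) : pair i (-i - 1) = 2 := by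
  rw [show (-i - 1 : ℤ) = -(i + 1) by ring, pair_neg, pair_top]; rfl

theorem pair_zero (i : ℕ) : pair i 0 = 0 := by
  have := pair_neg i 0
  rw [neg_zero] at this
  omega

theorem eCoef_zero_zero : eCoef 0 0 = two := by simp [eCoef]

theorem q_mul_two : q * two = q ^ 2 + 1 := by
  have := q_ne_zero
  rw [two]; field_simp

theorem IsRel.swap_actE {f : ℤ → ℤ → Qq} (hf : IsRel f) (i : ℕ) {a b : ℤ} (hab : b < a)
    (h : a + b ≠ 0) : actE i f b a = q ^ 2 * actE i f a b := by
  have hq := q_ne_zero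
  unfold actE
  by_cases h0 : a + b + 1 = 0
  · obtain rfl : b = -a - 1 := by omega
    rw [show -a - 1 + 1 = -a by ring]
    by_cases hai : a = i
    · subst hai
      by_cases hi : i = 0
      · subst hi
        have e1 := eCoef_top 0
        have e2 := pair_bot 0
        simp only [Nat.cast_zero, zero_add, neg_zero, zero_sub] at *
        rw [e1, e2, pair_zero, eCoef_zero_zero, neg_zero, zpow_zero, zpow_neg,
          zpow_ofNat]
        have := hf.zero
        have h2 := q_mul_two
        field_simp
        apply mul_left_cancel₀ hq
        linear_combination this + (1 - q ^ 2) * f 0 0 * h2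
      · have := hf.step i (by omega)
        rw [pair_self hi, pair_bot, eCoef_top, eCoef_bot hi, zpow_neg, zpow_ofNat]
        field_simp
        linear_combination -this
    · rw [eCoef_of_ne (i := i) (a := a + 1) (by omega) (by omega),
        eCoef_of_ne (i := i) (a := -a) (by omega) (by omega)]
      ring
  · have h1 : q ^ (-pair i a) * eCoef i (b + 1) * f (b + 1) a
        = q ^ 2 * (eCoef i (b + 1) * f a (b + 1)) := by
      by_cases hb : eCoef i (b + 1) = 0
      · rw [hb]; ring
      have hb' := eCoef_ne_zero hb
      by_cases hba : b + 1 = a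
      · have : pair i a = -2 := by
          rcases hb' with hb' | hb'
          · rw [← hba, hb', pair_top]
          · rw [← hba, hb', pair_neg_self (by omega)]
        rw [this, hba, neg_neg, zpow_ofNat]; ring
      · rw [hf.swap a (b + 1) (by omega) (by omega),
          pair_of_ne (by omega) (by omega) (by omega) (by omega), neg_zero, zpow_zero]
        ring
    have h2 : eCoef i (a + 1) * f b (a + 1)
        = q ^ 2 * (q ^ (-pair i b) * eCoef i (a + 1) * f (a + 1) b) := by
      by_cases ha : eCoef i (a + 1) = 0
      · rw [ha]; ring
      have ha' := eCoef_ne_zero ha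
      rw [hf.swap (a + 1) b (by omega) (by omega),
        pair_of_ne (by omega) (by omega) (by omega) (by omega), neg_zero, zpow_zero]
      ring
    rw [h1, h2]; ring

/-- The conditions defining the relations are stable under `E_i`. -/
theorem IsRel.actE {f : ℤ → ℤ → Qq} (hf : IsRel f) (i : ℕ) : IsRel (actE i f) where
  swap a b hab h := hf.swap_actE i hab h
  zero := by
    unfold QueerFock.actE
    simp only [zero_add, neg_add_cancel, pair_zero, neg_zero, zpow_zero, one_mul, pair_neg,
      neg_neg, show (1 : ℤ) + 1 = 2 by norm_num]
    have h1 := hf.swap 1 0 (by norm_num) (by norm_num)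
    have h2 := hf.swap 2 (-1) (by norm_num) (by norm_num)
    rcases Nat.lt_trichotomy i 1 with hi | hi | hi
    · obtain rfl : i = 0 := by omega
      have e1 : eCoef 0 1 = 1 := by simpa using eCoef_top 0
      have e2 : eCoef 0 2 = 0 := eCoef_of_ne (by norm_num) (by norm_num)
      have e3 : pair 0 1 = -2 := by simpa using pair_top 0
      rw [e1, e2, e3, eCoef_zero_zero, h1, neg_neg, zpow_ofNat]
      linear_combination (f 1 0 * (q ^ 4 - 1)) * q_mul_two
    · subst hi
      have e1 : eCoef 1 1 = 0 := eCoef_of_ne (by norm_num) (by norm_num)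
      have e0 : eCoef 1 0 = 0 := eCoef_of_ne (by norm_num) (by norm_num)
      have e3 : pair 1 1 = 2 := by simpa using pair_self one_ne_zero
      rw [e1, e0, e3, h2, zpow_ofNat]
      ring
    · rw [eCoef_of_ne (i := i) (a := 0) (by omega) (by omega),
        eCoef_of_ne (i := i) (a := 1) (by omega) (by omega),
        eCoef_of_ne (i := i) (a := 2) (by omega) (by omega)]
      ring
  step a ha := by
    unfold QueerFock.actE
    rw [show -a - 1 + 1 = -a by ring, show a + 1 + 1 = a + 2 by ring,
      show -a - 1 = -(a + 1) by ring]
    simp only [pair_neg, neg_neg]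
    have h1 := hf.swap (a + 1) (-a) (by omega) (by omega)
    have h2 := hf.swap (a + 2) (-(a + 1)) (by omega) (by omega)
    have h3 := hf.swap a (-a + 1) (by omega) (by omega)
    rw [h1, h2, h3]
    have hq := q_ne_zero
    by_cases h : a = i
    · subst h
      have hi : i ≠ 0 := by omega
      rw [eCoef_of_ne (i := i) (a := i + 2) (by omega) (by omega),
        eCoef_of_ne (i := i) (a := -i + 1) (by omega) (by omega), eCoef_top, eCoef_bot hi,
        pair_top, pair_self hi, neg_neg, zpow_ofNat]
      ring
    · rw [eCoef_of_ne (i := i) (a := a + 1) (by omega) (by omega),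
        eCoef_of_ne (i := i) (a := -a) (by omega) (by omega)]
      by_cases h' : a + 1 = i
      · rw [eCoef_of_ne (i := i) (a := -a + 1) (by omega) (by omega), h', pair_self (by omega),
          zpow_ofNat]
        ring
      · rw [eCoef_of_ne (i := i) (a := a + 2) (by omega) (by omega)]
        by_cases h'' : a = i + 1
        · subst h''
          rw [pair_top, neg_neg, zpow_ofNat]
          ring
        · rw [eCoef_of_ne (i := i) (a := -a + 1) (by omega) (by omega)]
          ring
  bounded := by
    obtain ⟨A, hA⟩ := hf.bounded
    refine ⟨i + 2, fun a ha => ?_⟩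
    unfold QueerFock.actE
    rw [eCoef_of_ne (i := i) (a := a + 1) (by omega) (by omega),
        eCoef_of_ne (i := i) (a := -a + 1) (by omega) (by omega)]
    simp

/-- The action of `F_i` on the tensor square. -/
def actF (i : ℕ) (f : ℤ → ℤ → Qq) (a b : ℤ) : Qq :=
  fCoef i (a - 1) * f (a - 1) b + q ^ pair i a * fCoef i (b - 1) * f a (b - 1)

theorem IsRel.actF {f : ℤ → ℤ → Qq} (hf : IsRel f) (i : ℕ) : IsRel (actF i f) := by
  have := ((hf.reflect).actE i).reflect
  convert this using 3 with a b
  unfold QueerFock.actF QueerFock.actE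
  beta_reduce
  rw [fCoef_eq, fCoef_eq, pair_neg, neg_neg, show -(a - 1) = -a + 1 by ring,
    show -(b - 1) = -b + 1 by ring, show -(-b + 1) = b - 1 by ring,
    show -(-a + 1) = a - 1 by ring, neg_neg, neg_neg, add_comm]

theorem IsRel.actK {f : ℤ → ℤ → Qq} (hf : IsRel f) (i : ℕ) (ε : ℤ) :
    IsRel fun a b => q ^ (ε * (pair i a + pair i b)) * f a b where
  swap a b h h' := by
    rw [hf.swap a b h h', add_comm (pair i b)]; ring
  zero := by
    simp only [pair_neg, pair_zero, add_neg_cancel, neg_add_cancel, add_zero, mul_zero, zpow_zero,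
      one_mul]
    exact hf.zero
  step a ha := by
    rw [show -a - 1 = -(a + 1) by ring]
    simp only [pair_neg, add_neg_cancel, neg_add_cancel, mul_zero, zpow_zero, one_mul]
    have := hf.step a ha
    rwa [show -a - 1 = -(a + 1) by ring] at this
  bounded := by
    obtain ⟨A, hA⟩ := hf.bounded
    exact ⟨A, fun a ha => by rw [(hA a ha).1, (hA a ha).2, mul_zero, mul_zero]; exact ⟨rfl, rfl⟩⟩

theorem one_sub_q_pow_ne_zero : (1 : Qq) - q ^ 4 ≠ 0 := by
  intro h
  have e := eq_zero_of_add_add_barQ (x := 0) (y := -(q⁻¹ ^ 4)) zero_mem_qInvZ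
    ⟨-Polynomial.X ^ 3, by rw [map_neg, map_pow, Polynomial.aeval_X]; ring⟩ 1 (by
      rw [map_neg, map_pow, map_inv₀, barQ_q, inv_inv]; push_cast; linear_combination h)
  exact pow_ne_zero 4 (inv_ne_zero q_ne_zero) (neg_eq_zero.1 e)

/-- The component of weight zero of a relation vanishes if it is symmetric, that is, if the
coefficients of the relations of weight zero vanish. -/
theorem IsRel.eq_zero {f : ℤ → ℤ → Qq} (hf : IsRel f) (h : ∀ a, 1 ≤ a → f a (-a) = f (-a) a)
    (a : ℤ) : f a (-a) = 0 := by
  have h4 := one_sub_q_pow_ne_zero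
  have h1 : ∀ a, 1 ≤ a → f a (-a) = 0 ∧ f (-a) a = 0 := fun a ha => by
    have e := hf.step a ha
    have e' := h (a + 1) (by omega)
    rw [show -(a + 1) = -a - 1 by ring] at e'
    rw [e', sub_self, mul_zero, ← h a ha] at e
    have : (1 - q ^ 4) * f a (-a) = 0 := by linear_combination -e
    have := (mul_eq_zero.1 this).resolve_left h4
    exact ⟨this, by rw [← h a ha, this]⟩
  rcases lt_trichotomy a 0 with ha | ha | ha
  · have := (h1 (-a) (by omega)).2
    rwa [neg_neg] at this
  · subst ha
    have e := hf.zero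
    rw [(h1 1 le_rfl).1, (h1 1 le_rfl).2, sub_self, mul_zero] at e
    rw [neg_zero]
    exact (mul_eq_zero.1 e).resolve_left h4
  · exact (h1 a ha).1

/-! ### Relations in two adjacent tensor factors -/

/-- The weight `m` with its entries in positions `k`, `k + 1` replaced by `a`, `b`. -/
def place {n : ℕ} (m : Wt n) (k : ℕ) (a b : ℤ) : Wt n := fun j =>
  if (j : ℕ) = k then a else if (j : ℕ) = k + 1 then b else m j

theorem place_snoc {n k : ℕ} (hk : k + 1 < n) (m : Wt n) (p a b : ℤ) :
    place (Fin.snoc (α := fun _ => ℤ) m p : Wt (n + 1)) k a b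
      = Fin.snoc (α := fun _ => ℤ) (place m k a b) p := by
  funext j
  refine Fin.lastCases ?_ (fun j => ?_) j
  · rw [Fin.snoc_last, place, Fin.val_last, if_neg (by omega), if_neg (by omega), Fin.snoc_last]
  · rw [Fin.snoc_castSucc, place, place, Fin.snoc_castSucc]; rfl

theorem place_cons {n k : ℕ} (m : Wt n) (p a b : ℤ) :
    place (Fin.cons (α := fun _ => ℤ) p m : Wt (n + 1)) (k + 1) a b
      = Fin.cons (α := fun _ => ℤ) p (place m k a b) := by
  funext j
  refine Fin.cases ?_ (fun j => ?_) j
  · rw [Fin.cons_zero, place, Fin.val_zero, if_neg (by omega), if_neg (by omega), Fin.cons_zero]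
  · rw [Fin.cons_succ, place, place, Fin.cons_succ, Fin.val_succ]
    simp only [Nat.add_right_cancel_iff]

theorem place_two (m : Wt 2) (a b : ℤ) : place m 0 a b = ![a, b] := by
  funext j
  fin_cases j <;> rfl

/-- The vectors of `T̂ⁿ` which satisfy the linear conditions of `IsRel` in the tensor positions
`k`, `k + 1`. -/
def relSpace (n k : ℕ) : Submodule Qq (FT n) where
  carrier := {x | x ∈ THat n ∧ ∀ m, IsRel fun a b => x (place m k a b)}
  zero_mem' := ⟨(THat n).zero_mem, fun _ => isRel_zero⟩
  add_mem' hx hy := ⟨(THat n).add_mem hx.1 hy.1, fun m => (hx.2 m).add (hy.2 m)⟩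
  smul_mem' r _ hx := ⟨(THat n).smul_mem r hx.1, fun m => (hx.2 m).smul r⟩

theorem relSpace_le (n k : ℕ) : relSpace n k ≤ THat n := fun _ hx => hx.1

theorem mem_relSpace_slice {n k : ℕ} (hk : k + 1 < n) {x : FT (n + 1)} :
    x ∈ relSpace (n + 1) k ↔ x ∈ THat (n + 1) ∧ ∀ p, slice x p ∈ relSpace n k := by
  constructor
  · rintro ⟨h1, h2⟩
    refine ⟨h1, fun p => ⟨slice_mem_THat h1 p, fun m => ?_⟩⟩
    have := h2 (Fin.snoc (α := fun _ => ℤ) m p)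
    simp only [place_snoc hk] at this
    exact this
  · rintro ⟨h1, h2⟩
    refine ⟨h1, fun m => ?_⟩
    rw [← Fin.snoc_init_self m]
    simp only [place_snoc hk]
    exact (h2 (m (Fin.last n))).2 (Fin.init m)

theorem mem_relSpace_lslice {n k : ℕ} {x : FT (n + 1)} :
    x ∈ relSpace (n + 1) (k + 1) ↔ x ∈ THat (n + 1) ∧ ∀ p, lslice x p ∈ relSpace n k := by
  constructor
  · rintro ⟨h1, h2⟩
    refine ⟨h1, fun p => ⟨lslice_mem_THat h1 p, fun m => ?_⟩⟩
    have := h2 (Fin.cons (α := fun _ => ℤ) p m)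
    simp only [place_cons] at this
    exact this
  · rintro ⟨h1, h2⟩
    refine ⟨h1, fun m => ?_⟩
    rw [← Fin.cons_self_tail m]
    simp only [place_cons]
    exact (h2 (m 0)).2 (Fin.tail m)

theorem two_eta (m : Wt 2) : m = ![m 0, m 1] := by
  funext j
  fin_cases j <;> rfl

theorem mem_relSpace_two {x : FT 2} :
    x ∈ relSpace 2 0 ↔ x ∈ THat 2 ∧ IsRel fun a b => x ![a, b] := by
  refine and_congr_right fun _ => ⟨fun h => ?_, fun h m => ?_⟩
  · have := h ![0, 0]
    simpa only [place_two] using this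
  · simpa only [place_two] using h

theorem opE_two (i : ℕ) (x : FT 2) (a b : ℤ) :
    opE 2 i x ![a, b] = actE i (fun a b => x ![a, b]) a b := by
  have h1 : Function.update ![a, b] 0 (a + 1) = ![a + 1, b] := by
    funext j; fin_cases j <;> rfl
  have h2 : Function.update ![a, b] 1 (b + 1) = ![a, b + 1] := by
    funext j; fin_cases j <;> rfl
  simp [opE, actE, Finset.sum_filter, h1, h2]

theorem opF_two (i : ℕ) (x : FT 2) (a b : ℤ) :
    opF 2 i x ![a, b] = actF i (fun a b => x ![a, b]) a b := by
  have h1 : Function.update ![a, b] 0 (a - 1) = ![a - 1, b] := by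
    funext j; fin_cases j <;> rfl
  have h2 : Function.update ![a, b] 1 (b - 1) = ![a, b - 1] := by
    funext j; fin_cases j <;> rfl
  simp [opF, actF, Finset.sum_filter, h1, h2]

/-! ### The bar involution of the tensor square -/

theorem barKer_one (m l : Wt 1) : barKer m l = if m = l then 1 else 0 := by
  rw [← Fin.snoc_init_self m, ← Fin.snoc_init_self l, Subsingleton.elim (Fin.init m) (Fin.init l),
    barKer_snoc, finsum_eq_single _ (Fin.init l) fun x hx => absurd (Subsingleton.elim _ _) hx,
    barKer_self, mul_one, thetaKer]
  simp [rker, dsum, Fin.snoc_inj, eq_comm]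

theorem barKer_two (a b c d : ℤ) :
    barKer ![c, d] ![a, b] = locR d b c a * q ^ (-dform a b) := by
  have e : ∀ x y : ℤ, (![x, y] : Wt 2) = Fin.snoc (α := fun _ => ℤ) (![x] : Wt 1) y := fun x y => by
    funext j; fin_cases j <;> rfl
  have e1 : ∀ x : ℤ, (![x] : Wt 1) = Fin.snoc (α := fun _ => ℤ) (![] : Wt 0) x := fun x => by
    funext j; fin_cases j; rfl
  rw [e, e, barKer_snoc,
    finsum_eq_single _ ![a] fun x hx => by rw [barKer_one, if_neg hx, mul_zero],
    barKer_self, mul_one, thetaKer]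
  have h2 : dsum (![a] : Wt 1) b = dform a b := by simp [dsum]
  rw [h2, e1, e1, rker_snoc]
  congr 1
  simp only [rker, mul_ite, mul_one, mul_zero, Finset.sum_ite_eq]
  split_ifs with h
  · rfl
  · by_contra h0
    exact h (Finset.mem_Icc.2 ⟨le_rfl, le_of_locR_ne_zero (Ne.symm h0)⟩)

theorem bar_apply_of_ker {n : ℕ} {c : FT n} (hc : c ∈ THat n) (m : Wt n) (T : Finset (Wt n))
    (hT : ∀ l, barKer m l ≠ 0 → c l ≠ 0 → l ∈ T) :
    bar n c m = ∑ l ∈ T, barKer m l * barQ (c l) := by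
  classical
  have h : ∀ l, Succeq l m → c l ≠ 0 → l ∈ (finite_above hc m).toFinset ∪ T := fun l h1 h2 =>
    Finset.mem_union_left _ (by rw [Set.Finite.mem_toFinset]; exact ⟨h1, h2⟩)
  rw [bar_apply hc m _ h]
  symm
  refine Finset.sum_subset Finset.subset_union_right fun l _ hl => ?_
  by_contra h0
  exact hl (hT l (left_ne_zero_of_mul h0) fun h' => right_ne_zero_of_mul h0 (by rw [h', map_zero]))

theorem dform_of_ne {a b : ℤ} (h1 : a ≠ b) (h2 : a + b ≠ 0) : dform a b = 0 := by
  unfold dform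
  rw [if_neg (fun h => h1 h.1), if_neg (fun h => h2 (by omega)), sub_zero]

theorem locR_of_add_ne {b c p p' : ℤ} (h : p + b ≠ 0) :
    locR b c p p' = (if b = c ∧ p = p' then q ^ dform p' c else 0)
      + (if c < b ∧ p = c ∧ p' = b then q ^ (2 : ℤ) - q ^ (-2 : ℤ) else 0) := by
  unfold locR
  rw [if_neg (show ¬(c < b ∧ p = -b ∧ p' = -c) by omega), sub_zero]

theorem add_eq_of_locR_ne_zero {b c p p' : ℤ} (h : locR b c p p' ≠ 0) (h' : p + b = 0) :
    p' + c = 0 := by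
  by_contra h0
  apply h
  unfold locR
  rw [if_neg (show ¬(b = c ∧ p = p') by omega), if_neg (show ¬(c < b ∧ p = c ∧ p' = b) by omega),
    if_neg (show ¬(c < b ∧ p = -b ∧ p' = -c) by omega)]
  simp

/-- The relation `v_a ⊗ v_b + q² v_b ⊗ v_a`. -/
def skew (a b : ℤ) : FT 2 := bas ![a, b] + q ^ 2 • bas ![b, a]

theorem vec_inj {a b c d : ℤ} : (![a, b] : Wt 2) = ![c, d] ↔ a = c ∧ b = d := by
  constructor
  · intro h; exact ⟨congrFun h 0, congrFun h 1⟩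
  · rintro ⟨rfl, rfl⟩; rfl

theorem skew_apply (a b c d : ℤ) :
    skew a b ![c, d]
      = (if c = a ∧ d = b then 1 else 0) + q ^ 2 * if c = b ∧ d = a then 1 else 0 := by
  simp only [skew, bas, Pi.add_apply, Pi.smul_apply, Pi.single_apply, vec_inj, smul_eq_mul]

theorem skew_mem_THat (a b : ℤ) : skew a b ∈ THat 2 :=
  (THat 2).add_mem (bas_mem_THat _) ((THat 2).smul_mem _ (bas_mem_THat _))

theorem bar_skew {a b : ℤ} (hab : b < a) (h : a + b ≠ 0) : bar 2 (skew a b) = skew a b := by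
  funext m
  rw [two_eta m]
  generalize m 0 = c
  generalize m 1 = d
  rw [skew_apply, skew, bar_add (bas_mem_THat _) ((THat 2).smul_mem _ (bas_mem_THat _)),
    bar_smul _ (bas_mem_THat _), Pi.add_apply, Pi.smul_apply, smul_eq_mul]
  change barKer _ _ + _ * barKer _ _ = _
  rw [barKer_two, barKer_two, dform_of_ne (by omega) h, dform_of_ne (by omega) (by omega), neg_zero,
    zpow_zero, mul_one, mul_one, map_pow, barQ_q]
  by_cases h0 : c + d = 0
  · have e1 : locR d b c a = 0 := by
      by_contra h1; exact h (add_eq_of_locR_ne_zero h1 h0)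
    have e2 : locR d a c b = 0 := by
      by_contra h1; have := add_eq_of_locR_ne_zero h1 h0; omega
    rw [e1, e2, if_neg (by omega), if_neg (by omega)]
    simp
  · have hq := q_ne_zero
    rw [locR_of_add_ne h0, locR_of_add_ne h0, dform_of_ne (by omega) h,
      dform_of_ne (by omega) (by omega), if_neg (show ¬(a < d ∧ c = a ∧ b = d) by omega)]
    by_cases h1 : c = a ∧ d = b
    · rw [if_pos h1, if_pos h1.symm, if_neg (show ¬(b < d ∧ c = b ∧ a = d) by omega),
        if_neg (show ¬(d = a ∧ c = b) by omega), if_neg (show ¬(c = b ∧ d = a) by omega)]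
      simp
    · rw [if_neg h1, if_neg (fun h' => h1 h'.symm)]
      by_cases h2 : c = b ∧ d = a
      · rw [if_pos h2, if_pos h2.symm, if_pos (show b < d ∧ c = b ∧ a = d by omega), zpow_neg,
          zpow_zero, zpow_ofNat]
        ring
      · rw [if_neg h2, if_neg (show ¬(d = a ∧ c = b) by omega),
          if_neg (show ¬(b < d ∧ c = b ∧ a = d) by omega)]
        simp

theorem isRel_skew {a b : ℤ} (hab : b < a) (h : a + b ≠ 0) :
    IsRel fun c d => skew a b ![c, d] := by
  have h0 : ∀ c, skew a b ![c, -c] = 0 := fun c => by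
    rw [skew_apply, if_neg (by omega), if_neg (by omega)]; simp
  have h0' : ∀ c, skew a b ![-c, c] = 0 := fun c => by
    rw [skew_apply, if_neg (by omega), if_neg (by omega)]; simp
  constructor
  · intro c d hcd hcd0
    rw [skew_apply, skew_apply, if_neg (show ¬(d = a ∧ c = b) by omega),
      if_neg (show ¬(c = b ∧ d = a) by omega), zero_add, mul_zero, add_zero]
    simp only [and_comm]
  · have e1 := h0 0
    rw [neg_zero] at e1
    rw [e1, h0 1, h0' 1]; ring
  · intro c _
    have e1 := h0 (c + 1)
    have e2 := h0' (c + 1)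
    rw [show -(c + 1) = -c - 1 by ring] at e1 e2
    rw [e1, e2, h0, h0']; ring
  · exact ⟨0, fun c _ => ⟨h0 c, h0' c⟩⟩

theorem eCoef_neg_ne_zero (i : ℕ) : eCoef i (-i) ≠ 0 := by
  by_cases h : i = 0
  · subst h; simpa [eCoef] using two_ne_zero'
  · rw [eCoef_bot h]; exact one_ne_zero

/-- The relation `E_i (v_{i+1} ⊗ v_{-i} + q² v_{-i} ⊗ v_{i+1})` of weight zero is a multiple of the
basic relation with leading term `v_{i+1} ⊗ v_{-i-1}`: only one of the differences vanishing in
`IsRel.eq_zero` is non-zero. -/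
theorem opE_skew_sub (i : ℕ) {a : ℤ} (ha : 1 ≤ a) :
    opE 2 i (skew (i + 1) (-i)) ![a, -a] - opE 2 i (skew (i + 1) (-i)) ![-a, a]
      = if a = i + 1 then (1 - q ^ 4) * eCoef i (-i) else 0 := by
  rw [opE_two, opE_two, actE, actE, skew_apply, skew_apply, skew_apply, skew_apply]
  by_cases h : a = i + 1
  · subst h
    rw [if_pos rfl, if_neg (by omega), if_neg (by omega), if_pos (by omega), if_neg (by omega),
      if_neg (by omega), if_pos (by omega), if_neg (by omega), if_neg (by omega), pair_top,
      show -((i : ℤ) + 1) + 1 = -i by ring, neg_neg, zpow_ofNat]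
    ring
  · rw [if_neg h, if_neg (show ¬(a = (i : ℤ) + 1 ∧ -a + 1 = -i) by omega),
      if_neg (show ¬(a = -(i : ℤ) ∧ -a + 1 = i + 1) by omega),
      if_neg (show ¬(-a + 1 = (i : ℤ) + 1 ∧ a = -i) by omega),
      if_neg (show ¬(-a + 1 = -(i : ℤ) ∧ a = i + 1) by omega),
      if_neg (show ¬(a + 1 = -(i : ℤ) ∧ -a = i + 1) by omega),
      if_neg (show ¬(-a = (i : ℤ) + 1 ∧ a + 1 = -i) by omega)]
    by_cases h' : a = i
    · subst h'
      have hi : i ≠ 0 := by omega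
      rw [if_pos ⟨rfl, rfl⟩, if_pos ⟨rfl, rfl⟩, pair_neg_self hi, neg_neg, zpow_ofNat]
      ring
    · rw [if_neg (show ¬(a + 1 = (i : ℤ) + 1 ∧ -a = -i) by omega),
        if_neg (show ¬(-a = -(i : ℤ) ∧ a + 1 = i + 1) by omega)]
      ring

theorem relSpace_opE_two (i : ℕ) {x : FT 2} (hx : x ∈ relSpace 2 0) :
    opE 2 i x ∈ relSpace 2 0 := by
  rw [mem_relSpace_two] at *
  refine ⟨opE_mem_THat i hx.1, ?_⟩
  simp only [opE_two]
  exact hx.2.actE i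

theorem relSpace_opF_two (i : ℕ) {x : FT 2} (hx : x ∈ relSpace 2 0) :
    opF 2 i x ∈ relSpace 2 0 := by
  rw [mem_relSpace_two] at *
  refine ⟨opF_mem_THat i hx.1, ?_⟩
  simp only [opF_two]
  exact hx.2.actF i

theorem relSpace_opK_two (i : ℕ) (ε : ℤ) {x : FT 2} (hx : x ∈ relSpace 2 0) :
    opK 2 i ε x ∈ relSpace 2 0 := by
  rw [mem_relSpace_two] at *
  refine ⟨opK_mem_THat i ε hx.1, ?_⟩
  have e : ∀ a b : ℤ, psum i (![a, b] : Wt 2) = pair i a + pair i b := fun a b => by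
    simp [psum]
  simp only [opK_apply, e]
  exact hx.2.actK i ε

theorem opE_skew_mem (i : ℕ) : opE 2 i (skew (i + 1) (-i)) ∈ relSpace 2 0 :=
  relSpace_opE_two i
    (mem_relSpace_two.2 ⟨skew_mem_THat _ _, isRel_skew (by omega) (by omega)⟩)

theorem bar_opE_skew (i : ℕ) :
    bar 2 (opE 2 i (skew (i + 1) (-i))) = opE 2 i (skew (i + 1) (-i)) := by
  rw [bar_opE i (skew_mem_THat _ _), bar_skew (by omega) (by omega)]

/-- In the tensor square the bar involution preserves the relations. In weights `≠ 0` this is a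
computation with two basis vectors; a relation of weight `0` is a finite combination of the
bar-invariant relations `E_i (v_{i+1} ⊗ v_{-i} + q² v_{-i} ⊗ v_{i+1})`. -/
theorem relSpace_bar_two {x : FT 2} (hx : x ∈ relSpace 2 0) : bar 2 x ∈ relSpace 2 0 := by
  have hx' := hx
  rw [mem_relSpace_two] at hx
  obtain ⟨hT, hR⟩ := hx
  obtain ⟨A, hA⟩ := hR.bounded
  -- the relation `y` of weight zero which has the same coefficients as the part of weight zero of
  -- `x`
  set z : ℕ → Qq := fun i => (x ![(i : ℤ) + 1, -((i : ℤ) + 1)] - x ![-((i : ℤ) + 1), (i : ℤ) + 1])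
    / ((1 - q ^ 4) * eCoef i (-i)) with hz
  set y : FT 2 := ∑ i ∈ Finset.range A.toNat, z i • opE 2 i (skew (i + 1) (-i)) with hy
  have hmem : ∀ i ∈ Finset.range A.toNat, z i • opE 2 i (skew (i + 1) (-i)) ∈ relSpace 2 0 :=
    fun i _ => Submodule.smul_mem _ _ (opE_skew_mem i)
  have hyR : y ∈ relSpace 2 0 := Submodule.sum_mem _ hmem
  have hbarR : bar 2 y ∈ relSpace 2 0 := by
    rw [hy, bar_sum _ _ fun i hi => (hmem i hi).1]
    refine Submodule.sum_mem _ fun i hi => ?_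
    rw [bar_smul _ (opE_skew_mem i).1, bar_opE_skew]
    exact Submodule.smul_mem _ _ (opE_skew_mem i)
  have hdiff : ∀ a, 1 ≤ a → y ![a, -a] - y ![-a, a] = x ![a, -a] - x ![-a, a] := by
    intro a ha
    obtain ⟨j, rfl⟩ : ∃ j : ℕ, a = j + 1 := ⟨(a - 1).toNat, by omega⟩
    simp only [hy, Finset.sum_apply, Pi.smul_apply, smul_eq_mul, ← Finset.sum_sub_distrib,
      ← mul_sub, opE_skew_sub _ ha]
    have e : ∀ i ∈ Finset.range A.toNat, z i * (if (j : ℤ) + 1 = i + 1 then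
        (1 - q ^ 4) * eCoef i (-i) else 0) = if j = i then
        x ![(j : ℤ) + 1, -((j : ℤ) + 1)] - x ![-((j : ℤ) + 1), (j : ℤ) + 1] else 0 := by
      intro i _
      by_cases h : j = i
      · subst h
        rw [if_pos rfl, if_pos rfl]
        exact div_mul_cancel₀ _ (mul_ne_zero one_sub_q_pow_ne_zero (eCoef_neg_ne_zero j))
      · rw [if_neg h, if_neg (by omega), mul_zero]
    rw [Finset.sum_congr rfl e, Finset.sum_ite_eq]
    split_ifs with h
    · rfl
    · rw [Finset.mem_range] at h
      have := hA ((j : ℤ) + 1) (by omega)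
      rw [this.1, this.2, sub_self]
  have hD := (mem_relSpace_two.1 (Submodule.sub_mem _ hx' hyR)).2
  have hD0 : ∀ a, (x - y) ![a, -a] = 0 := hD.eq_zero fun a ha => by
    have := hdiff a ha
    simp only [Pi.sub_apply]
    linear_combination -this
  have hz0 : ∀ a, bar 2 x ![a, -a] = bar 2 y ![a, -a] := fun a => by
    have e := congrFun (bar_sub hT hyR.1) ![a, -a]
    rw [bar_apply_of_ker (Submodule.sub_mem _ hT hyR.1) _ ∅, Finset.sum_empty, Pi.sub_apply] at e
    · exact (sub_eq_zero.1 e.symm)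
    · intro l h1 h2
      rw [two_eta l] at h1 h2
      rw [barKer_two] at h1
      have h3 := add_eq_of_locR_ne_zero (left_ne_zero_of_mul h1) (add_neg_cancel a)
      rw [show l 1 = -l 0 by omega] at h2
      exact absurd (hD0 _) h2
  have hz0' : ∀ a, bar 2 x ![-a, a] = bar 2 y ![-a, a] := fun a => by
    have := hz0 (-a)
    rwa [neg_neg] at this
  have hB := (mem_relSpace_two.1 hbarR).2
  refine mem_relSpace_two.2 ⟨bar_mem_THat hT, ?_, ?_, ?_, ?_⟩
  · intro a b hab h0
    have hne : (![b, a] : Wt 2) ≠ ![a, b] := fun h => by rw [vec_inj] at h; omega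
    have key : ∀ l, barKer ![a, b] l ≠ 0 → x l ≠ 0 → l ∈ ({![a, b]} : Finset (Wt 2)) := by
      intro l h1 _
      rw [two_eta l] at h1 ⊢
      rw [barKer_two, locR_of_add_ne h0] at h1
      rw [Finset.mem_singleton, vec_inj]
      by_contra h2
      rw [if_neg (by omega), if_neg (by omega)] at h1
      exact h1 (by simp)
    have key' : ∀ l, barKer ![b, a] l ≠ 0 → x l ≠ 0 →
        l ∈ ({![b, a], ![a, b]} : Finset (Wt 2)) := by
      intro l h1 _
      rw [two_eta l] at h1 ⊢
      rw [barKer_two, locR_of_add_ne (by omega)] at h1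
      rw [Finset.mem_insert, Finset.mem_singleton, vec_inj, vec_inj]
      by_contra h2
      rw [if_neg (by omega), if_neg (by omega)] at h1
      exact h1 (by simp)
    rw [bar_apply_of_ker hT _ _ key, bar_apply_of_ker hT _ _ key', Finset.sum_pair hne,
      Finset.sum_singleton, barKer_self, barKer_self, barKer_two, locR_of_add_ne (by omega),
      if_neg (by omega), if_pos ⟨hab, rfl, rfl⟩, dform_of_ne (by omega) h0, hR.swap a b hab h0,
      map_mul, map_pow, barQ_q, neg_zero, zpow_zero, zpow_neg, zpow_ofNat]
    ring
  · have e0 := hz0 0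
    rw [neg_zero] at e0
    rw [e0, hz0 1, hz0' 1]
    exact hB.zero
  · intro a ha
    have e1 := hz0 (a + 1)
    have e2 := hz0' (a + 1)
    rw [show -(a + 1) = -a - 1 by ring] at e1 e2
    rw [e1, e2, hz0, hz0']
    exact hB.step a ha
  · obtain ⟨C, hC⟩ := hB.bounded
    exact ⟨C, fun a ha => by rw [hz0, hz0']; exact hC a ha⟩

/-- A subspace which is stable under the quantum group and the bar involution. -/
structure IsStable {n : ℕ} (W : Submodule Qq (FT n)) : Prop where
  opE_mem : ∀ i, ∀ x ∈ W, opE n i x ∈ W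
  opF_mem : ∀ i, ∀ x ∈ W, opF n i x ∈ W
  opK_mem : ∀ i ε, ∀ x ∈ W, opK n i ε x ∈ W
  bar_mem : ∀ x ∈ W, bar n x ∈ W

/-- Adding a tensor factor on the right. -/
theorem IsStable.succ {n k : ℕ} (hk : k + 1 < n) (h : IsStable (relSpace n k)) :
    IsStable (relSpace (n + 1) k) where
  opE_mem i x hx := by
    rw [mem_relSpace_slice hk] at *
    refine ⟨opE_mem_THat i hx.1, fun p => ?_⟩
    rw [slice_opE]
    exact Submodule.add_mem _ (Submodule.smul_mem _ _ (hx.2 _))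
      (Submodule.smul_mem _ _ (h.opE_mem i _ (hx.2 _)))
  opF_mem i x hx := by
    rw [mem_relSpace_slice hk] at *
    refine ⟨opF_mem_THat i hx.1, fun p => ?_⟩
    rw [slice_opF]
    exact Submodule.add_mem _ (Submodule.smul_mem _ _ (h.opK_mem i _ _ (hx.2 _)))
      (h.opF_mem i _ (hx.2 _))
  opK_mem i ε x hx := by
    rw [mem_relSpace_slice hk] at *
    refine ⟨opK_mem_THat i ε hx.1, fun p => ?_⟩
    rw [slice_opK]
    exact Submodule.smul_mem _ _ (h.opK_mem i _ _ (hx.2 _))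
  bar_mem x hx := by
    rw [mem_relSpace_slice hk] at *
    exact ⟨bar_mem_THat hx.1, slice_bar_mem _ h.opE_mem h.bar_mem hx.1 hx.2⟩

/-- Adding a tensor factor on the left. -/
theorem IsStable.cons {n k : ℕ} (h : IsStable (relSpace n k)) :
    IsStable (relSpace (n + 1) (k + 1)) where
  opE_mem i x hx := by
    rw [mem_relSpace_lslice] at *
    refine ⟨opE_mem_THat i hx.1, fun p => ?_⟩
    rw [lslice_opE]
    exact Submodule.add_mem _ (Submodule.smul_mem _ _ (h.opK_mem i _ _ (hx.2 _)))
      (h.opE_mem i _ (hx.2 _))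
  opF_mem i x hx := by
    rw [mem_relSpace_lslice] at *
    refine ⟨opF_mem_THat i hx.1, fun p => ?_⟩
    rw [lslice_opF]
    exact Submodule.add_mem _ (Submodule.smul_mem _ _ (hx.2 _))
      (Submodule.smul_mem _ _ (h.opF_mem i _ (hx.2 _)))
  opK_mem i ε x hx := by
    rw [mem_relSpace_lslice] at *
    refine ⟨opK_mem_THat i ε hx.1, fun p => ?_⟩
    rw [lslice_opK]
    exact Submodule.smul_mem _ _ (h.opK_mem i _ _ (hx.2 _))
  bar_mem x hx := by
    rw [mem_relSpace_lslice] at *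
    exact ⟨bar_mem_THat hx.1,
      lslice_bar_mem _ (relSpace_le n k) h.opF_mem h.bar_mem hx.1 hx.2⟩

/-- The space of vectors satisfying the relations in two adjacent positions is stable under the
quantum group and the bar involution. -/
theorem isStable_relSpace : ∀ {n k : ℕ}, k + 1 < n → IsStable (relSpace n k)
  | 0, _, h => by omega
  | n + 1, 0, h => by
    rcases Nat.lt_or_ge 1 n with hn | hn
    · exact (isStable_relSpace hn).succ hn
    · obtain rfl : n = 1 := by omega
      exact ⟨fun i _ => relSpace_opE_two i, fun i _ => relSpace_opF_two i,
        fun i ε _ => relSpace_opK_two i ε, fun _ => relSpace_bar_two⟩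
  | n + 1, k + 1, h => (isStable_relSpace (by omega)).cons

/-! ### The kernel of the projection to the `q`-exterior power -/

theorem place_self {n k : ℕ} (hk : k + 1 < n) (m : Wt n) :
    place m k (m ⟨k, by omega⟩) (m ⟨k + 1, hk⟩) = m := by
  funext j
  unfold place
  split_ifs with h1 h2
  · congr 1; exact Fin.ext h1.symm
  · congr 1; exact Fin.ext h2.symm
  · rfl

theorem place_place {n : ℕ} (m : Wt n) (k : ℕ) (a b c d : ℤ) :
    place (place m k a b) k c d = place m k c d := by
  funext j
  unfold place
  split_ifs <;> rfl

theorem place_fst {n k : ℕ} (hk : k < n) (m : Wt n) (a b : ℤ) : place m k a b ⟨k, hk⟩ = a :=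
  if_pos rfl

theorem place_snd {n k : ℕ} (hk : k + 1 < n) (m : Wt n) (a b : ℤ) :
    place m k a b ⟨k + 1, hk⟩ = b := by
  unfold place
  rw [if_neg (show ¬(k + 1 = k) by omega), if_pos rfl]

theorem place_inj {n k : ℕ} (hk : k + 1 < n) {m : Wt n} {a b c d : ℤ}
    (h : place m k a b = place m k c d) : a = c ∧ b = d := by
  have h1 := congrFun h ⟨k, by omega⟩
  have h2 := congrFun h ⟨k + 1, hk⟩
  rw [place_fst, place_fst] at h1
  rw [place_snd, place_snd] at h2
  exact ⟨h1, h2⟩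

theorem tl_place {n k : ℕ} (hk : k + 1 < n) (m : Wt n) (a b : ℤ) (t r : ℕ) :
    tl (place m k a b) t r = tl (place m k 0 0) t r + (if t ≤ k then lev r a else 0)
      + (if t ≤ k + 1 then lev r b else 0) := by
  have h0 : lev r 0 = 0 := lev_eq_zero (by simp)
  have e : ∀ j : Fin n, (if t ≤ (j : ℕ) then lev r (place m k a b j) else 0)
      = (if t ≤ (j : ℕ) then lev r (place m k 0 0 j) else 0)
        + (if j = ⟨k, by omega⟩ then (if t ≤ k then lev r a else 0) else 0)
        + (if j = ⟨k + 1, hk⟩ then (if t ≤ k + 1 then lev r b else 0) else 0) := fun j => by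
    simp only [place, Fin.ext_iff]
    by_cases h1 : (j : ℕ) = k
    · simp [h1, h0]
    · by_cases h2 : (j : ℕ) = k + 1
      · simp [h2, h0]
      · simp [h1, h2]
  unfold tl
  rw [Finset.sum_congr rfl fun j _ => e j, Finset.sum_add_distrib, Finset.sum_add_distrib,
    Finset.sum_ite_eq', Finset.sum_ite_eq', if_pos (Finset.mem_univ _), if_pos (Finset.mem_univ _)]

theorem succeq_place {n k : ℕ} (hk : k + 1 < n) (m : Wt n) {a b c d : ℤ} (hbd : b ≤ d)
    (h : ∀ r, lev r a + lev r b = lev r c + lev r d) :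
    Succeq (place m k a b) (place m k c d) := by
  rw [succeq_iff]
  have e : ∀ t r, tl (place m k a b) t r ≤ tl (place m k c d) t r := fun t r => by
    rw [tl_place hk m a b, tl_place hk m c d]
    have h1 := h r
    have h2 := lev_mono r hbd
    split_ifs <;> omega
  refine ⟨fun r => ?_, e⟩
  rw [tl_place hk m a b, tl_place hk m c d]
  have h1 := h r
  simp only [Nat.zero_le, if_true]
  omega

/-- The coefficient at `v_p ⊗ v_r` of the combination of the quadratic relations with
coefficients `f`. -/
def relSum (f : ℤ → ℤ → Qq) (p r : ℤ) : Qq :=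
  if p + r ≠ 0 then (if r ≤ p then 1 else q ^ 2) * f (max p r) (min p r)
  else if p = 0 then q * f 1 (-1)
  else (if 0 < p then 1 else q ^ 4) * f |p| (-|p|) + q ^ 2 * f (|p| + 1) (-|p| - 1)

theorem eq_of_wedgeRel_ne_zero {a b p r : ℤ} (h : wedgeRel a b (p, r) ≠ 0) :
    b ≤ a ∧ (p + r ≠ 0 ∧ a = max p r ∧ b = min p r ∨
      p + r = 0 ∧ b = -a ∧ (p ≠ 0 ∧ a = |p| ∨ a = |p| + 1)) := by
  unfold wedgeRel at h
  split_ifs at h with h1 h2 h3 h4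
  · refine ⟨h1.le, Or.inl ?_⟩
    have : p = a ∧ r = b ∨ p = b ∧ r = a := by
      by_contra h'
      apply h
      simp only [Finsupp.add_apply, Finsupp.single_apply, Prod.mk.injEq]
      rw [if_neg (by omega), if_neg (by omega), add_zero]
    omega
  · have : p = 1 ∧ r = -1 ∨ p = 0 ∧ r = 0 ∨ p = -1 ∧ r = 1 := by
      by_contra h'
      apply h
      simp only [Finsupp.add_apply, Finsupp.single_apply, Prod.mk.injEq]
      rw [if_neg (by omega), if_neg (by omega), if_neg (by omega), add_zero, add_zero]
    rcases this with ⟨rfl, rfl⟩ | ⟨rfl, rfl⟩ | ⟨rfl, rfl⟩ <;> simp <;> omega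
  · have : p = a ∧ r = -a ∨ p = a - 1 ∧ r = 1 - a ∨ p = 1 - a ∧ r = a - 1 ∨ p = -a ∧ r = a := by
      by_contra h'
      apply h
      simp only [Finsupp.add_apply, Finsupp.single_apply, Prod.mk.injEq]
      rw [if_neg (by omega), if_neg (by omega), if_neg (by omega), if_neg (by omega), add_zero,
        add_zero, add_zero]
    refine ⟨h1.le, Or.inr ⟨by omega, by omega, ?_⟩⟩
    rcases this with h | h | h | h <;> rw [h.1]
    · left; rw [abs_of_pos (by omega)]; omega
    · right; rw [abs_of_pos (by omega)]; omega
    · right; rw [abs_of_neg (by omega)]; omega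
    · left; rw [abs_of_neg (by omega)]; omega
  · refine ⟨h4.1.ge, Or.inl ?_⟩
    have : p = a ∧ r = a := by
      by_contra h'
      apply h
      simp only [Finsupp.single_apply, Prod.mk.injEq]
      rw [if_neg (by omega)]
    omega
  · exact absurd rfl h

theorem wedgeRel_max_min {p r : ℤ} (h : p + r ≠ 0) :
    wedgeRel (max p r) (min p r) (p, r) = if r ≤ p then 1 else q ^ 2 := by
  unfold wedgeRel
  rcases lt_trichotomy p r with h1 | h1 | h1
  · rw [max_eq_right h1.le, min_eq_left h1.le, if_pos h1, if_pos (by omega : r + p ≠ 0),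
      if_neg (not_le.2 h1)]
    simp only [Finsupp.add_apply, Finsupp.single_apply, Prod.mk.injEq]
    split_ifs <;> first | (exfalso; omega) | ring
  · subst h1
    rw [max_self, min_self, if_neg (lt_irrefl _), if_pos ⟨rfl, by omega⟩, if_pos le_rfl]
    simp
  · rw [max_eq_left h1.le, min_eq_right h1.le, if_pos h1, if_pos h, if_pos h1.le]
    simp only [Finsupp.add_apply, Finsupp.single_apply, Prod.mk.injEq]
    split_ifs <;> first | (exfalso; omega) | ring

theorem wedgeRel_zero : wedgeRel 1 (-1) (0, 0) = q := by
  simp [wedgeRel]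

theorem wedgeRel_abs {p : ℤ} (hp : p ≠ 0) :
    wedgeRel |p| (-|p|) (p, -p) = if 0 < p then 1 else q ^ 4 := by
  have h0 := abs_pos.2 hp
  unfold wedgeRel
  rw [if_pos (by omega), if_neg (by omega)]
  rcases lt_or_gt_of_ne hp with h | h
  · rw [abs_of_neg h, if_neg (not_lt.2 h.le)]
    split_ifs with h1
    · simp only [Finsupp.add_apply, Finsupp.single_apply, Prod.mk.injEq]
      split_ifs <;> first | (exfalso; omega) | ring
    · simp only [Finsupp.add_apply, Finsupp.single_apply, Prod.mk.injEq, neg_neg]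
      split_ifs <;> first | (exfalso; omega) | ring
  · rw [abs_of_pos h, if_pos h]
    split_ifs with h1
    · simp only [Finsupp.add_apply, Finsupp.single_apply, Prod.mk.injEq]
      split_ifs <;> first | (exfalso; omega) | ring
    · simp only [Finsupp.add_apply, Finsupp.single_apply, Prod.mk.injEq]
      split_ifs <;> first | (exfalso; omega) | ring

theorem wedgeRel_abs_add_one {p : ℤ} (hp : p ≠ 0) :
    wedgeRel (|p| + 1) (-|p| - 1) (p, -p) = q ^ 2 := by
  have h0 := abs_pos.2 hp
  unfold wedgeRel
  rw [if_pos (by omega), if_neg (by omega), if_neg (by omega)]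
  simp only [Finsupp.add_apply, Finsupp.single_apply, Prod.mk.injEq]
  rcases lt_or_gt_of_ne hp with h | h
  · rw [abs_of_neg h]
    split_ifs <;> first | (exfalso; omega) | ring
  · rw [abs_of_pos h]
    split_ifs <;> first | (exfalso; omega) | ring

theorem relAt_place {n k : ℕ} (hk : k + 1 < n) (m : Wt n) (a b : ℤ) :
    relAt ⟨k, by omega⟩ hk (place m k a b) m
      = wedgeRel a b (m ⟨k, by omega⟩, m ⟨k + 1, hk⟩) := by
  unfold relAt
  rw [if_pos, place_fst, place_snd]
  intro j h1 h2
  unfold place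
  rw [if_neg fun h => h1 (Fin.ext h), if_neg fun h => h2 (Fin.ext h)]

theorem eq_place_of_relAt_ne_zero {n k : ℕ} (hk : k + 1 < n) {l m : Wt n}
    (h : relAt ⟨k, by omega⟩ hk l m ≠ 0) :
    l = place m k (l ⟨k, by omega⟩) (l ⟨k + 1, hk⟩) ∧
      wedgeRel (l ⟨k, by omega⟩) (l ⟨k + 1, hk⟩) (m ⟨k, by omega⟩, m ⟨k + 1, hk⟩) ≠ 0 := by
  unfold relAt at h
  split_ifs at h with h0
  · refine ⟨funext fun j => ?_, h⟩
    unfold place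
    split_ifs with h1 h2
    · congr 1; exact Fin.ext h1
    · congr 1; exact Fin.ext h2
    · exact (h0 j (fun e => h1 (by rw [e])) (fun e => h2 (by rw [e]))).symm
  · exact absurd rfl h

/-- Sums of relations, coordinatewise: at most two relations contribute to a coordinate. -/
theorem finsum_relAt {n k : ℕ} (hk : k + 1 < n) (c : Wt n → Qq) (m : Wt n) :
    ∑ᶠ l, c l * relAt ⟨k, by omega⟩ hk l m
      = relSum (fun a b => c (place m k a b)) (m ⟨k, by omega⟩) (m ⟨k + 1, hk⟩) := by
  classical
  set p := m ⟨k, by omega⟩ with hp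
  set r := m ⟨k + 1, hk⟩ with hr
  unfold relSum
  split_ifs with h1 h2 h3 h4
  · rw [finsum_eq_single _ (place m k (max p r) (min p r)), relAt_place, wedgeRel_max_min h1,
      if_pos h2, one_mul, mul_one]
    intro l hl
    by_contra h0
    obtain ⟨e1, e2⟩ := eq_place_of_relAt_ne_zero hk (right_ne_zero_of_mul h0)
    obtain ⟨-, h | h⟩ := eq_of_wedgeRel_ne_zero e2
    · rw [h.2.1, h.2.2] at e1; exact hl e1
    · exact h1 h.1
  · rw [finsum_eq_single _ (place m k (max p r) (min p r)), relAt_place, wedgeRel_max_min h1,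
      if_neg h2, mul_comm]
    intro l hl
    by_contra h0
    obtain ⟨e1, e2⟩ := eq_place_of_relAt_ne_zero hk (right_ne_zero_of_mul h0)
    obtain ⟨-, h | h⟩ := eq_of_wedgeRel_ne_zero e2
    · rw [h.2.1, h.2.2] at e1; exact hl e1
    · exact h1 h.1
  · have hr0 : r = 0 := by omega
    rw [finsum_eq_single _ (place m k 1 (-1)), relAt_place, ← hp, ← hr, h3, hr0, wedgeRel_zero,
      mul_comm]
    intro l hl
    by_contra h0
    obtain ⟨e1, e2⟩ := eq_place_of_relAt_ne_zero hk (right_ne_zero_of_mul h0)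
    obtain ⟨-, h | h⟩ := eq_of_wedgeRel_ne_zero e2
    · exact h1 h.1
    · rw [← hp, h3] at h
      simp only [ne_eq, not_true_eq_false, false_and, false_or, abs_zero, zero_add] at h
      rw [h.2.1, h.2.2] at e1; exact hl e1
  all_goals
    have hr0 : r = -p := by omega
    have hne : place m k |p| (-|p|) ≠ place m k (|p| + 1) (-|p| - 1) := fun h => by
      have := (place_inj hk h).1; omega
    rw [finsum_eq_sum_of_support_subset (s := {place m k |p| (-|p|),
      place m k (|p| + 1) (-|p| - 1)}), Finset.sum_pair hne, relAt_place, relAt_place, ← hp, ← hr,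
      hr0, wedgeRel_abs h3, wedgeRel_abs_add_one h3]
    · first | rw [if_pos h4] | rw [if_neg h4]
      ring
    · intro l h0
      obtain ⟨e1, e2⟩ := eq_place_of_relAt_ne_zero hk (right_ne_zero_of_mul h0)
      obtain ⟨-, h | h⟩ := eq_of_wedgeRel_ne_zero e2
      · exact absurd h.1 h1
      · rw [h.2.1] at e1
        rw [Finset.coe_pair, Set.mem_insert_iff, Set.mem_singleton_iff]
        rcases h.2.2 with h' | h'
        · left; rw [h'.2] at e1; exact e1
        · right
          rw [h'] at e1
          rw [show -|p| - 1 = -(|p| + 1) by ring]; exact e1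

theorem lev_of_wedgeRel_ne_zero {a b p r : ℤ} (h : wedgeRel a b (p, r) ≠ 0) :
    b ≤ r ∧ ∀ s, lev s a + lev s b = lev s p + lev s r := by
  obtain ⟨h1, h | h⟩ := eq_of_wedgeRel_ne_zero h
  · refine ⟨h.2.2 ▸ min_le_right p r, fun s => ?_⟩
    rcases le_total p r with h' | h'
    · rw [h.2.1, h.2.2, max_eq_right h', min_eq_left h', add_comm]
    · rw [h.2.1, h.2.2, max_eq_left h', min_eq_right h']
  · obtain ⟨h2, rfl, h3⟩ := h
    obtain rfl : r = -p := by omega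
    have := le_abs_self p
    refine ⟨by rcases h3 with h3 | h3 <;> omega, fun s => ?_⟩
    rw [lev_neg, lev_neg]; ring

theorem succeq_of_relAt_ne_zero {n k : ℕ} (hk : k + 1 < n) {l m : Wt n}
    (h : relAt ⟨k, by omega⟩ hk l m ≠ 0) : Succeq l m := by
  obtain ⟨e1, e2⟩ := eq_place_of_relAt_ne_zero hk h
  obtain ⟨h1, h2⟩ := lev_of_wedgeRel_ne_zero e2
  have := succeq_place hk m h1 h2
  rwa [← e1, place_self hk] at this

theorem finsum_relAt_mem_THat {n k : ℕ} (hk : k + 1 < n) {c : FT n} (hc : c ∈ THat n) :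
    (fun m => ∑ᶠ l, c l * relAt ⟨k, by omega⟩ hk l m) ∈ THat n := by
  obtain ⟨S, hS⟩ := hc
  refine ⟨S, fun m hm => ?_⟩
  obtain ⟨l, hl⟩ : ∃ l, c l * relAt ⟨k, by omega⟩ hk l m ≠ 0 := by
    by_contra h
    push Not at h
    exact hm ((finsum_congr h).trans finsum_zero)
  obtain ⟨s, hs, h⟩ := hS l (left_ne_zero_of_mul hl)
  exact ⟨s, hs, succeq_trans h (succeq_of_relAt_ne_zero hk (right_ne_zero_of_mul hl))⟩

theorem isRel_relSum {f : ℤ → ℤ → Qq} (hf : ∃ A : ℤ, ∀ a, A ≤ a → f a (-a) = 0) :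
    IsRel (relSum f) where
  swap a b hab h := by
    unfold relSum
    rw [if_pos (by omega), if_neg (by omega), if_pos h, if_pos hab.le, max_comm, min_comm, one_mul]
  zero := by
    unfold relSum
    simp
    ring
  step a ha := by
    have h1 : |a| = a := abs_of_pos (by omega)
    have h2 : |a + 1| = a + 1 := abs_of_pos (by omega)
    have h3 : |-a - 1| = a + 1 := by rw [abs_of_neg (by omega)]; ring
    have e1 : ∀ x y : ℤ, x + y = 0 → x ≠ 0 → relSum f x y = (if 0 < x then 1 else q ^ 4)
        * f |x| (-|x|) + q ^ 2 * f (|x| + 1) (-|x| - 1) := fun x y h h' => by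
      unfold relSum
      rw [if_neg (not_not.2 h), if_neg h']
    rw [e1 _ _ (by omega) (by omega), e1 _ _ (by omega) (by omega), e1 _ _ (by omega) (by omega),
      e1 _ _ (by omega) (by omega), abs_neg, h1, h2, h3, if_pos (by omega), if_neg (by omega),
      if_neg (by omega), if_pos (by omega), show -(a + 1) = -a - 1 by ring]
    ring
  bounded := by
    obtain ⟨A, hA⟩ := hf
    refine ⟨max A 1, fun a ha => ?_⟩
    unfold relSum
    have h1 : |a| = a := abs_of_pos (by omega)
    have e := hA (a + 1) (by omega)
    rw [show -(a + 1) = -a - 1 by ring] at e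
    rw [if_neg (show ¬(a + -a ≠ 0) by omega), if_neg (show ¬(-a + a ≠ 0) by omega),
      if_neg (show a ≠ 0 by omega), if_neg (show -a ≠ 0 by omega), abs_neg, h1,
      hA a (by omega), e]
    simp

theorem exists_place_eq_zero {n k : ℕ} (hk : k + 1 < n) {c : FT n} (hc : c ∈ THat n) (m : Wt n) :
    ∃ A : ℤ, ∀ a, A ≤ a → c (place m k a (-a)) = 0 := by
  rw [mem_THat_iff] at hc
  obtain ⟨N, hN⟩ := hc
  obtain ⟨M, hM⟩ := exists_inBox (place m k 0 0)
  refine ⟨max N M + 1, fun a ha => ?_⟩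
  by_contra h
  have h1 := ((hN _ h) (max N M) (le_max_left _ _)).2 (k + 1)
  rw [tl_place hk, tl_eq_zero_of_inBox hM _ (le_max_right _ _), if_neg (by omega),
    if_pos le_rfl] at h1
  unfold lev at h1
  split_ifs at h1 <;> omega

theorem finsum_relAt_mem_relSpace {n k : ℕ} (hk : k + 1 < n) {c : FT n} (hc : c ∈ THat n) :
    (fun m => ∑ᶠ l, c l * relAt ⟨k, by omega⟩ hk l m) ∈ relSpace n k := by
  refine ⟨finsum_relAt_mem_THat hk hc, fun m => ?_⟩
  simp only [finsum_relAt, place_place, place_fst, place_snd]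
  exact isRel_relSum (exists_place_eq_zero hk hc m)

/-- The coefficients of the relations in a vector satisfying `IsRel`. For the relations of weight
zero, the difference of the coordinates at `v_a ⊗ v_{-a}` and `v_{-a} ⊗ v_a` isolates the relation
with leading term `v_a ⊗ v_{-a}`. -/
def relCoef (f : ℤ → ℤ → Qq) (a b : ℤ) : Qq :=
  if a + b ≠ 0 then (if b ≤ a then f a b else 0)
  else if 0 < a then (f a (-a) - f (-a) a) / (1 - q ^ 4) else 0

theorem IsRel.relSum_relCoef {f : ℤ → ℤ → Qq} (hf : IsRel f) (p r : ℤ) :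
    relSum (relCoef f) p r = f p r := by
  have h4 := one_sub_q_pow_ne_zero
  unfold relSum
  by_cases h1 : p + r ≠ 0
  · rw [if_pos h1]
    have h2 : relCoef f (max p r) (min p r) = f (max p r) (min p r) := by
      unfold relCoef
      rw [if_pos (by omega), if_pos (by omega)]
    rw [h2]
    rcases le_or_gt r p with h | h
    · rw [if_pos h, one_mul, max_eq_left h, min_eq_right h]
    · rw [if_neg (by omega), max_eq_right h.le, min_eq_left h.le, hf.swap r p h (by omega)]
  · obtain rfl : r = -p := by omega
    rw [if_neg h1]
    have e : ∀ a, 1 ≤ a → relCoef f a (-a) = (f a (-a) - f (-a) a) / (1 - q ^ 4) := fun a ha => by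
      unfold relCoef
      rw [if_neg (by omega), if_pos (by omega)]
    by_cases hp : p = 0
    · subst hp
      rw [if_pos rfl, e 1 le_rfl, neg_zero]
      field_simp
      linear_combination -hf.zero
    · have h0 := abs_pos.2 hp
      have es := hf.step |p| h0
      have e2 := e (|p| + 1) (by omega)
      rw [show -(|p| + 1) = -|p| - 1 by ring] at e2
      rw [if_neg hp, e |p| h0, e2]
      rcases lt_or_gt_of_ne hp with h | h
      · rw [abs_of_neg h, neg_neg] at es ⊢
        rw [if_neg (by omega)]
        field_simp
        linear_combination es
      · rw [abs_of_pos h] at es ⊢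
        rw [if_pos h]
        field_simp
        linear_combination es

/-- A vector satisfying the linear conditions of `IsRel` in two adjacent positions is a sum of
relations with coefficients in `T̂ⁿ`. -/
theorem relSpace_le_wedgeKer {n k : ℕ} (hk : k + 1 < n) : relSpace n k ≤ wedgeKer n := by
  intro x hx
  have hR := hx.2
  set d : FT n := fun l =>
    relCoef (fun a b => x (place l k a b)) (l ⟨k, by omega⟩) (l ⟨k + 1, hk⟩) with hd
  have hdp : ∀ m a b, d (place m k a b) = relCoef (fun a b => x (place m k a b)) a b :=
    fun m a b => by
      simp only [hd, place_place, place_fst, place_snd]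
  have hdT : d ∈ THat n := by
    have hx1 := hx.1
    rw [mem_THat_iff] at *
    obtain ⟨N, hN⟩ := hx1
    refine ⟨N, fun l hl => ?_⟩
    rw [← place_self hk l] at hl ⊢
    generalize l ⟨k, by omega⟩ = a at hl ⊢
    generalize l ⟨k + 1, hk⟩ = b at hl ⊢
    rw [hdp] at hl
    by_cases hab : a + b ≠ 0
    · unfold relCoef at hl
      rw [if_pos hab] at hl
      split_ifs at hl
      · exact hN _ hl
      · exact absurd rfl hl
    · obtain rfl : b = -a := by omega
      have ha : 0 < a := by
        by_contra h
        unfold relCoef at hl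
        rw [if_neg hab, if_neg h] at hl
        exact hl rfl
      -- if `v_a ⊗ v_{-a}` does not occur, then the coefficient with parameter `a + 1` is non-zero
      obtain ⟨B, hB⟩ := (hR l).bounded
      have main : ∀ j : ℕ, ∀ a : ℤ, 0 < a → B ≤ a + j →
          x (place l k a (-a)) - x (place l k (-a) a) ≠ 0 →
          ∃ a', a ≤ a' ∧ x (place l k a' (-a')) ≠ 0 := by
        intro j
        induction j with
        | zero =>
          intro a _ ha h
          have := hB a (by simpa using ha)
          rw [this.1, this.2, sub_self] at h
          exact absurd rfl h
        | succ j ih =>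
          intro a ha0 ha h
          by_cases h0 : x (place l k a (-a)) = 0
          · obtain ⟨a', h1, h2⟩ := ih (a + 1) (by omega) (by push_cast at ha; omega) fun h' => h (by
              have := (hR l).step a ha0
              rw [show -(a + 1) = -a - 1 by ring] at h'
              rw [h', h0] at this
              rw [h0]; linear_combination this)
            exact ⟨a', by omega, h2⟩
          · exact ⟨a, le_rfl, h0⟩
      obtain ⟨a', h1, h2⟩ := main (B - a).toNat a ha (by omega) fun h => hl (by
        unfold relCoef
        rw [if_neg hab, if_pos ha, h, zero_div])
      have hle : Succeq (place l k a' (-a')) (place l k a (-a)) :=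
        succeq_place hk l (by omega) fun s => by rw [lev_neg, lev_neg]; ring
      have hb := hN _ h2
      rw [succeq_iff] at hle
      intro s hs
      exact ⟨by rw [← hle.1]; exact (hb s hs).1, fun t => ((hb s hs).2 t).trans (hle.2 t s)⟩
  refine Submodule.subset_span ⟨⟨k, by omega⟩, hk, d, hdT, funext fun m => ?_⟩
  rw [finsum_relAt]
  simp only [hdp]
  have := (hR m).relSum_relCoef (m ⟨k, by omega⟩) (m ⟨k + 1, hk⟩)
  rw [place_self hk] at this
  exact this.symm

theorem wedgeKer_le {n : ℕ} : wedgeKer n ≤ THat n :=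
  Submodule.span_le.2 (by
    rintro _ ⟨⟨k, hk'⟩, hk, c, hc, rfl⟩
    exact finsum_relAt_mem_THat hk hc)

/-- The bar involution of `T̂ⁿ` induces one of `F̂ⁿ`. -/
theorem bar_mem_wedgeKer {n : ℕ} {x : FT n} (hx : x ∈ wedgeKer n) : bar n x ∈ wedgeKer n := by
  refine Submodule.span_induction (p := fun x _ => bar n x ∈ wedgeKer n) ?_ ?_ ?_ ?_ hx
  · rintro _ ⟨⟨k, hk'⟩, hk, c, hc, rfl⟩
    exact relSpace_le_wedgeKer hk
      ((isStable_relSpace hk).bar_mem _ (finsum_relAt_mem_relSpace hk hc))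
  · rw [bar_zero]; exact Submodule.zero_mem _
  · intro x y hx hy h1 h2
    rw [bar_add (wedgeKer_le hx) (wedgeKer_le hy)]
    exact Submodule.add_mem _ h1 h2
  · intro r x hx h
    rw [bar_smul _ (wedgeKer_le hx)]
    exact Submodule.smul_mem _ _ h

/-! ### Dominant weights and the reversal of the Bruhat order -/

theorem w0_w0 {n : ℕ} (l : Wt n) : w0 (w0 l) = l := funext fun i => by
  unfold w0; rw [Fin.rev_rev]

theorem tl_w0 {n : ℕ} (l : Wt n) {t : ℕ} (ht : t ≤ n) (r : ℕ) :
    tl (w0 l) t r = tl l 0 r - tl l (n - t) r := by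
  unfold tl w0
  rw [← Finset.sum_sub_distrib, ← Equiv.sum_comp Fin.revPerm]
  refine Finset.sum_congr rfl fun i _ => ?_
  rw [Fin.revPerm_apply, Fin.rev_rev, Fin.val_rev]
  have := i.2
  split_ifs <;> omega

theorem succeq_of_succeq_w0 {n : ℕ} {l m : Wt n} (h : Succeq (w0 l) (w0 m)) : Succeq m l := by
  rw [succeq_iff] at *
  have e0 : ∀ r, tl l 0 r = tl m 0 r := fun r => by
    have := h.1 r
    rw [tl_w0 _ (Nat.zero_le _), tl_w0 _ (Nat.zero_le _), Nat.sub_zero, tl_of_le l le_rfl,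
      tl_of_le m le_rfl] at this
    omega
  refine ⟨fun r => (e0 r).symm, fun t r => ?_⟩
  rcases le_or_gt t n with ht | ht
  · have := h.2 (n - t) r
    rw [tl_w0 _ (Nat.sub_le _ _), tl_w0 _ (Nat.sub_le _ _), Nat.sub_sub_self ht, e0] at this
    omega
  · rw [tl_of_le l ht.le, tl_of_le m ht.le]

theorem IsDominant.neg_w0 {n : ℕ} {l : Wt n} (h : IsDominant l) : IsDominant (-w0 l) := by
  intro i j hij
  have := h j.rev i.rev (Fin.rev_lt_rev.2 hij)
  simp only [Pi.neg_apply, w0]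
  omega

/-! ### Straightening -/

/-- The position `k` of `λ` admits straightening: there is a relation with leading term
`v_{λ_k} ⊗ v_{λ_{k+1}}`, that is, `λ_k ≥ λ_{k+1}` and not both are `0`. -/
def IsDescent {n : ℕ} (l : Wt n) (k : ℕ) : Prop :=
  ∃ hk : k + 1 < n, l ⟨k + 1, hk⟩ ≤ l ⟨k, by omega⟩ ∧ (l ⟨k, by omega⟩ = 0 → l ⟨k + 1, hk⟩ ≠ 0)

open scoped Classical in
/-- A chosen descent of a weight, or `n` if there is none. -/
def descent {n : ℕ} (l : Wt n) : ℕ := if h : ∃ k, IsDescent l k then h.choose else n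

theorem isDescent_descent {n : ℕ} {l : Wt n} (h : descent l + 1 < n) :
    IsDescent l (descent l) := by
  unfold descent at *
  split_ifs at * with h'
  · exact h'.choose_spec
  · omega

theorem not_isDescent {n : ℕ} {l : Wt n} (h : ¬descent l + 1 < n) (k : ℕ) : ¬IsDescent l k := by
  intro hk
  have h' : ∃ k, IsDescent l k := ⟨k, hk⟩
  apply h
  unfold descent
  rw [dif_pos h']
  exact h'.choose_spec.1

/-- Weights without descents are the reversals of dominant weights. -/
theorem isDominant_of_descent {n : ℕ} {l : Wt n} (h : ¬descent (w0 l) + 1 < n) :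
    IsDominant l := by
  have hadj : ∀ (k : ℕ) (hk : k + 1 < n), w0 l ⟨k, by omega⟩ ≤ w0 l ⟨k + 1, hk⟩ ∧
      (w0 l ⟨k, by omega⟩ = w0 l ⟨k + 1, hk⟩ → w0 l ⟨k, by omega⟩ = 0) := fun k hk => by
    have := not_isDescent h k
    unfold IsDescent at this
    push Not at this
    have := this hk
    omega
  have main : ∀ (d i : ℕ) (hi : i + d + 1 < n), w0 l ⟨i, by omega⟩ ≤ w0 l ⟨i + d + 1, hi⟩ ∧
      (w0 l ⟨i, by omega⟩ = w0 l ⟨i + d + 1, hi⟩ → w0 l ⟨i, by omega⟩ = 0) := by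
    intro d
    induction d with
    | zero => exact fun i hi => hadj i hi
    | succ d ih =>
      intro i hi
      have h1 := ih i (by omega)
      have h2 := hadj (i + d + 1) (by omega)
      have e : (⟨i + (d + 1) + 1, hi⟩ : Fin n) = ⟨i + d + 1 + 1, by omega⟩ := Fin.ext (by
        simp only; omega)
      rw [e]
      omega
  intro i j hij
  have := main ((j : ℕ) - i - 1) (n - 1 - j) (by omega)
  have e1 : w0 l ⟨n - 1 - j, by omega⟩ = l j := by
    unfold w0; congr 1; refine Fin.ext ?_
    rw [Fin.val_rev]; simp only; omega
  have e2 : w0 l ⟨n - 1 - j + ((j : ℕ) - i - 1) + 1, by omega⟩ = l i := by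
    unfold w0; congr 1; refine Fin.ext ?_
    rw [Fin.val_rev]; simp only; omega
  rw [e1, e2] at this
  omega

theorem IsDominant.descent {n : ℕ} {l : Wt n} (h : IsDominant l) :
    ¬QueerFock.descent (w0 l) + 1 < n := by
  intro h'
  have hd := isDescent_descent h'
  generalize QueerFock.descent (w0 l) = k at hd
  obtain ⟨hk, h1, h2⟩ := hd
  have := h (Fin.rev ⟨k + 1, hk⟩) (Fin.rev ⟨k, by omega⟩)
    (Fin.rev_lt_rev.2 (Fin.lt_def.2 (Nat.lt_succ_self k)))
  unfold w0 at h1 h2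
  omega

/-- The coefficient of `N_m` in the relation with leading term `N_l` with which `l` is straightened,
or `0` if `l` has no descent. -/
def straight {n : ℕ} (l m : Wt n) : Qq :=
  if h : descent l + 1 < n then relAt ⟨descent l, by omega⟩ h l m else 0

theorem wedgeRel_self {a b : ℤ} (hab : b ≤ a) (h : a = 0 → b ≠ 0) :
    wedgeRel a b (a, b) = 1 := by
  unfold wedgeRel
  split_ifs with h1 h2 h3 h4
  · simp only [Finsupp.add_apply, Finsupp.single_apply, Prod.mk.injEq]
    split_ifs <;> first | (exfalso; omega) | ring
  · obtain rfl : b = -1 := by omega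
    subst h3
    simp
  · obtain rfl : b = -a := by omega
    simp only [Finsupp.add_apply, Finsupp.single_apply, Prod.mk.injEq, if_true]
    split_ifs <;> first | (exfalso; omega) | ring
  · rw [← h4.1]; simp
  · omega

theorem q_pow_mem_qZ (j : ℕ) : q ^ (j + 1) ∈ qZ :=
  ⟨Polynomial.X ^ j, by rw [map_pow, Polynomial.aeval_X, pow_succ']⟩

theorem wedgeRel_mem_qZ {a b p r : ℤ} (h : (a, b) ≠ (p, r)) : wedgeRel a b (p, r) ∈ qZ := by
  have e1 : q ∈ qZ := by simpa using q_pow_mem_qZ 0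
  have e2 := q_pow_mem_qZ 1
  have e4 := q_pow_mem_qZ 3
  have h0 := zero_mem_qZ
  have h' : ¬(a = p ∧ b = r) := fun e => h (by rw [e.1, e.2])
  have hs : ∀ {x : ℤ × ℤ} {c : Qq}, c ∈ qZ → Finsupp.single x c (p, r) ∈ qZ := fun {x c} hc => by
    rw [Finsupp.single_apply]; split_ifs <;> assumption
  have hz : Finsupp.single (a, b) (1 : Qq) (p, r) = 0 := Finsupp.single_eq_of_ne (Ne.symm h)
  unfold wedgeRel
  split_ifs with h1 h2 h3 h4
  · rw [Finsupp.add_apply, hz, zero_add]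
    exact hs e2
  · obtain rfl : b = -1 := by omega
    subst h3
    rw [Finsupp.add_apply, Finsupp.add_apply, hz, zero_add]
    exact add_mem_qZ (hs e1) (hs e4)
  · obtain rfl : b = -a := by omega
    rw [Finsupp.add_apply, Finsupp.add_apply, Finsupp.add_apply, hz, zero_add]
    exact add_mem_qZ (add_mem_qZ (hs e2) (hs e2)) (hs e4)
  · obtain rfl : b = a := h4.1.symm
    rw [hz]; exact h0
  · exact h0

theorem straight_self {n : ℕ} {l : Wt n} (h : descent l + 1 < n) : straight l l = 1 := by
  obtain ⟨hk, h1, h2⟩ := isDescent_descent h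
  unfold straight
  rw [dif_pos h, relAt, if_pos fun _ _ _ => rfl]
  exact wedgeRel_self h1 h2

theorem straight_mem_qZ {n : ℕ} {l m : Wt n} (hlm : l ≠ m) : straight l m ∈ qZ := by
  unfold straight
  split_ifs with h
  · by_cases h0 : relAt ⟨descent l, by omega⟩ h l m = 0
    · rw [h0]; exact zero_mem_qZ
    · obtain ⟨e1, e2⟩ := eq_place_of_relAt_ne_zero h h0
      have e3 := relAt_place h m (l ⟨descent l, by omega⟩) (l ⟨descent l + 1, h⟩)
      rw [← e1] at e3
      rw [e3]
      refine wedgeRel_mem_qZ fun e => hlm ?_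
      rw [Prod.mk.injEq] at e
      rw [e1, e.1, e.2, place_self]
  · exact zero_mem_qZ

/-- The canonical basis of `F̂ⁿ` exists: the bar-invariant vector `T` of `T̂ⁿ` with leading term
`N_{w_0 λ}` is straightened modulo the relations into a combination of the `F_μ`. -/
theorem exists_isCanonicalWedge {n : ℕ} {l : Wt n} (hl : IsDominant l) :
    ∃ u, IsCanonicalWedge l u := by
  classical
  set L := w0 l with hL
  have hLd : ¬descent L + 1 < n := hl.descent
  have hL0 : ∀ m, straight L m = 0 := fun m => dif_neg hLd
  obtain ⟨T, hTbar, hTL, hTs, hTq⟩ := exists_canonical L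
  have hTT : T ∈ THat n := ⟨{L}, fun m hm => ⟨L, Finset.mem_singleton_self L, hTs m hm⟩⟩
  let J : Wt n → Finset (Wt n) := fun m => (finite_interval L m).toFinset
  have hJ : ∀ m l, l ∈ J m ↔ Succeq L l ∧ Succeq l m := fun m l => Set.Finite.mem_toFinset _
  -- `g l` is the coefficient of `N_l` when all larger weights have been straightened
  obtain ⟨g, hg⟩ := exists_recursive L fun m g =>
    if Succeq L m then T m - ∑ l ∈ J m, g l * straight l m else 0
  have hg' : ∀ m, g m = if Succeq L m then T m - ∑ l ∈ (J m).erase m, g l * straight l m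
      else 0 := fun m => by
    rw [hg]
    by_cases hm : Succeq L m
    · rw [if_pos hm, if_pos hm, ← Finset.add_sum_erase _ _ ((hJ m m).2 ⟨hm, succeq_refl m⟩)]
      beta_reduce
      rw [if_neg (fun h => h.2.2 rfl), zero_mul, zero_add]
      congr 1
      refine Finset.sum_congr rfl fun k hk => ?_
      rw [Finset.mem_erase, hJ] at hk
      rw [if_pos ⟨hk.2.1, hk.2.2, hk.1⟩]
    · rw [if_neg hm, if_neg hm]
  have hgs : ∀ m, g m ≠ 0 → Succeq L m := fun m hm => by
    by_contra h
    exact hm (by rw [hg', if_neg h])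
  have hgL : g L = 1 := by
    rw [hg', if_pos (succeq_refl L), hTL, Finset.sum_eq_zero, sub_zero]
    intro k hk
    rw [Finset.mem_erase, hJ] at hk
    exact absurd (succeq_antisymm hk.2.2 hk.2.1) hk.1
  have hgq : ∀ m, m ≠ L → g m ∈ qZ := by
    intro m
    induction m using (wellFounded_interval L).induction with
    | _ m ih =>
    intro hm
    rw [hg']
    split_ifs with h
    · rw [sub_eq_add_neg]
      refine add_mem_qZ (hTq m hm) (neg_mem_qZ ?_)
      refine Finset.sum_induction _ (· ∈ qZ) (fun _ _ => add_mem_qZ) zero_mem_qZ fun k hk => ?_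
      rw [Finset.mem_erase, hJ] at hk
      by_cases hkL : k = L
      · rw [hkL, hL0, mul_zero]; exact zero_mem_qZ
      · exact mul_mem_qZ (ih k ⟨hk.2.1, hk.2.2, hk.1⟩ hkL) (straight_mem_qZ hk.1)
    · exact zero_mem_qZ
  -- the combination `κ` of relations which is subtracted, sorted by the positions of the descents
  let d : ℕ → FT n := fun k l => if descent l = k then g l else 0
  have hdT : ∀ k, d k ∈ THat n := fun k =>
    ⟨{L}, fun m hm => ⟨L, Finset.mem_singleton_self L, hgs m fun h => hm (by
      simp only [d, h, ite_self])⟩⟩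
  let κ : FT n := ∑ k ∈ Finset.range n, if hk : k + 1 < n then
    (fun m => ∑ᶠ l, d k l * relAt ⟨k, by omega⟩ hk l m) else 0
  have hκ : κ ∈ wedgeKer n := Submodule.sum_mem _ fun k _ => by
    split_ifs with hk
    · exact Submodule.subset_span ⟨⟨k, by omega⟩, hk, d k, hdT k, rfl⟩
    · exact Submodule.zero_mem _
  have hκm : ∀ m, κ m = ∑ l ∈ J m, g l * straight l m := fun m => by
    have e : ∀ k ∈ Finset.range n, (if hk : k + 1 < n then
        (fun m => ∑ᶠ l, d k l * relAt ⟨k, by omega⟩ hk l m) else (0 : FT n)) m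
        = ∑ l ∈ J m, if descent l = k then g l * straight l m else 0 := fun k _ => by
      split_ifs with hk
      · beta_reduce
        rw [finsum_eq_sum_of_support_subset (s := J m)]
        · refine Finset.sum_congr rfl fun l _ => ?_
          by_cases h : descent l = k
          · subst h
            simp only [d, straight, if_true, dif_pos hk]
          · simp only [d, if_neg h, zero_mul]
        · intro l h0
          have h1 : d k l ≠ 0 := left_ne_zero_of_mul h0
          refine (hJ m l).2 ⟨hgs l fun h => h1 ?_,
            succeq_of_relAt_ne_zero hk (right_ne_zero_of_mul h0)⟩
          simp only [d, h, ite_self]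
      · symm
        refine Finset.sum_eq_zero fun l _ => ?_
        split_ifs with h
        · rw [straight, dif_neg (by omega), mul_zero]
        · rfl
    simp only [κ]
    rw [Finset.sum_apply, Finset.sum_congr rfl e, Finset.sum_comm]
    refine Finset.sum_congr rfl fun l _ => ?_
    rw [Finset.sum_ite_eq]
    split_ifs with h
    · rfl
    · rw [straight, dif_neg (by rw [Finset.mem_range] at h; omega), mul_zero]
  have hu : ∀ m, T m - κ m = if descent m + 1 < n then 0 else g m := fun m => by
    rw [hκm]
    by_cases hm : Succeq L m
    · have hmJ := (hJ m m).2 ⟨hm, succeq_refl m⟩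
      have e := hg' m
      rw [if_pos hm] at e
      rw [← Finset.add_sum_erase _ _ hmJ]
      split_ifs with h
      · rw [straight_self h]; linear_combination -e
      · have : straight m m = 0 := dif_neg h
        rw [this]; linear_combination -e
    · have h1 : T m = 0 := by
        by_contra h; exact hm (hTs m h)
      have h2 : g m = 0 := by
        by_contra h; exact hm (hgs m h)
      rw [h1, h2, ite_self, Finset.sum_eq_zero, sub_zero]
      intro k hk
      rw [hJ] at hk
      exact absurd (succeq_trans hk.1 hk.2) hm
  have hu0 : ∀ m, (T - κ) (w0 m) ≠ 0 → IsDominant m ∧ g (w0 m) ≠ 0 := fun m hm => by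
    rw [Pi.sub_apply, hu] at hm
    split_ifs at hm with h
    · exact absurd rfl hm
    · exact ⟨isDominant_of_descent h, hm⟩
  have hue : (fun ν => (T - κ) (w0 (w0 ν))) = T - κ := funext fun ν => by rw [w0_w0]
  refine ⟨fun m => (T - κ) (w0 m), ⟨?_, ?_, fun m hm => ?_, fun m hm => ?_⟩⟩
  · rw [hue, bar_sub hTT (wedgeKer_le hκ), hTbar, sub_sub_sub_cancel_left]
    exact Submodule.sub_mem _ hκ (bar_mem_wedgeKer hκ)
  · change (T - κ) L = 1
    rw [Pi.sub_apply, hu, if_neg hLd, hgL]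
  · obtain ⟨h1, h2⟩ := hu0 m hm
    exact ⟨h1, succeq_of_succeq_w0 (hgs _ h2)⟩
  · rw [Pi.sub_apply, hu]
    split_ifs with h
    · exact zero_mem_qZ
    · refine hgq _ fun e => hm ?_
      rw [← w0_w0 m, e, hL, w0_w0]

theorem uCoef_self {n : ℕ} {l : Wt n} (hl : IsDominant l) : uCoef l l = 1 := by
  have h := exists_isCanonicalWedge hl
  rw [uCoef, dif_pos h]
  exact h.choose_spec.leading

theorem uCoef_mem_qZ {n : ℕ} {l m : Wt n} (hl : IsDominant l) (hm : m ≠ l) : uCoef m l ∈ qZ := by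
  have h := exists_isCanonicalWedge hl
  rw [uCoef, dif_pos h]
  exact h.choose_spec.coeff m hm

/-! ### Dominant weights below a given one -/

/-- A dominant weight below a weight in a box lies in the box: its last part is bounded below by
the Bruhat order, hence so are all parts, and then the weight bounds them above. -/
theorem inBox_of_isDominant {n N : ℕ} {l m : Wt n} (hl : InBox N l) (hm : IsDominant m)
    (h : Succeq l m) : InBox N m := by
  have hb := below_of_succeq h hl
  have hN : ∀ i, -(N : ℤ) ≤ m i := fun i => by
    have hn : 0 < n := i.pos
    have h1 := (hb N le_rfl).2 (n - 1)
    have h2 := lev_eq_tl_sub m ⟨n - 1, by omega⟩ N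
    have h4 : tl m (n - 1 + 1) N = 0 := tl_of_le m (by omega) N
    rw [h4, sub_zero] at h2
    have h3 : -(N : ℤ) ≤ m ⟨n - 1, by omega⟩ := by
      simp only at h2
      rw [← h2] at h1
      unfold lev at h1; split_ifs at h1 <;> omega
    rcases eq_or_lt_of_le (show i ≤ ⟨n - 1, by omega⟩ from Fin.le_def.2 (by simp only; omega))
      with h4 | h4
    · rw [h4]; exact h3
    · exact h3.trans (hm _ _ h4).1
  intro i
  have h0 := (hb N le_rfl).1
  unfold tl at h0
  simp only [Nat.zero_le, if_true] at h0
  have hnn : ∀ j ∈ Finset.univ, 0 ≤ lev N (m j) := fun j _ => by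
    have := hN j
    unfold lev; split_ifs <;> omega
  exact natAbs_le_of_lev ((Finset.sum_eq_zero_iff_of_nonneg hnn).1 h0 i (Finset.mem_univ i))

theorem finite_isDominant {n : ℕ} (l : Wt n) : {m | IsDominant m ∧ Succeq l m}.Finite := by
  obtain ⟨N, hN⟩ := exists_inBox l
  exact (finite_inBox n N).subset fun m hm => inBox_of_isDominant hN hm.1 hm.2

/-- The number of negative parts. -/
def negs {n : ℕ} (l : Wt n) : ℤ := ∑ i, if l i < 0 then 1 else 0

/-- The tail sum `tl λ 0 0` is the number of positive parts minus the number of negative parts. -/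
theorem zeros_add {n : ℕ} (l : Wt n) : (zeros l : ℤ) + tl l 0 0 + 2 * negs l = n := by
  have e : ∀ i, (if l i = 0 then (1 : ℤ) else 0) + lev 0 (l i) + 2 * (if l i < 0 then 1 else 0)
      = 1 := fun i => by
    unfold lev; split_ifs <;> omega
  have h := Finset.sum_congr rfl fun i (_ : i ∈ (Finset.univ : Finset (Fin n))) => e i
  rw [Finset.sum_add_distrib, Finset.sum_add_distrib, ← Finset.mul_sum] at h
  unfold zeros negs tl
  rw [Finset.card_filter]
  push_cast
  simpa using h

/-- Going down in the Bruhat order on dominant weights, zero parts do not disappear. -/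
theorem zeros_le_of_succeq {n : ℕ} {l m : Wt n} (hm : IsDominant m) (h : Succeq l m) :
    zeros l ≤ zeros m := by
  classical
  rw [succeq_iff] at h
  -- the negative parts of `m` are those from the position `Nat.find hex` on; comparing the tail
  -- sums there shows that `l` has at least as many negative parts, and `zeros_add` does the rest
  have hex : ∃ t : ℕ, ∀ i : Fin n, t ≤ i → m i < 0 := ⟨n, fun i hi => by have := i.2; omega⟩
  have hneg : ∀ i : Fin n, Nat.find hex ≤ i ↔ m i < 0 := fun i => by
    refine ⟨Nat.find_spec hex i, fun hi => Nat.find_min' hex fun j hj => ?_⟩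
    rcases eq_or_lt_of_le (Fin.le_def.2 hj) with h1 | h1
    · rwa [← h1]
    · exact lt_of_le_of_lt (hm _ _ h1).1 hi
  have e1 : tl m (Nat.find hex) 0 = -negs m := by
    unfold tl negs
    rw [← Finset.sum_neg_distrib]
    refine Finset.sum_congr rfl fun i _ => ?_
    have := hneg i
    unfold lev
    split_ifs <;> omega
  have e2 : -negs l ≤ tl l (Nat.find hex) 0 := by
    unfold tl negs
    rw [← Finset.sum_neg_distrib]
    refine Finset.sum_le_sum fun i _ => ?_
    unfold lev
    split_ifs <;> omega
  have h1 := h.2 (Nat.find hex) 0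
  have h2 := h.1 0
  have z1 := zeros_add l
  have z2 := zeros_add m
  omega

theorem noZero_iff {n : ℕ} (l : Wt n) : NoZero l ↔ zeros l = 0 := by
  unfold NoZero zeros
  rw [Finset.card_eq_zero, Finset.filter_eq_empty_iff]
  simp

theorem noZero_of_succeq {n : ℕ} {l m : Wt n} (hm : IsDominant m) (h : Succeq l m)
    (hz : NoZero m) : NoZero l := by
  rw [noZero_iff] at *
  have := zeros_le_of_succeq hm h
  omega

/-! ### The space `Eⁿ` -/

/-- The coefficient of `L_m` in `E_l`. -/
def stdCoef {n : ℕ} (l m : Wt n) : Qq := barQ (uCoef (-w0 l) (-w0 m))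

theorem stdCoef_self {n : ℕ} {l : Wt n} (hl : IsDominant l) : stdCoef l l = 1 := by
  rw [stdCoef, uCoef_self hl.neg_w0, map_one]

theorem stdCoef_mem {n : ℕ} {l m : Wt n} (hm : IsDominant m) (h : m ≠ l) :
    stdCoef l m ∈ qInvZ :=
  barQ_mem_qInvZ (uCoef_mem_qZ hm.neg_w0 fun e => h (by
    rw [← w0_w0 m, ← w0_w0 l, neg_injective e]))

/-- Induction on dominant weights along the Bruhat order. -/
theorem dom_induction {n : ℕ} {P : Wt n → Prop}
    (h : ∀ l, IsDominant l → (∀ m, IsDominant m → Succeq l m → m ≠ l → P m) → P l) :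
    ∀ l, IsDominant l → P l := by
  have main : ∀ N l, IsDominant l → (finite_isDominant l).toFinset.card ≤ N → P l := by
    intro N
    induction N with
    | zero =>
      intro l hl hN
      rw [Nat.le_zero, Finset.card_eq_zero] at hN
      have : l ∈ (finite_isDominant l).toFinset :=
        (Set.Finite.mem_toFinset _).2 ⟨hl, succeq_refl l⟩
      rw [hN] at this
      exact absurd this (Finset.notMem_empty l)
    | succ N ih =>
      intro l hl hN
      refine h l hl fun m hm hlm hne => ih m hm ?_
      have : (finite_isDominant m).toFinset.card < (finite_isDominant l).toFinset.card := by
        refine Finset.card_lt_card ⟨fun k hk => ?_, fun h' => ?_⟩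
        · rw [Set.Finite.mem_toFinset] at *
          exact ⟨hk.1, succeq_trans hlm hk.2⟩
        · have : l ∈ (finite_isDominant m).toFinset :=
            h' ((Set.Finite.mem_toFinset _).2 ⟨hl, succeq_refl l⟩)
          rw [Set.Finite.mem_toFinset] at this
          exact hne (succeq_antisymm this.2 hlm)
      omega
  exact fun l hl => main _ l hl le_rfl

theorem stdE_eq {n : ℕ} {l : Wt n} (hl : IsDominant l) :
    stdE l = dualCan l
      + ∑ m ∈ (finite_isDominant l).toFinset.erase l, stdCoef l m • dualCan m := by
  have h1 : stdE l = ∑ m ∈ (finite_isDominant l).toFinset, stdCoef l m • dualCan m :=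
    finsum_mem_eq_finite_toFinset_sum (fun m => stdCoef l m • dualCan m) (finite_isDominant l)
  have h2 : l ∈ (finite_isDominant l).toFinset :=
    (Set.Finite.mem_toFinset _).2 ⟨hl, succeq_refl l⟩
  rw [h1, ← Finset.add_sum_erase _ _ h2, stdCoef_self hl, one_smul]

theorem mem_erase_iff {n : ℕ} {l m : Wt n} :
    m ∈ (finite_isDominant l).toFinset.erase l ↔ m ≠ l ∧ IsDominant m ∧ Succeq l m := by
  rw [Finset.mem_erase, Set.Finite.mem_toFinset]; rfl

/-- A family of `E_λ` which is closed under going down spans the same space as the corresponding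
`L_λ`. -/
theorem span_stdE {n : ℕ} (P : Wt n → Prop)
    (hP : ∀ l m, IsDominant m → Succeq l m → P l → P m) :
    Submodule.span Qq {x | ∃ l : Wt n, (IsDominant l ∧ P l) ∧ x = stdE l}
      = Submodule.span Qq (dualCan '' {l : Wt n | IsDominant l ∧ P l}) := by
  refine le_antisymm (Submodule.span_le.2 ?_) (Submodule.span_le.2 ?_)
  · rintro _ ⟨l, ⟨hl, hPl⟩, rfl⟩
    rw [SetLike.mem_coe, stdE_eq hl]
    refine Submodule.add_mem _ (Submodule.subset_span ⟨l, ⟨hl, hPl⟩, rfl⟩)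
      (Submodule.sum_mem _ fun m hm => Submodule.smul_mem _ _ ?_)
    rw [mem_erase_iff] at hm
    exact Submodule.subset_span ⟨m, ⟨hm.2.1, hP l m hm.2.1 hm.2.2 hPl⟩, rfl⟩
  · rintro _ ⟨l, ⟨hl, hPl⟩, rfl⟩
    revert hPl
    refine dom_induction (P := fun l => P l → dualCan l ∈ Submodule.span Qq
      {x | ∃ l : Wt n, (IsDominant l ∧ P l) ∧ x = stdE l}) (fun l hl ih hPl => ?_) l hl
    rw [← sub_eq_of_eq_add (stdE_eq hl)]
    refine Submodule.sub_mem _ (Submodule.subset_span ⟨l, ⟨hl, hPl⟩, rfl⟩)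
      (Submodule.sum_mem _ fun m hm => Submodule.smul_mem _ _ ?_)
    rw [mem_erase_iff] at hm
    exact ih m hm.2.1 hm.2.2 hm.1 (hP l m hm.2.1 hm.2.2 hPl)

theorem En_eq (n : ℕ) :
    En n = Submodule.span Qq (dualCan '' {l : Wt n | IsDominant l}) := by
  have := span_stdE (n := n) (fun _ => True) fun _ _ _ _ _ => trivial
  simp only [and_true] at this
  exact this

theorem En0_eq (n : ℕ) :
    En0 n = Submodule.span Qq (dualCan '' {l : Wt n | IsDominant l ∧ ¬NoZero l}) :=
  span_stdE _ fun _ _ hm h hl hz => hl (noZero_of_succeq hm h hz)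

theorem dualCan_mem_THat {n : ℕ} (l : Wt n) : dualCan l ∈ THat n :=
  ⟨{l}, fun m hm => ⟨l, Finset.mem_singleton_self l, (isDualCanonical_dualCan l).support m hm⟩⟩

/-- The bar involution preserves the span of any set of dual canonical basis vectors. -/
theorem bar_mem_span {n : ℕ} (S : Set (Wt n)) {x : FT n}
    (hx : x ∈ Submodule.span Qq (dualCan '' S)) :
    x ∈ THat n ∧ bar n x ∈ Submodule.span Qq (dualCan '' S) := by
  induction hx using Submodule.span_induction with
  | mem x hx =>
    obtain ⟨l, hl, rfl⟩ := hx
    refine ⟨dualCan_mem_THat l, ?_⟩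
    rw [(isDualCanonical_dualCan l).bar_eq]
    exact Submodule.subset_span ⟨l, hl, rfl⟩
  | zero =>
    rw [bar_zero]
    exact ⟨Submodule.zero_mem _, Submodule.zero_mem _⟩
  | add x y _ _ hx hy =>
    rw [bar_add hx.1 hy.1]
    exact ⟨Submodule.add_mem _ hx.1 hy.1, Submodule.add_mem _ hx.2 hy.2⟩
  | smul r x _ hx =>
    rw [bar_smul _ hx.1]
    exact ⟨Submodule.smul_mem _ _ hx.1, Submodule.smul_mem _ _ hx.2⟩

theorem En_le_THat (n : ℕ) : En n ≤ THat n := fun x hx => by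
  rw [En_eq] at hx
  exact (bar_mem_span _ hx).1

theorem bar_mem_En {n : ℕ} {x : FT n} (hx : x ∈ En n) : bar n x ∈ En n := by
  rw [En_eq] at *
  exact (bar_mem_span _ hx).2

theorem bar_mem_En0 {n : ℕ} {x : FT n} (hx : x ∈ En0 n) : bar n x ∈ En0 n := by
  rw [En0_eq] at *
  exact (bar_mem_span _ hx).2

theorem dualCan_mem_En {n : ℕ} {l : Wt n} (hl : IsDominant l) : dualCan l ∈ En n := by
  rw [En_eq]
  exact Submodule.subset_span ⟨l, hl, rfl⟩

theorem dualCan_mem_En0 {n : ℕ} {l : Wt n} (hl : IsDominant l) (hz : ¬NoZero l) :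
    dualCan l ∈ En0 n := by
  rw [En0_eq]
  exact Submodule.subset_span ⟨l, ⟨hl, hz⟩, rfl⟩

theorem exists_maximal {n : ℕ} (s : Finset (Wt n)) (hs : s.Nonempty) :
    ∃ m ∈ s, ∀ l ∈ s, Succeq l m → l = m := by
  classical
  induction s using Finset.induction_on with
  | empty => exact absurd hs Finset.not_nonempty_empty
  | insert a s _ ih =>
    rcases s.eq_empty_or_nonempty with rfl | hs'
    · refine ⟨a, by simp, fun l hl _ => by simpa using hl⟩
    · obtain ⟨m, hm, h⟩ := ih hs'
      by_cases ha : Succeq a m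
      · refine ⟨a, Finset.mem_insert_self a s, fun l hl hla => ?_⟩
        rcases Finset.mem_insert.1 hl with rfl | hl
        · rfl
        · have := h l hl (succeq_trans hla ha)
          subst this
          exact succeq_antisymm hla ha
      · refine ⟨m, Finset.mem_insert_of_mem hm, fun l hl hlm => ?_⟩
        rcases Finset.mem_insert.1 hl with rfl | hl
        · exact absurd hlm ha
        · exact h l hl hlm

theorem linearIndependent_dualCan (n : ℕ) :
    LinearIndependent Qq (dualCan : Wt n → FT n) := by
  classical
  rw [linearIndependent_iff']
  intro s g hg
  by_contra h
  push Not at h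
  obtain ⟨i, hi, hgi⟩ := h
  obtain ⟨m, hm, hmax⟩ := exists_maximal (s.filter fun i => g i ≠ 0)
    ⟨i, Finset.mem_filter.2 ⟨hi, hgi⟩⟩
  rw [Finset.mem_filter] at hm
  have e := congrFun hg m
  rw [Finset.sum_apply, Finset.sum_eq_single_of_mem m hm.1] at e
  · rw [Pi.smul_apply, (isDualCanonical_dualCan m).leading, smul_eq_mul] at e
    exact mul_ne_zero hm.2 (pow_ne_zero _ (inv_ne_zero two_ne_zero')) e
  · intro l hl hlm
    by_contra h0
    rw [Pi.smul_apply, smul_eq_mul] at h0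
    exact hlm (hmax l (Finset.mem_filter.2 ⟨hl, left_ne_zero_of_mul h0⟩)
      ((isDualCanonical_dualCan l).support m (right_ne_zero_of_mul h0)))

/-! ### The quotient without zero parts -/

/-- `𝐋_λ`, the image of `L_λ` in `E^{n,×}`. -/
def bfL {n : ℕ} (l : DomX n) : EnX n := proj n ⟨dualCan l.1, dualCan_mem_En l.2.1⟩

theorem proj_eq_zero {n : ℕ} {x : FT n} (hx : x ∈ En n) (h : x ∈ En0 n) :
    proj n ⟨x, hx⟩ = 0 :=
  (Submodule.Quotient.mk_eq_zero _).2 h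

theorem linearIndependent_bfL (n : ℕ) : LinearIndependent Qq (bfL : DomX n → EnX n) := by
  classical
  have hd := (linearIndependent_dualCan n).disjoint_span_image
    (s := {l | IsDominant l ∧ NoZero l}) (t := {l | IsDominant l ∧ ¬NoZero l})
    (Set.disjoint_left.2 fun l h1 h2 => h2.2 h1.2)
  rw [linearIndependent_iff']
  intro s g hg
  have h1 : ∑ l ∈ s, g l • dualCan l.1 ∈ En0 n := by
    have e : proj n (∑ l ∈ s, g l • ⟨dualCan l.1, dualCan_mem_En l.2.1⟩) = 0 := by
      rw [map_sum, ← hg]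
      exact Finset.sum_congr rfl fun l _ => map_smul _ _ _
    have := (Submodule.Quotient.mk_eq_zero _).1 e
    rw [Submodule.submoduleOf, Submodule.mem_comap, map_sum] at this
    exact this
  have h2 : ∑ l ∈ s, g l • dualCan l.1
      ∈ Submodule.span Qq (dualCan '' {l : Wt n | IsDominant l ∧ NoZero l}) :=
    Submodule.sum_mem _ fun l _ => Submodule.smul_mem _ _ (Submodule.subset_span ⟨l.1, l.2, rfl⟩)
  rw [En0_eq] at h1
  have h3 := (Submodule.disjoint_def.1 hd) _ h2 h1
  exact linearIndependent_iff'.1 ((linearIndependent_dualCan n).comp (fun l : DomX n => l.1)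
    Subtype.val_injective) s g h3

theorem span_bfL (n : ℕ) : Submodule.span Qq (Set.range (bfL : DomX n → EnX n)) = ⊤ := by
  rw [eq_top_iff]
  rintro y -
  obtain ⟨⟨x, hx⟩, rfl⟩ := Submodule.Quotient.mk_surjective _ y
  change proj n ⟨x, hx⟩ ∈ _
  have hx' := hx
  rw [En_eq] at hx'
  induction hx' using Submodule.span_induction with
  | mem x h =>
    obtain ⟨l, hl, rfl⟩ := h
    by_cases hz : NoZero l
    · exact Submodule.subset_span ⟨⟨l, hl, hz⟩, rfl⟩
    · rw [proj_eq_zero hx (dualCan_mem_En0 hl hz)]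
      exact Submodule.zero_mem _
  | zero =>
    rw [proj_eq_zero hx (Submodule.zero_mem _)]
    exact Submodule.zero_mem _
  | add x y h1 h2 ih1 ih2 =>
    rw [← En_eq] at h1 h2
    have : proj n ⟨x + y, hx⟩ = proj n ⟨x, h1⟩ + proj n ⟨y, h2⟩ := map_add (proj n) ⟨x, h1⟩ ⟨y, h2⟩
    rw [this]
    exact Submodule.add_mem _ (ih1 h1) (ih2 h2)
  | smul r x h ih =>
    rw [← En_eq] at h
    have : proj n ⟨r • x, hx⟩ = r • proj n ⟨x, h⟩ := map_smul (proj n) r ⟨x, h⟩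
    rw [this]
    exact Submodule.smul_mem _ _ (ih h)

/-- The bar involution of `Eⁿ`. -/
def barEn (n : ℕ) : En n →ₛₗ[barQ] En n where
  toFun x := ⟨bar n x, bar_mem_En x.2⟩
  map_add' x y := Subtype.ext (bar_add (En_le_THat n x.2) (En_le_THat n y.2))
  map_smul' r x := Subtype.ext (bar_smul r (En_le_THat n x.2))

/-- The induced bar involution of `E^{n,×}`. -/
def barEnX (n : ℕ) : EnX n →ₛₗ[barQ] EnX n :=
  Submodule.mapQ _ _ (barEn n) fun _ hx => bar_mem_En0 hx

theorem barEnX_proj {n : ℕ} (x : En n) :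
    barEnX n (proj n x) = proj n ⟨bar n x, bar_mem_En x.2⟩ := rfl

theorem barEnX_barEnX {n : ℕ} (y : EnX n) : barEnX n (barEnX n y) = y := by
  obtain ⟨x, rfl⟩ := Submodule.Quotient.mk_surjective _ y
  change barEnX n (barEnX n (proj n x)) = proj n x
  rw [barEnX_proj, barEnX_proj]
  congr 1
  exact Subtype.ext (bar_bar (En_le_THat n x.2))

theorem barEnX_bfL {n : ℕ} (l : DomX n) : barEnX n (bfL l) = bfL l := by
  unfold bfL
  rw [barEnX_proj]
  congr 1
  exact Subtype.ext (isDualCanonical_dualCan l.1).bar_eq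

/-- The group `∑_{μ ≺ λ} q⁻¹ℤ[q⁻¹] 𝐄_μ`. -/
def lowerE {n : ℕ} (l : DomX n) : AddSubgroup (EnX n) := AddSubgroup.closure
  {y | ∃ m : DomX n, Succeq l.1 m.1 ∧ m ≠ l ∧ ∃ p ∈ qInvZ, y = p • bfE m}

/-- If `μ ≺ λ`, then multiplication by an element of `q⁻¹ℤ[q⁻¹]` maps the lower terms of `𝐄_μ` to
lower terms of `𝐄_λ`. -/
theorem smul_mem_lowerE {n : ℕ} {l m : DomX n} (h : Succeq l.1 m.1) (hne : m ≠ l) {p : Qq}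
    (hp : p ∈ qInvZ) {y : EnX n} (hy : y ∈ lowerE m) : p • y ∈ lowerE l := by
  induction hy using AddSubgroup.closure_induction with
  | mem y hy =>
    obtain ⟨k, hk, hkm, r, hr, rfl⟩ := hy
    refine AddSubgroup.subset_closure ⟨k, succeq_trans h hk, fun e => hne ?_, _,
      mul_mem_qInvZ hp hr, smul_smul _ _ _⟩
    subst e
    exact Subtype.ext (succeq_antisymm hk h)
  | zero => rw [smul_zero]; exact zero_mem _
  | add x y _ _ hx hy => rw [smul_add]; exact add_mem hx hy
  | neg x _ hx => rw [smul_neg]; exact neg_mem hx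

/-- The expansion of `𝐄_λ`: the `L_μ` with a zero part disappear in the quotient. -/
theorem bfE_eq {n : ℕ} (l : DomX n) : ∃ S : Finset (DomX n),
    (∀ m ∈ S, m ≠ l ∧ Succeq l.1 m.1) ∧ bfE l = bfL l + ∑ m ∈ S, stdCoef l.1 m.1 • bfL m := by
  classical
  set S₀ := (finite_isDominant l.1).toFinset.erase l.1 with hS₀
  let f : Wt n → EnX n := fun m => if h : IsDominant m then
    stdCoef l.1 m • proj n ⟨dualCan m, dualCan_mem_En h⟩ else 0
  have h1 : bfE l = bfL l + ∑ m ∈ S₀, f m := by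
    have e : (⟨stdE l.1, stdE_mem l⟩ : En n) = ⟨dualCan l.1, dualCan_mem_En l.2.1⟩
        + ∑ m ∈ S₀, if h : IsDominant m then stdCoef l.1 m • ⟨dualCan m, dualCan_mem_En h⟩
          else 0 := by
      refine Subtype.ext ?_
      rw [Submodule.coe_add, Submodule.coe_sum]
      change stdE l.1 = _
      rw [stdE_eq l.2.1]
      congr 1
      refine Finset.sum_congr rfl fun m hm => ?_
      rw [hS₀, mem_erase_iff] at hm
      rw [dif_pos hm.2.1]
      rfl
    unfold bfE bfL
    rw [e, map_add, map_sum]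
    congr 1
    refine Finset.sum_congr rfl fun m _ => ?_
    simp only [f]
    split_ifs with h
    · exact map_smul _ _ _
    · exact map_zero _
  refine ⟨S₀.subtype fun m => IsDominant m ∧ NoZero m, fun m hm => ?_, ?_⟩
  · rw [Finset.mem_subtype, hS₀, mem_erase_iff] at hm
    exact ⟨fun e => hm.1 (by rw [e]), hm.2.2⟩
  · rw [h1]
    congr 1
    rw [← Finset.sum_filter_add_sum_filter_not S₀ (fun m => IsDominant m ∧ NoZero m) f]
    rw [Finset.sum_eq_zero (s := S₀.filter fun m => ¬(IsDominant m ∧ NoZero m)), add_zero,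
      ← Finset.subtype_map (p := fun m => IsDominant m ∧ NoZero m), Finset.sum_map]
    · refine Finset.sum_congr rfl fun m _ => ?_
      exact dif_pos m.2.1
    · intro m hm
      rw [Finset.mem_filter] at hm
      simp only [f]
      split_ifs with h
      · rw [proj_eq_zero _ (dualCan_mem_En0 h fun hz => hm.2 ⟨h, hz⟩), smul_zero]
      · rfl

/-- The triangular relation between the `𝐄_λ` and the `𝐋_λ` is inverted by induction. -/
theorem bfL_sub_bfE_mem {n : ℕ} (l : DomX n) : bfL l - bfE l ∈ lowerE l := by
  obtain ⟨l, hl⟩ := l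
  have h0 := hl.1
  revert hl
  refine dom_induction (P := fun l => ∀ hl : IsDominant l ∧ NoZero l,
    bfL (⟨l, hl⟩ : DomX n) - bfE ⟨l, hl⟩ ∈ lowerE ⟨l, hl⟩) (fun l _ ih hl => ?_) l h0
  obtain ⟨S, hS, e⟩ := bfE_eq ⟨l, hl⟩
  rw [e, sub_add_cancel_left]
  refine neg_mem (sum_mem fun m hm => ?_)
  obtain ⟨h1, h2⟩ := hS m hm
  have hne : m.1 ≠ l := fun e => h1 (Subtype.ext e)
  have hc := stdCoef_mem (l := l) m.2.1 hne
  have e2 : bfL m = bfE m + (bfL m - bfE m) := by abel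
  rw [e2, smul_add]
  exact add_mem (AddSubgroup.subset_closure ⟨m, h2, h1, _, hc, rfl⟩)
    (smul_mem_lowerE h2 h1 hc (ih m.1 m.2.1 h2 hne m.2))

/-- The elements of `lowerE l` are combinations of the `𝐋_μ` with coefficients in
`q⁻¹ℤ[q⁻¹]`. -/
theorem exists_of_mem_lowerE {n : ℕ} {l : DomX n} {y : EnX n} (hy : y ∈ lowerE l) :
    ∃ f : DomX n →₀ Qq, (∀ m, f m ∈ qInvZ) ∧ y = Finsupp.linearCombination Qq bfL f := by
  classical
  have hsingle : ∀ (m : DomX n) {p : Qq}, p ∈ qInvZ →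
      ∀ k, Finsupp.single m p k ∈ qInvZ := fun m p hp k => by
    rw [Finsupp.single_apply]
    split_ifs
    · exact hp
    · exact zero_mem_qInvZ
  have hsum : ∀ (S : Finset (DomX n)) (g : DomX n → Qq), (∀ m ∈ S, g m ∈ qInvZ) →
      ∃ f : DomX n →₀ Qq, (∀ m, f m ∈ qInvZ) ∧
        ∑ m ∈ S, g m • bfL m = Finsupp.linearCombination Qq bfL f := fun S g hg => by
    refine ⟨∑ m ∈ S, Finsupp.single m (g m), fun k => ?_, ?_⟩
    · rw [Finsupp.finsetSum_apply]
      exact Finset.sum_induction _ (· ∈ qInvZ) (fun _ _ => add_mem_qInvZ) zero_mem_qInvZ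
        fun m hm => hsingle m (hg m hm) k
    · rw [map_sum]
      exact Finset.sum_congr rfl fun m _ => (Finsupp.linearCombination_single _ _ _).symm
  induction hy using AddSubgroup.closure_induction with
  | mem y hy =>
    obtain ⟨m, -, -, p, hp, rfl⟩ := hy
    obtain ⟨S, hS, e⟩ := bfE_eq m
    obtain ⟨f, hf, hf'⟩ := hsum S (fun k => p * stdCoef m.1 k.1) fun k hk =>
      mul_mem_qInvZ hp (stdCoef_mem k.2.1 fun e => (hS k hk).1 (Subtype.ext e))
    refine ⟨Finsupp.single m p + f, fun k => ?_, ?_⟩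
    · rw [Finsupp.add_apply]
      exact add_mem_qInvZ (hsingle m hp k) (hf k)
    · rw [e, smul_add, Finset.smul_sum, map_add, Finsupp.linearCombination_single, ← hf']
      congr 1
      exact Finset.sum_congr rfl fun k _ => smul_smul _ _ _
  | zero => exact ⟨0, fun _ => zero_mem_qInvZ, (map_zero _).symm⟩
  | add x y _ _ hx hy =>
    obtain ⟨f, hf, rfl⟩ := hx
    obtain ⟨g, hg, rfl⟩ := hy
    exact ⟨f + g, fun m => add_mem_qInvZ (hf m) (hg m), (map_add _ _ _).symm⟩
  | neg x _ hx =>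
    obtain ⟨f, hf, rfl⟩ := hx
    exact ⟨-f, fun m => neg_mem_qInvZ (hf m), (map_neg _ _).symm⟩

theorem isBarBasis_bfL (n : ℕ) : IsBarBasis (barEnX n) (bfL : DomX n → EnX n) where
  linearIndependent := linearIndependent_bfL n
  span_eq_top := span_bfL n
  bar_eq := barEnX_bfL
  triangular := bfL_sub_bfE_mem

/-- Uniqueness: the difference of two candidates is a bar-invariant combination of the `𝐋_μ` with
coefficients in `q⁻¹ℤ[q⁻¹]`. -/
theorem IsBarBasis.eq_bfL {n : ℕ} {B : DomX n → EnX n} (hB : IsBarBasis (barEnX n) B) :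
    B = bfL := by
  funext l
  have h : B l - bfL l ∈ lowerE l := by
    have := sub_mem (hB.triangular l) (bfL_sub_bfE_mem l)
    rwa [sub_sub_sub_cancel_right] at this
  obtain ⟨f, hf, e⟩ := exists_of_mem_lowerE h
  have hbar : barEnX n (Finsupp.linearCombination Qq bfL f)
      = Finsupp.linearCombination Qq bfL (f.mapRange barQ (map_zero barQ)) := by
    rw [Finsupp.linearCombination_apply, Finsupp.linearCombination_apply,
      Finsupp.sum_mapRange_index (h := fun m a => a • bfL m) (fun m => zero_smul Qq (bfL m)),
      Finsupp.sum, Finsupp.sum, map_sum]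
    exact Finset.sum_congr rfl fun m _ => by rw [map_smulₛₗ, barEnX_bfL]
  have hinv : barEnX n (B l - bfL l) = B l - bfL l := by
    rw [map_sub, hB.bar_eq, barEnX_bfL]
  rw [e, hbar] at hinv
  have hff := (linearIndependent_bfL n).finsuppLinearCombination_injective hinv
  have hf0 : f = 0 := Finsupp.ext fun m => eq_zero_of_barQ_eq (hf m) (by
    have := DFunLike.congr_fun hff m
    rwa [Finsupp.mapRange_apply] at this)
  rw [hf0, map_zero] at e
  exact sub_eq_zero.1 e

end

end QueerFock

theorem mainTheorem8 (n : ℕ) (hn : 1 ≤ n) :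
    ∃ (hbar : ∀ x ∈ QueerFock.En n, QueerFock.bar n x ∈ QueerFock.En n)
      (hL : ∀ l : QueerFock.Wt n, QueerFock.IsDominant l → QueerFock.dualCan l ∈ QueerFock.En n),
      (∀ x ∈ QueerFock.En0 n, QueerFock.bar n x ∈ QueerFock.En0 n) ∧
      ∃ β : QueerFock.EnX n →ₛₗ[QueerFock.barQ] QueerFock.EnX n,
        (∀ x : QueerFock.En n,
          β (QueerFock.proj n x) = QueerFock.proj n ⟨QueerFock.bar n x, hbar x x.2⟩) ∧
        (∀ y, β (β y) = y) ∧
        QueerFock.IsBarBasis β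
          (fun l => QueerFock.proj n ⟨QueerFock.dualCan l.1, hL l.1 l.2.1⟩) ∧
        ∀ B : QueerFock.DomX n → QueerFock.EnX n, QueerFock.IsBarBasis β B →
          B = fun l => QueerFock.proj n ⟨QueerFock.dualCan l.1, hL l.1 l.2.1⟩ :=
  ⟨fun _ hx => QueerFock.bar_mem_En hx, fun _ hl => QueerFock.dualCan_mem_En hl,
    fun _ hx => QueerFock.bar_mem_En0 hx, QueerFock.barEnX n, QueerFock.barEnX_proj,
    QueerFock.barEnX_barEnX, QueerFock.isBarBasis_bfL n, fun _ hB => hB.eq_bfL⟩
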